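/- Let $N\subseteq B(\mathcal H_0)$ be a von Neumann algebra with a faithful normal semifinite tracial weight $\tau\colon N_+\to[0,\infty]$; that is, $\tau$ is additive and positively homogeneous, $\tau(x^*x)=\tau(xx^*)$ for all $x\in N$, $\tau(x)=0$ only for $x=0$, $\tau(\sup_i x_i)=\sup_i\tau(x_i)$ for every bounded increasing net in $N_+$, and every non-zero $x\in N_+$ dominates a non-zero $y\in N_+$ with $\tau(y)<\infty$. Let $L^2(N,\tau)$ be the completion of $\{x\in N:\tau(x^*x)<\infty\}$ for the inner product $\langle x,y\rangle=\tau(y^*x)$, on which $N$ acts by left multiplication, and let $J_\tau$ be the conjugate linear isometry of $L^2(N,\tau)$ extending $x\mapsto x^*$. A left $(N,\tau)$-module is a Hilbert space $\mathcal H$ with a normal unital $*$-homomorphism $\pi\colon N\to B(\mathcal H)$. A standard intertwiner for $(\mathcal H,\pi)$ is an isometry $v\colon\mathcal H\to L^2(N,\tau)\otimes\mathcal K$, where $\mathcal K=\ell^2(I)$ for some set $I$, such that $v\pi(x)=(x\otimes1)v$ for all $x\in N$. Here $L^2(N,\tau)\otimes \ell^2(I)=\bigoplus_{i\in I}L^2(N,\tau)$,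 $J_\tau\otimes 1$ is $J_\tau$ applied in each coordinate, $N\bar\otimes B(\ell^2(I))$ consists of the bounded operators all of whose matrix entries lie in $N$, and $(\tau\otimes\mathrm{Tr})(T)=\sum_{i\in I}\tau(T_{ii})$ for positive $T\in N\bar\otimes B(\ell^2(I))$. The Murray--von Neumann dimension of $(\mathcal H,\pi)$ is $$\dim_{(N,\tau)}(\mathcal H,\pi):=(\tau\otimes\mathrm{Tr})\big[(J_\tau\otimes1)vv^*(J_\tau\otimes1)\big]$$ for any standard intertwiner $v$, and Petersen's dimension is $$\dim'_{(N,\tau)}(\mathcal H,\pi):=\sup\{\tau(p)\dim_{(pNp,\tau_p)}(\pi(p)\mathcal H,\pi|_{pNp}) : p\in N\text{ a projection with }\tau(p)<\infty\},$$ where $\tau_p=\tau(p)^{-1}\tau(p\,\cdot\,p)$ on $pNp$ (the term for $p=0$ is $0$). Then, for every left $(N,\tau)$-module $(\mathcal H,\pi)$, standard intertwiners exist; for every standard intertwiner $v$ the operator $(J_\tau\otimes1)vv^*(J_\tau\otimes1)$ belongs to $N\bar\otimes B(\ell^2(I))$ and its value under $\tau\otimes\mathrm{Tr}$ is the same number $\dim_{(N,\tau)}(\mathcal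 H,\pi)\in[0,\infty]$; and $$\dim'_{(N,\tau)}(\mathcal H,\pi)=\dim_{(N,\tau)}(\mathcal H,\pi).$$ -/

import Mathlib

open scoped ENNReal NNReal

universe u₀ u w

noncomputable section

namespace VNDim

/-! ### Tracial weights on a von Neumann algebra -/

section Weights

variable {H₀ : Type u₀} [NormedAddCommGroup H₀] [InnerProductSpace ℂ H₀] [CompleteSpace H₀]

/-- The elements of the von Neumann algebra `N`, as a unital `*`-algebra ordered by the
Loewner order of operators. -/
abbrev Elem (N : VonNeumannAlgebra H₀) : Type u₀ := N.toStarSubalgebra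

/-- A tracial weight `τ : N₊ → [0,∞]`. It is represented by a function on all of `N`, of which only
the values on the positive cone `N₊` carry information (and are ever used below). -/
structure TracialWeight (N : VonNeumannAlgebra H₀) where
  toFun : Elem N → ℝ≥0∞
  add_of_nonneg : ∀ x y : Elem N, 0 ≤ x → 0 ≤ y → toFun (x + y) = toFun x + toFun y
  smul_of_nonneg : ∀ (c : ℝ≥0) (x : Elem N), 0 ≤ x → toFun (((c : ℝ) : ℂ) • x) = c * toFun x
  tracial : ∀ x : Elem N, toFun (star x * x) = toFun (x * star x)

variable {N : VonNeumannAlgebra H₀}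

namespace TracialWeight

instance : CoeFun (TracialWeight N) fun _ => Elem N → ℝ≥0∞ := ⟨TracialWeight.toFun⟩

/-- `τ(x) = 0` for `x ∈ N₊` only if `x = 0`. -/
def IsFaithful (τ : TracialWeight N) : Prop := ∀ x : Elem N, 0 ≤ x → τ x = 0 → x = 0

/-- `τ(sup D) = sup τ(D)` for every bounded upward directed family `D` in `N₊`. -/
def IsNormal (τ : TracialWeight N) : Prop :=
  ∀ D : Set (Elem N), (∀ d ∈ D, 0 ≤ d) → D.Nonempty → DirectedOn (· ≤ ·) D →
    ∀ x : Elem N, IsLUB D x → τ x = ⨆ d ∈ D, τ d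

/-- Semifiniteness of a trace: every non-zero positive element dominates a non-zero positive element
of finite trace. -/
def IsSemifinite (τ : TracialWeight N) : Prop :=
  ∀ x : Elem N, 0 ≤ x → x ≠ 0 → ∃ y : Elem N, 0 ≤ y ∧ y ≤ x ∧ y ≠ 0 ∧ τ y < ∞

end TracialWeight

theorem star_mul_self_nonneg' (x : Elem N) : 0 ≤ star x * x := by
  change (0 : H₀ →L[ℂ] H₀) ≤ star (x : H₀ →L[ℂ] H₀) * (x : H₀ →L[ℂ] H₀)
  exact star_mul_self_nonneg _

theorem add_nonneg' {x y : Elem N} (hx : 0 ≤ x) (hy : 0 ≤ y) : 0 ≤ x + y := by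
  have hx' : (0 : H₀ →L[ℂ] H₀) ≤ x := hx
  have hy' : (0 : H₀ →L[ℂ] H₀) ≤ y := hy
  change (0 : H₀ →L[ℂ] H₀) ≤ (x : H₀ →L[ℂ] H₀) + (y : H₀ →L[ℂ] H₀)
  exact add_nonneg hx' hy'

theorem sub_nonneg' {x y : Elem N} (h : x ≤ y) : 0 ≤ y - x := by
  have h' : (x : H₀ →L[ℂ] H₀) ≤ y := h
  change (0 : H₀ →L[ℂ] H₀) ≤ (y : H₀ →L[ℂ] H₀) - (x : H₀ →L[ℂ] H₀)
  exact sub_nonneg.2 h'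

theorem smul_nonneg' (c : ℝ≥0) {x : Elem N} (hx : 0 ≤ x) : 0 ≤ ((c : ℝ) : ℂ) • x := by
  have hx' : (0 : H₀ →L[ℂ] H₀) ≤ x := hx
  change (0 : H₀ →L[ℂ] H₀) ≤ ((c : ℝ) : ℂ) • (x : H₀ →L[ℂ] H₀)
  rw [ContinuousLinearMap.nonneg_iff_isPositive] at hx' ⊢
  exact hx'.smul_of_nonneg (by exact_mod_cast c.2)

/-- `y* x* x y ≤ ‖x‖² y* y`. -/
theorem conj_le (x y : Elem N) :
    star (x * y) * (x * y) ≤ (((‖x‖₊ ^ 2 : ℝ≥0) : ℝ) : ℂ) • (star y * y) := by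
  change star ((x : H₀ →L[ℂ] H₀) * y) * ((x : H₀ →L[ℂ] H₀) * y) ≤
    (((‖x‖₊ ^ 2 : ℝ≥0) : ℝ) : ℂ) • (star (y : H₀ →L[ℂ] H₀) * y)
  have h := CStarAlgebra.star_left_conjugate_le_norm_smul (a := (y : H₀ →L[ℂ] H₀))
    (b := star (x : H₀ →L[ℂ] H₀) * x)
  rw [CStarRing.norm_star_mul_self] at h
  have e : (((‖x‖₊ ^ 2 : ℝ≥0) : ℝ) : ℂ) • (star (y : H₀ →L[ℂ] H₀) * y) =
      (‖(x : H₀ →L[ℂ] H₀)‖ * ‖(x : H₀ →L[ℂ] H₀)‖) • (star (y : H₀ →L[ℂ] H₀) * y) := by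
    rw [Complex.coe_smul]; congr 1; simp [sq]
  rw [e]
  simpa [mul_assoc] using h

namespace TracialWeight

variable (τ : TracialWeight N)

theorem mono {x y : Elem N} (hx : 0 ≤ x) (h : x ≤ y) : τ x ≤ τ y := by
  have := τ.add_of_nonneg x (y - x) hx (sub_nonneg' h)
  rw [add_sub_cancel] at this
  rw [this]; exact le_self_add

theorem sq_smul (c : ℂ) (x : Elem N) :
    τ (star (c • x) * (c • x)) = (‖c‖₊ ^ 2 : ℝ≥0) * τ (star x * x) := by
  rw [← τ.smul_of_nonneg _ _ (star_mul_self_nonneg' x)]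
  congr 1
  rw [star_smul, smul_mul_smul_comm]
  congr 1
  simp [← Complex.normSq_eq_conj_mul_self, Complex.normSq_eq_norm_sq]

theorem sq_add_le (x y : Elem N) :
    τ (star (x + y) * (x + y)) ≤ 2 * (τ (star x * x) + τ (star y * y)) := by
  have h1 := τ.add_of_nonneg (star (x + y) * (x + y)) (star (x - y) * (x - y))
    (star_mul_self_nonneg' _) (star_mul_self_nonneg' _)
  have h2 := τ.smul_of_nonneg 2 (star x * x + star y * y)
    (add_nonneg' (star_mul_self_nonneg' _) (star_mul_self_nonneg' _))
  rw [τ.add_of_nonneg _ _ (star_mul_self_nonneg' _) (star_mul_self_nonneg' _)] at h2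
  have e : star (x + y) * (x + y) + star (x - y) * (x - y) =
      (((2 : ℝ≥0) : ℝ) : ℂ) • (star x * x + star y * y) := by
    simp only [star_add, star_sub, NNReal.coe_ofNat, Complex.ofReal_ofNat, two_smul]
    noncomm_ring
  rw [e, h2] at h1
  rw [show ((2 : ℝ≥0) : ℝ≥0∞) = 2 from rfl] at h1
  rw [h1]; exact le_self_add

/-! ### The Hilbert space `L²(N,τ)` -/

/-- The left ideal `{x ∈ N : τ(x*x) < ∞}`. -/
def sqrtDom : Submodule ℂ (Elem N) where
  carrier := {x | τ (star x * x) < ∞}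
  add_mem' {x y} hx hy := by
    refine (τ.sq_add_le x y).trans_lt ?_
    exact ENNReal.mul_lt_top (by simp) (ENNReal.add_lt_top.2 ⟨hx, hy⟩)
  zero_mem' := by
    have h := τ.sq_smul 0 0
    rw [zero_smul] at h
    change τ (star 0 * 0) < ∞
    rw [h]
    simp
  smul_mem' c x hx := by
    simp only [Set.mem_ofPred_eq, τ.sq_smul] at hx ⊢
    exact ENNReal.mul_lt_top (by simp) hx

/-- The left ideal `{x ∈ N : τ(x*x) < ∞}`, to be equipped with the inner product of `τ` (rather than
with the operator norm). -/
def PreL2 : Type u₀ := τ.sqrtDom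

instance : AddCommGroup τ.PreL2 := inferInstanceAs (AddCommGroup τ.sqrtDom)
instance : Module ℂ τ.PreL2 := inferInstanceAs (Module ℂ τ.sqrtDom)

/-- The inclusion of `{x ∈ N : τ(x*x) < ∞}` into `N`. -/
def PreL2.val : τ.PreL2 →ₗ[ℂ] Elem N := τ.sqrtDom.subtype

/-- An element of `N` with `τ(x*x) < ∞`, as a vector. -/
def PreL2.mk (x : Elem N) (hx : τ (star x * x) < ∞) : τ.PreL2 := (⟨x, hx⟩ : τ.sqrtDom)

variable {τ} in
theorem PreL2.ext {x y : τ.PreL2} (h : PreL2.val τ x = PreL2.val τ y) : x = y := Subtype.ext h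

@[simp] theorem PreL2.val_mk (x : Elem N) (hx : τ (star x * x) < ∞) :
    PreL2.val τ (PreL2.mk τ x hx) = x := rfl

theorem PreL2.lt_top (x : τ.PreL2) : τ (star (PreL2.val τ x) * PreL2.val τ x) < ∞ := x.2

/-- The quadratic form `x ↦ τ(x*x) ∈ [0,∞)`. -/
def quad (x : τ.PreL2) : ℝ := (τ (star (PreL2.val τ x) * PreL2.val τ x)).toReal

/-- `Re τ(x*y)`, by polarization. -/
def reInner (x y : τ.PreL2) : ℝ := (τ.quad (x + y) - τ.quad (x - y)) / 4

theorem quad_nonneg (x : τ.PreL2) : 0 ≤ τ.quad x := ENNReal.toReal_nonneg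

theorem quad_smul (c : ℂ) (x : τ.PreL2) : τ.quad (c • x) = ‖c‖ ^ 2 * τ.quad x := by
  rw [quad, map_smul, τ.sq_smul, ENNReal.toReal_mul]
  simp [quad]

theorem quad_neg (x : τ.PreL2) : τ.quad (-x) = τ.quad x := by
  simpa using τ.quad_smul (-1) x

theorem quad_zero : τ.quad 0 = 0 := by
  simpa using τ.quad_smul 0 0

theorem toReal_add {a b : Elem N} (ha : 0 ≤ a) (hb : 0 ≤ b) (ha' : τ a < ∞) (hb' : τ b < ∞) :
    (τ (a + b)).toReal = (τ a).toReal + (τ b).toReal ∧ τ (a + b) < ∞ := by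
  rw [τ.add_of_nonneg a b ha hb]
  exact ⟨ENNReal.toReal_add ha'.ne hb'.ne, ENNReal.add_lt_top.2 ⟨ha', hb'⟩⟩

theorem quad_add_three (a b c : τ.PreL2) :
    (τ (star (PreL2.val τ a) * PreL2.val τ a + star (PreL2.val τ b) * PreL2.val τ b +
      star (PreL2.val τ c) * PreL2.val τ c)).toReal = τ.quad a + τ.quad b + τ.quad c := by
  have h1 := τ.toReal_add (star_mul_self_nonneg' (PreL2.val τ a))
    (star_mul_self_nonneg' (PreL2.val τ b)) (PreL2.lt_top τ a) (PreL2.lt_top τ b)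
  have h2 := τ.toReal_add (add_nonneg' (star_mul_self_nonneg' (PreL2.val τ a))
    (star_mul_self_nonneg' (PreL2.val τ b))) (star_mul_self_nonneg' (PreL2.val τ c)) h1.2
    (PreL2.lt_top τ c)
  rw [h2.1, h1.1]; rfl

theorem reInner_add (x₁ x₂ y : τ.PreL2) :
    τ.reInner (x₁ + x₂) y = τ.reInner x₁ y + τ.reInner x₂ y := by
  have h1 := τ.quad_add_three (x₁ + x₂ + y) (x₁ - y) (x₂ - y)
  have h2 := τ.quad_add_three (x₁ + x₂ - y) (x₁ + y) (x₂ + y)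
  have e : ∀ a b c : Elem N, star (a + b + c) * (a + b + c) + star (a - c) * (a - c) +
      star (b - c) * (b - c) = star (a + b - c) * (a + b - c) + star (a + c) * (a + c) +
      star (b + c) * (b + c) := by
    intro a b c
    simp only [star_add, star_sub]
    noncomm_ring
  simp only [map_add, map_sub] at h1 h2
  rw [e, h2] at h1
  simp only [reInner]
  linarith

theorem reInner_comm (x y : τ.PreL2) : τ.reInner x y = τ.reInner y x := by
  rw [reInner, reInner, add_comm y x, ← τ.quad_neg (y - x), neg_sub]

theorem reInner_neg (x y : τ.PreL2) : τ.reInner (-x) y = -τ.reInner x y := by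
  have h1 := τ.quad_neg (x - y)
  have h2 := τ.quad_neg (x + y)
  rw [neg_sub, sub_eq_neg_add] at h1
  rw [neg_add, ← sub_eq_add_neg] at h2
  rw [reInner, reInner, h1, h2]; ring

theorem reInner_I_I (x y : τ.PreL2) :
    τ.reInner (Complex.I • x) (Complex.I • y) = τ.reInner x y := by
  simp [reInner, ← smul_add, ← smul_sub, τ.quad_smul]

theorem reInner_smul_nnreal (c : ℝ≥0) (x y : τ.PreL2) :
    τ.reInner (((c : ℝ) : ℂ) • x) y = c * τ.reInner x y := by
  have key : ∀ a b : τ.PreL2, (τ (star (PreL2.val τ a) * PreL2.val τ a +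
      ((c : ℝ) : ℂ) • (star (PreL2.val τ b) * PreL2.val τ b))).toReal =
      τ.quad a + c * τ.quad b := by
    intro a b
    have hs := τ.smul_of_nonneg c _ (star_mul_self_nonneg' (PreL2.val τ b))
    rw [(τ.toReal_add (star_mul_self_nonneg' _) (smul_nonneg' c (star_mul_self_nonneg' _))
      (PreL2.lt_top τ a) (by rw [hs]; exact ENNReal.mul_lt_top (by simp) (PreL2.lt_top τ b))).1, hs]
    simp [quad]
  have h1 := key (((c : ℝ) : ℂ) • x + y) (x - y)
  have h2 := key (((c : ℝ) : ℂ) • x - y) (x + y)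
  have e : ∀ a b : Elem N, star (((c : ℝ) : ℂ) • a + b) * (((c : ℝ) : ℂ) • a + b) +
      ((c : ℝ) : ℂ) • (star (a - b) * (a - b)) =
      star (((c : ℝ) : ℂ) • a - b) * (((c : ℝ) : ℂ) • a - b) +
      ((c : ℝ) : ℂ) • (star (a + b) * (a + b)) := by
    intro a b
    have hc : star (((c : ℝ) : ℂ)) = ((c : ℝ) : ℂ) := by simp
    simp only [star_add, star_sub, star_smul, hc, mul_add, add_mul, mul_sub, sub_mul,
      smul_mul_assoc, mul_smul_comm, smul_add, smul_sub]
    abel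
  simp only [map_add, map_sub, map_smul] at h1 h2
  rw [e, h2] at h1
  simp only [reInner]
  linarith

theorem reInner_smul_real (c : ℝ) (x y : τ.PreL2) :
    τ.reInner ((c : ℂ) • x) y = c * τ.reInner x y := by
  rcases le_total 0 c with h | h
  · exact τ.reInner_smul_nnreal ⟨c, h⟩ x y
  · lift -c to ℝ≥0 using by linarith with d hd
    have hc : (c : ℂ) = -((d : ℝ) : ℂ) := by rw [hd]; simp
    rw [hc, neg_smul, τ.reInner_neg, τ.reInner_smul_nnreal, hd]
    ring

theorem polarization_eq (x y : τ.PreL2) :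
    (((τ.quad (y + x) - τ.quad (y - x) : ℝ) : ℂ) +
        Complex.I * (τ.quad (y + Complex.I • x) - τ.quad (y - Complex.I • x) : ℝ)) / 4 =
      (τ.reInner x y : ℂ) + Complex.I * τ.reInner (Complex.I • x) y := by
  rw [τ.reInner_comm x, τ.reInner_comm _ y, reInner, reInner]
  push_cast; ring

/-- The inner product `τ(x*y)` (conjugate linear in `x`), by polarization:
`x*y = ¼ ∑ₖ iᵏ (y + iᵏ x)* (y + iᵏ x)`. -/
abbrev preL2Core : PreInnerProductSpace.Core ℂ τ.PreL2 where
  inner x y := ((τ.quad (y + x) - τ.quad (y - x) : ℝ) +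
    Complex.I * (τ.quad (y + Complex.I • x) - τ.quad (y - Complex.I • x) : ℝ)) / 4
  conj_inner_symm x y := by
    simp only [polarization_eq]
    have h2 : τ.reInner (Complex.I • y) x = - τ.reInner (Complex.I • x) y := by
      rw [← τ.reInner_I_I, smul_smul, Complex.I_mul_I, neg_one_smul, τ.reInner_neg,
        τ.reInner_comm]
    rw [h2, τ.reInner_comm y x]
    simp
  re_inner_nonneg x := by
    have h2 : τ.quad (x + x) = 4 * τ.quad x := by
      rw [← two_smul ℂ x, τ.quad_smul]; norm_num
    have := τ.quad_nonneg x
    simp [h2, τ.quad_zero]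
    exact this
  add_left x y z := by
    simp only [polarization_eq]
    simp only [smul_add, τ.reInner_add]
    push_cast; ring
  smul_left x y r := by
    simp only [polarization_eq]
    have h1 : r • x = (r.re : ℂ) • x + (r.im : ℂ) • (Complex.I • x) := by
      rw [smul_smul, ← add_smul, Complex.re_add_im]
    have h2 : Complex.I • r • x = (r.re : ℂ) • (Complex.I • x) + ((-r.im : ℝ) : ℂ) • x := by
      rw [smul_smul, smul_smul, ← add_smul]
      congr 1
      apply Complex.ext <;> simp
    rw [h2, h1, τ.reInner_add, τ.reInner_add, τ.reInner_smul_real, τ.reInner_smul_real,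
      τ.reInner_smul_real, τ.reInner_smul_real]
    apply Complex.ext <;> simp

instance : SeminormedAddCommGroup τ.PreL2 :=
  InnerProductSpace.Core.toSeminormedAddCommGroup (c := τ.preL2Core)
instance : InnerProductSpace ℂ τ.PreL2 := InnerProductSpace.ofCore τ.preL2Core

/-- `‖x‖² = τ(x*x)` in `L²(N,τ)`. -/
theorem norm_sq_preL2 (x : τ.PreL2) : ‖x‖ ^ 2 = τ.quad x := by
  rw [← inner_self_eq_norm_sq (𝕜 := ℂ)]
  change (((τ.quad (x + x) - τ.quad (x - x) : ℝ) +
    Complex.I * (τ.quad (x + Complex.I • x) - τ.quad (x - Complex.I • x) : ℝ)) / 4 : ℂ).re = _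
  have h2 : τ.quad (x + x) = 4 * τ.quad x := by
    rw [← two_smul ℂ x, τ.quad_smul]; norm_num
  have h3 : τ.quad (x + Complex.I • x) = τ.quad (x - Complex.I • x) := by
    have : x + Complex.I • x = Complex.I • (x - Complex.I • x) := by
      rw [smul_sub, smul_smul, Complex.I_mul_I, neg_one_smul, sub_neg_eq_add, add_comm]
    rw [this, τ.quad_smul]; simp
  simp [h2, h3, τ.quad_zero]

/-- The Hilbert space `L²(N,τ)`: the completion of `{x ∈ N : τ(x*x) < ∞}`. -/
abbrev L2 : Type u₀ := UniformSpace.Completion τ.PreL2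

theorem mul_mem_dom (x : Elem N) (y : τ.PreL2) :
    τ (star (x * PreL2.val τ y) * (x * PreL2.val τ y)) ≤
      (‖x‖₊ ^ 2 : ℝ≥0) * τ (star (PreL2.val τ y) * PreL2.val τ y) := by
  rw [← τ.smul_of_nonneg _ _ (star_mul_self_nonneg' _)]
  exact τ.mono (star_mul_self_nonneg' _) (conj_le _ _)

/-- Left multiplication `y ↦ x y` on `{y ∈ N : τ(y*y) < ∞}`. -/
def preLmul (x : Elem N) : τ.PreL2 →L[ℂ] τ.PreL2 :=
  LinearMap.mkContinuous
    { toFun := fun y => PreL2.mk τ (x * PreL2.val τ y) ((τ.mul_mem_dom x y).trans_lt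
        (ENNReal.mul_lt_top (by simp) (PreL2.lt_top τ y)))
      map_add' := fun a b => PreL2.ext (by simp [mul_add])
      map_smul' := fun c a => PreL2.ext (by simp) }
    ‖x‖ fun y => by
      rw [← sq_le_sq₀ (norm_nonneg _) (by positivity), mul_pow, norm_sq_preL2, norm_sq_preL2]
      have h := ENNReal.toReal_mono
        (ENNReal.mul_lt_top (by simp) (PreL2.lt_top τ y)).ne (τ.mul_mem_dom x y)
      simpa [quad] using h

/-- The representation `π_τ(x) y = x y` of `N` on `L²(N,τ)`. -/
def lmul (x : Elem N) : τ.L2 →L[ℂ] τ.L2 := (τ.preLmul x).completion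

/-- The conjugation `x ↦ x*` on `{x ∈ N : τ(x*x) < ∞}`. -/
def preJ : τ.PreL2 →L⋆[ℂ] τ.PreL2 :=
  LinearMap.mkContinuous
    { toFun := fun y => PreL2.mk τ (star (PreL2.val τ y)) (by
        rw [star_star, ← τ.tracial]; exact PreL2.lt_top τ y)
      map_add' := fun a b => PreL2.ext (by simp)
      map_smul' := fun c a => PreL2.ext (by simp) }
    1 fun y => by
      rw [one_mul, ← sq_le_sq₀ (norm_nonneg _) (norm_nonneg _), norm_sq_preL2, norm_sq_preL2]
      simp [quad, ← τ.tracial]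

/-- The modular conjugation `J_τ` of `L²(N,τ)`: the continuous extension of `x ↦ x*`, which is
isometric because `τ` is tracial. -/
def J : τ.L2 →L⋆[ℂ] τ.L2 := τ.preJ.completion

theorem norm_J_le (ξ : τ.L2) : ‖τ.J ξ‖ ≤ ‖ξ‖ := by
  induction ξ using UniformSpace.Completion.induction_on with
  | hp => exact isClosed_le (by fun_prop) (by fun_prop)
  | ih y =>
    rw [J, ContinuousLinearMap.completion_apply_coe, UniformSpace.Completion.norm_coe,
      UniformSpace.Completion.norm_coe]
    simpa using LinearMap.mkContinuous_norm_le _ zero_le_one _ |> (τ.preJ).le_of_opNorm_le (x := y)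

/-! ### The amplification `L²(N,τ) ⊗ ℓ²(ι)` and the trace `τ ⊗ Tr` -/

/-- The Hilbert space `L²(N,τ) ⊗ ℓ²(ι)`, realized as the `ℓ²`-direct sum of copies of `L²(N,τ)`
indexed by `ι`. -/
abbrev Amp (ι : Type w) : Type (max u₀ w) := lp (fun _ : ι => τ.L2) 2

variable {ι : Type w}

/-- The operator `T ⊗ 1` on `L²(N,τ) ⊗ ℓ²(ι)`. -/
def amplify (ι : Type w) (T : τ.L2 →L[ℂ] τ.L2) : τ.Amp ι →L[ℂ] τ.Amp ι :=
  lp.mapCLM 2 (fun _ => T) (norm_nonneg T) (fun _ => le_rfl)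

/-- The conjugate linear operator `J_τ ⊗ 1` on `L²(N,τ) ⊗ ℓ²(ι)`, i.e. `J_τ` applied in each
coordinate. -/
def ampJ (ι : Type w) : τ.Amp ι →L⋆[ℂ] τ.Amp ι :=
  LinearMap.mkContinuous
    { toFun := fun f => ⟨fun i => τ.J (f i), (lp.memℓp f).norm.mono
        (fun i => by simpa using τ.norm_J_le (f i)) |>.of_norm⟩
      map_add' := fun f g => by ext i; exact map_add τ.J (f i) (g i)
      map_smul' := fun c f => by ext i; exact map_smulₛₗ τ.J c (f i) }
    1 fun f => by
      rw [one_mul]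
      exact lp.norm_mono (by simp) fun i => τ.norm_J_le (f i)

open Classical in
/-- The isometry `ξ ↦ ξ ⊗ δᵢ` from `L²(N,τ)` to `L²(N,τ) ⊗ ℓ²(ι)`. -/
def coordEmb (i : ι) : τ.L2 →L[ℂ] τ.Amp ι :=
  lp.singleContinuousLinearMap ℂ (fun _ : ι => τ.L2) 2 i

/-- The matrix entry `T_{ij}`, an operator on `L²(N,τ)`, of an operator `T` on
`L²(N,τ) ⊗ ℓ²(ι)`. -/
def matrixEntry (T : τ.Amp ι →L[ℂ] τ.Amp ι) (i j : ι) : τ.L2 →L[ℂ] τ.L2 :=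
  (ContinuousLinearMap.adjoint (τ.coordEmb i)).comp (T.comp (τ.coordEmb j))

/-- `T` belongs to `N ⊗̄ B(ℓ²(ι))`, where `N` acts on `L²(N,τ)` by `π_τ`: all its matrix entries lie
in `π_τ(N)`. -/
def MemTensor (T : τ.Amp ι →L[ℂ] τ.Amp ι) : Prop :=
  ∀ i j, τ.matrixEntry T i j ∈ Set.range τ.lmul

/-- `τ` transported to `π_τ(N)₊`: the value at `π_τ(x)`, `x ∈ N₊`, is `τ(x)`. (For faithful
semifinite `τ` such an `x` is unique. The value is `∞` off `π_τ(N₊)`.) -/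
def opTrace (T : τ.L2 →L[ℂ] τ.L2) : ℝ≥0∞ :=
  ⨅ (x : Elem N) (_ : 0 ≤ x) (_ : τ.lmul x = T), τ x

/-- `(τ ⊗ Tr)(T) = ∑ᵢ τ(Tᵢᵢ)` for positive `T` in `N ⊗̄ B(ℓ²(ι))`. -/
def tensorTrace (T : τ.Amp ι →L[ℂ] τ.Amp ι) : ℝ≥0∞ :=
  ∑' i, τ.opTrace (τ.matrixEntry T i i)

end TracialWeight

/-! ### Modules and their dimension -/

variable {H : Type u} [NormedAddCommGroup H] [InnerProductSpace ℂ H] [CompleteSpace H]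

/-- A unital `*`-homomorphism `π : N → B(H)` is normal if `π(sup D) = sup π(D)` for every bounded
upward directed family `D` in `N₊`. -/
def IsNormalRep (π : Elem N →⋆ₐ[ℂ] (H →L[ℂ] H)) : Prop :=
  ∀ D : Set (Elem N), (∀ d ∈ D, 0 ≤ d) → D.Nonempty → DirectedOn (· ≤ ·) D →
    ∀ x : Elem N, IsLUB D x → IsLUB (π '' D) (π x)

namespace TracialWeight

variable (τ : TracialWeight N) {ι : Type w}

/-- An isometry `v : H → L²(N,τ) ⊗ ℓ²(ι)` is a standard intertwiner for `(H,π)` if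
`v π(x) = (x ⊗ 1) v` for all `x ∈ N`. -/
def IsStandardIntertwiner (π : Elem N →⋆ₐ[ℂ] (H →L[ℂ] H)) (v : H →ₗᵢ[ℂ] τ.Amp ι) : Prop :=
  ∀ x : Elem N, v.toContinuousLinearMap.comp (π x) =
    (τ.amplify ι (τ.lmul x)).comp v.toContinuousLinearMap

/-- The operator `(J_τ ⊗ 1) v v* (J_τ ⊗ 1)`. -/
def conjRangeProj (v : H →ₗᵢ[ℂ] τ.Amp ι) : τ.Amp ι →L[ℂ] τ.Amp ι :=
  (τ.ampJ ι).comp ((v.toContinuousLinearMap.comp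
    (ContinuousLinearMap.adjoint v.toContinuousLinearMap)).comp (τ.ampJ ι))

/-- The Murray--von Neumann dimension `dim_{(N,τ)}(H,π) = (τ ⊗ Tr)[(J_τ ⊗ 1) v v* (J_τ ⊗ 1)]`, for
any standard intertwiner `v`. The value does not depend on `v`, which is why it may be written
as an infimum over all `v`. -/
def dim (π : Elem N →⋆ₐ[ℂ] (H →L[ℂ] H)) : ℝ≥0∞ :=
  ⨅ (ι : Type u) (v : H →ₗᵢ[ℂ] τ.Amp ι) (_ : τ.IsStandardIntertwiner π v),
    τ.tensorTrace (τ.conjRangeProj v)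

end TracialWeight

end Weights

/-! ### Corners -/

section Corners

/-- The orthogonal projections in `B(H)`. -/
abbrev StarProj (H : Type u) [NormedAddCommGroup H] [InnerProductSpace ℂ H] [CompleteSpace H] :
    Type u := {e : H →L[ℂ] H // IsStarProjection e}

variable {H : Type u} [NormedAddCommGroup H] [InnerProductSpace ℂ H] [CompleteSpace H]

namespace StarProj

variable (e : StarProj H)

/-- The closed subspace `eH`. -/
def space : Submodule ℂ H := LinearMap.range (e.1 : H →ₗ[ℂ] H)

theorem mem_space_iff {ξ : H} : ξ ∈ e.space ↔ e.1 ξ = ξ := by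
  constructor
  · rintro ⟨η, rfl⟩
    exact congrArg (fun T : H →L[ℂ] H => T η) e.2.isIdempotentElem
  · intro h
    exact ⟨ξ, h⟩

instance : CompleteSpace e.space := by
  have : IsClosed (e.space : Set H) := by
    have h : (e.space : Set H) = {ξ | e.1 ξ = ξ} := Set.ext fun ξ => e.mem_space_iff
    rw [h]
    exact isClosed_eq (by fun_prop) continuous_id
  exact this.completeSpace_coe

/-- The inclusion `eH → H`. -/
def incl : e.space →L[ℂ] H := e.space.subtypeL

/-- The orthogonal projection `H → eH`, i.e. the adjoint of the inclusion. -/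
def proj : H →L[ℂ] e.space := ContinuousLinearMap.adjoint e.incl

theorem proj_apply (ξ : H) : (e.proj ξ : H) = e.1 ξ := by
  have h : e.proj ξ = ⟨e.1 ξ, ⟨ξ, rfl⟩⟩ := by
    refine ext_inner_left ℂ fun η => ?_
    rw [proj, ContinuousLinearMap.adjoint_inner_right, Submodule.coe_inner]
    change inner ℂ (η : H) ξ = inner ℂ (η : H) (e.1 ξ)
    have hη : e.1 η = η := e.mem_space_iff.1 η.2
    have hs := ContinuousLinearMap.adjoint_inner_right e.1 (η : H) ξ
    rw [← ContinuousLinearMap.star_eq_adjoint, e.2.isSelfAdjoint.star_eq, hη] at hs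
    exact hs.symm
  rw [h]

theorem incl_proj : e.incl ∘L e.proj = e.1 := by
  ext ξ; exact e.proj_apply ξ

theorem proj_incl : e.proj ∘L e.incl = 1 := by
  ext ξ
  change (e.proj (ξ : H) : H) = ξ
  rw [proj_apply]; exact e.mem_space_iff.1 ξ.2

theorem proj_incl_apply (ξ : e.space) : e.proj (e.incl ξ) = ξ :=
  congrArg (fun T : e.space →L[ℂ] e.space => T ξ) e.proj_incl

theorem incl_proj_apply (ξ : H) : e.incl (e.proj ξ) = e.1 ξ := e.proj_apply ξ

/-- The extension of an operator on `eH` to `H` by `0` on the orthogonal complement of `eH`;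
this identifies `B(eH)` with `e B(H) e`. -/
def extend (y : e.space →L[ℂ] e.space) : H →L[ℂ] H := e.incl ∘L y ∘L e.proj

/-- The compression of an operator on `H` to `eH`. -/
def compress (x : H →L[ℂ] H) : e.space →L[ℂ] e.space := e.proj ∘L x ∘L e.incl

theorem extend_add (y z : e.space →L[ℂ] e.space) :
    e.extend (y + z) = e.extend y + e.extend z := by
  ext; simp [extend]

theorem extend_smul (c : ℂ) (y : e.space →L[ℂ] e.space) :
    e.extend (c • y) = c • e.extend y := by
  ext; simp [extend]

theorem extend_mul (y z : e.space →L[ℂ] e.space) :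
    e.extend (y * z) = e.extend y * e.extend z := by
  ext; simp [extend, proj_incl_apply]

theorem extend_one : e.extend 1 = e.1 := e.incl_proj

theorem extend_star (y : e.space →L[ℂ] e.space) : e.extend (star y) = star (e.extend y) := by
  simp only [extend, proj, ContinuousLinearMap.star_eq_adjoint, ContinuousLinearMap.adjoint_comp,
    ContinuousLinearMap.adjoint_adjoint, ContinuousLinearMap.comp_assoc]

theorem extend_nonneg {y : e.space →L[ℂ] e.space} (hy : 0 ≤ y) : 0 ≤ e.extend y := by
  rw [ContinuousLinearMap.nonneg_iff_isPositive] at hy ⊢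
  exact hy.conj_adjoint e.incl

theorem mul_extend (y : e.space →L[ℂ] e.space) : e.1 * e.extend y = e.extend y := by
  rw [← e.extend_one, ← e.extend_mul, one_mul]

theorem extend_mul' (y : e.space →L[ℂ] e.space) : e.extend y * e.1 = e.extend y := by
  rw [← e.extend_one, ← e.extend_mul, mul_one]

end StarProj

variable {H₀ : Type u₀} [NormedAddCommGroup H₀] [InnerProductSpace ℂ H₀] [CompleteSpace H₀]

/-- The projections of `N`. -/
abbrev Proj (N : VonNeumannAlgebra H₀) : Type u₀ := {p : Elem N // IsStarProjection p}

variable {N : VonNeumannAlgebra H₀}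

/-- A projection of `N ⊆ B(H₀)`, as a projection of `B(H₀)`. -/
def Proj.op (p : Proj N) : StarProj H₀ :=
  ⟨p.1.1, ⟨congrArg Subtype.val p.2.isIdempotentElem, congrArg Subtype.val p.2.isSelfAdjoint⟩⟩

theorem Proj.op_mem (p : Proj N) : p.op.1 ∈ N := p.1.2

/-- The image of a projection of `N` under a representation. -/
def Proj.map (p : Proj N) (π : Elem N →⋆ₐ[ℂ] (H →L[ℂ] H)) : StarProj H :=
  ⟨π p.1, ⟨by rw [IsIdempotentElem, ← map_mul, p.2.isIdempotentElem],
    by rw [IsSelfAdjoint, ← map_star, p.2.isSelfAdjoint.star_eq]⟩⟩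

/-- The corner `pNp` as a von Neumann algebra on `pH₀`: those operators on `pH₀` whose extension
by zero belongs to `N`. -/
def corner (p : Proj N) : VonNeumannAlgebra p.op.space where
  carrier := {y | p.op.extend y ∈ N}
  mul_mem' {y z} hy hz := by
    simp only [Set.mem_ofPred_eq, p.op.extend_mul] at *
    exact mul_mem hy hz
  one_mem' := by
    simp only [Set.mem_ofPred_eq, p.op.extend_one]
    exact p.op_mem
  add_mem' {y z} hy hz := by
    simp only [Set.mem_ofPred_eq, p.op.extend_add] at *
    exact add_mem hy hz
  zero_mem' := by
    have : p.op.extend 0 = 0 := by ext; simp [StarProj.extend]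
    simp only [Set.mem_ofPred_eq, this]
    exact zero_mem N
  algebraMap_mem' c := by
    simp only [Set.mem_ofPred_eq, Algebra.algebraMap_eq_smul_one, p.op.extend_smul, p.op.extend_one]
    exact N.toStarSubalgebra.smul_mem p.op_mem c
  star_mem' {y} hy := by
    simp only [Set.mem_ofPred_eq, p.op.extend_star] at *
    exact star_mem hy
  centralizer_centralizer' := by
    refine Set.Subset.antisymm ?_ Set.subset_centralizer_centralizer
    intro y hy
    change p.op.extend y ∈ (N : Set (H₀ →L[ℂ] H₀))
    rw [← N.centralizer_centralizer]
    intro t ht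
    have hp : p.op.1 * t = t * p.op.1 := ht _ p.op_mem
    have hc : p.op.compress t ∈ Set.centralizer {y | p.op.extend y ∈ N} := by
      intro z hz
      have h := ht _ hz
      ext ξ
      have h' := congrArg (fun T : H₀ →L[ℂ] H₀ => p.op.proj (T (p.op.incl ξ))) h
      simp only [StarProj.extend, mul_apply_eq_comp, ContinuousLinearMap.comp_apply,
        StarProj.proj_incl_apply] at h'
      simp only [StarProj.compress, mul_apply_eq_comp, ContinuousLinearMap.comp_apply]
      rw [h']
    have hyt := hy _ hc
    have hp' : ∀ ξ, p.op.1 (t ξ) = t (p.op.1 ξ) := fun ξ =>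
      congrArg (fun T : H₀ →L[ℂ] H₀ => T ξ) hp
    have hpj : ∀ ξ, p.op.proj (p.op.1 ξ) = p.op.proj ξ := fun ξ => by
      rw [← p.op.incl_proj_apply, p.op.proj_incl_apply]
    ext ξ
    have h' := congrArg (fun T => p.op.incl (T (p.op.proj ξ))) hyt
    simp only [StarProj.compress, mul_apply_eq_comp, ContinuousLinearMap.comp_apply,
      StarProj.incl_proj_apply] at h'
    simp only [StarProj.extend, mul_apply_eq_comp, ContinuousLinearMap.comp_apply]
    rw [hp', ← p.op.incl_proj_apply, p.op.proj_incl_apply, ← hp', hpj] at h'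
    exact h'

/-- The inclusion `pNp ⊆ N`. -/
def cornerIncl (p : Proj N) (y : Elem (corner p)) : Elem N := ⟨p.op.extend y.1, y.2⟩

theorem cornerIncl_add (p : Proj N) (y z : Elem (corner p)) :
    cornerIncl p (y + z) = cornerIncl p y + cornerIncl p z := Subtype.ext (p.op.extend_add _ _)

theorem cornerIncl_smul (p : Proj N) (c : ℂ) (y : Elem (corner p)) :
    cornerIncl p (c • y) = c • cornerIncl p y := Subtype.ext (p.op.extend_smul _ _)

theorem cornerIncl_mul (p : Proj N) (y z : Elem (corner p)) :
    cornerIncl p (y * z) = cornerIncl p y * cornerIncl p z := Subtype.ext (p.op.extend_mul _ _)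

theorem cornerIncl_star (p : Proj N) (y : Elem (corner p)) :
    cornerIncl p (star y) = star (cornerIncl p y) := Subtype.ext (p.op.extend_star _)

theorem cornerIncl_one (p : Proj N) : cornerIncl p 1 = p.1 := Subtype.ext p.op.extend_one

theorem cornerIncl_nonneg (p : Proj N) {y : Elem (corner p)} (hy : 0 ≤ y) :
    0 ≤ cornerIncl p y := p.op.extend_nonneg hy

/-- The normalized trace `τ_p = τ(p)⁻¹ τ(p · p)` on `pNp`. -/
def TracialWeight.cornerWeight (τ : TracialWeight N) (p : Proj N) : TracialWeight (corner p) where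
  toFun y := (τ p.1)⁻¹ * τ (cornerIncl p y)
  add_of_nonneg y z hy hz := by
    rw [cornerIncl_add, τ.add_of_nonneg _ _ (cornerIncl_nonneg p hy) (cornerIncl_nonneg p hz), mul_add]
  smul_of_nonneg c y hy := by
    rw [cornerIncl_smul, τ.smul_of_nonneg _ _ (cornerIncl_nonneg p hy), mul_left_comm]
  tracial y := by
    rw [cornerIncl_mul, cornerIncl_mul, cornerIncl_star, τ.tracial]

/-- The representation of `pNp` on `π(p)H` obtained by restricting `π`. -/
def cornerRep (π : Elem N →⋆ₐ[ℂ] (H →L[ℂ] H)) (p : Proj N) :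
    Elem (corner p) →⋆ₐ[ℂ] ((p.map π).space →L[ℂ] (p.map π).space) where
  toFun y := (p.map π).compress (π (cornerIncl p y))
  map_one' := by
    rw [cornerIncl_one]
    ext ξ
    change ((p.map π).proj ((p.map π).1 ξ) : H) = ξ
    rw [StarProj.proj_apply, (p.map π).mem_space_iff.1 ξ.2, (p.map π).mem_space_iff.1 ξ.2]
  map_mul' y z := by
    have h : cornerIncl p z = p.1 * cornerIncl p z := by
      rw [← cornerIncl_one, ← cornerIncl_mul, one_mul]
    have h' : cornerIncl p y * p.1 = cornerIncl p y := by
      rw [← cornerIncl_one, ← cornerIncl_mul, mul_one]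
    rw [cornerIncl_mul, map_mul]
    ext ξ
    simp only [StarProj.compress, mul_apply_eq_comp, ContinuousLinearMap.comp_apply,
      StarProj.incl_proj_apply]
    conv_lhs => rw [← h', map_mul]
    rfl
  map_zero' := by
    have h : cornerIncl p 0 = 0 := by simpa using cornerIncl_smul p 0 0
    rw [h, map_zero]
    ext; simp [StarProj.compress]
  map_add' y z := by
    rw [cornerIncl_add, map_add]
    ext; simp [StarProj.compress]
  commutes' c := by
    rw [Algebra.algebraMap_eq_smul_one, cornerIncl_smul, cornerIncl_one, map_smul]
    ext ξ
    change ((p.map π).proj (c • (p.map π).1 ξ) : H) = c • (ξ : H)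
    rw [StarProj.proj_apply, (p.map π).mem_space_iff.1 ξ.2, map_smul,
      (p.map π).mem_space_iff.1 ξ.2]
  map_star' y := by
    rw [cornerIncl_star, map_star]
    simp only [StarProj.compress, StarProj.proj, ContinuousLinearMap.star_eq_adjoint,
      ContinuousLinearMap.adjoint_comp, ContinuousLinearMap.adjoint_adjoint,
      ContinuousLinearMap.comp_assoc]

/-- Petersen's dimension
`dim'_{(N,τ)}(H,π) = sup {τ(p) dim_{(pNp,τ_p)}(π(p)H, π|_{pNp}) : p ∈ N a projection, τ(p) < ∞}`. -/
def TracialWeight.petersenDim (τ : TracialWeight N) (π : Elem N →⋆ₐ[ℂ] (H →L[ℂ] H)) : ℝ≥0∞ :=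
  ⨆ (p : Proj N) (_ : τ p.1 < ∞), τ p.1 * (τ.cornerWeight p).dim (cornerRep π p)

end Corners

end VNDim

end

/-!
For every non-zero vector `ξ` of a normal representation `π₂` and every faithful normal
representation `π₁` there are a vector `ζ` and `p ∈ N` such that `π₂(p)ξ ≠ 0` and
`‖π₂(xp)ξ‖ ≤ ‖π₁(xp)ζ‖` for all `x`, so `π₁(xp)ζ ↦ π₂(xp)ξ` is a non-zero intertwiner. By maximality
every module has a frame of intertwiners `v_j : H → L²(N,τ)`, `∑ v_j* v_j = 1`, which assembles to a
standard intertwiner. The commutant of `N` on `L²(N,τ)` is `J N J`, so it carries the trace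
`comTrace T = τ(J T J)`; the trace property gives
`∑ comTrace(v_j v_j*) = ∑ comTrace(v_j w_k* w_k v_j*) = ∑ comTrace(w_k w_k*)` for two frames, which
is the independence of the standard intertwiner.

For a projection `p` of finite trace let `Z_p` be the projection onto the closed span of
`π(N)π(p)H`. An intertwiner from `π(p)H` to `L²(pNp)` lifts to one from `H` to `L²(N,τ)`, and a
frame of `π(p)H` lifts to a family `c_i` with `∑ c_i* c_i = Z_p`. Hence
`τ(p) dim_{pNp}(π(p)H) = ∑ comTrace(v_j Z_p v_j*)`, which is at most `∑ comTrace(v_j v_j*)`. The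
sums of finitely many members of a maximal orthogonal family of projections of finite trace
increase to `1`, hence so do their `Z_p`, and normality of `comTrace` gives equality in the
supremum.
-/

noncomputable section

open Filter Topology

namespace VNDim

/-! ### Vector functionals and strong limits of monotone nets -/

section VectorForm

variable {H : Type u} [NormedAddCommGroup H] [InnerProductSpace ℂ H]

/-- The vector functional `T ↦ Re ⟨Tξ, ξ⟩` of a vector `ξ`, as a real linear functional. On
self-adjoint operators it is the usual vector functional; the real part makes it comparable for
the order of `ℝ`. -/
def vectorForm (ξ : H) : (H →L[ℂ] H) →ₗ[ℝ] ℝ where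
  toFun T := T.reApplyInnerSelf ξ
  map_add' S T := by simp [ContinuousLinearMap.reApplyInnerSelf_apply, inner_add_left]
  map_smul' c T := by simp [ContinuousLinearMap.reApplyInnerSelf_apply, inner_smul_left_eq_smul]

theorem vectorForm_apply (ξ : H) (T : H →L[ℂ] H) : vectorForm ξ T = (inner ℂ (T ξ) ξ).re := rfl

theorem vectorForm_nonneg {T : H →L[ℂ] H} (hT : 0 ≤ T) (ξ : H) : 0 ≤ vectorForm ξ T :=
  ((ContinuousLinearMap.nonneg_iff_isPositive T).1 hT).re_inner_nonneg_left ξ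

theorem vectorForm_one (ξ : H) : vectorForm ξ 1 = ‖ξ‖ ^ 2 := by
  simp [vectorForm_apply, ← inner_self_eq_norm_sq (𝕜 := ℂ)]

theorem vectorForm_smul_vector (c : ℂ) (ξ : H) (T : H →L[ℂ] H) :
    vectorForm (c • ξ) T = ‖c‖ ^ 2 * vectorForm ξ T :=
  ContinuousLinearMap.reApplyInnerSelf_smul T ξ

theorem vectorForm_complex_smul (c : ℝ) (ξ : H) (T : H →L[ℂ] H) :
    vectorForm ξ ((c : ℂ) • T) = c * vectorForm ξ T := by
  simp [vectorForm_apply]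

theorem tendsto_vectorForm {α : Type*} {l : Filter α} {T : α → H →L[ℂ] H} {x : H →L[ℂ] H}
    {ξ : H} (hlim : Tendsto (fun a => T a ξ) l (𝓝 (x ξ))) :
    Tendsto (fun a => vectorForm ξ (T a)) l (𝓝 (vectorForm ξ x)) :=
  (Complex.continuous_re.tendsto _).comp (hlim.inner tendsto_const_nhds)

variable [CompleteSpace H]

theorem vectorForm_mono (ξ : H) : Monotone (vectorForm ξ) := fun S T h => by
  simpa [map_sub] using vectorForm_nonneg (sub_nonneg.2 h) ξ

theorem vectorForm_star_mul_mul (ξ : H) (S T : H →L[ℂ] H) :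
    vectorForm ξ (star S * T * S) = vectorForm (S ξ) T := by
  rw [vectorForm_apply, vectorForm_apply, ContinuousLinearMap.star_eq_adjoint, mul_apply_eq_comp,
    mul_apply_eq_comp, ContinuousLinearMap.adjoint_inner_left]

theorem vectorForm_star_mul_self (ξ : H) (T : H →L[ℂ] H) :
    vectorForm ξ (star T * T) = ‖T ξ‖ ^ 2 := by
  rw [← vectorForm_one, ← vectorForm_star_mul_mul, mul_one]

theorem le_of_vectorForm_le {S T : H →L[ℂ] H} (hS : IsSelfAdjoint S) (hT : IsSelfAdjoint T)
    (h : ∀ ξ, vectorForm ξ S ≤ vectorForm ξ T) : S ≤ T :=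
  ⟨(hT.sub hS).isSymmetric, fun ξ => by
    have : 0 ≤ vectorForm ξ (T - S) := by rw [map_sub]; exact sub_nonneg.2 (h ξ)
    exact this⟩

theorem norm_apply_sq_le_norm_mul_vectorForm {T : H →L[ℂ] H} (hT : 0 ≤ T) (ξ : H) :
    ‖T ξ‖ ^ 2 ≤ ‖T‖ * vectorForm ξ T := by
  obtain ⟨B, rfl⟩ := CStarAlgebra.nonneg_iff_eq_star_mul_self.1 hT
  calc ‖star B (B ξ)‖ ^ 2 ≤ (‖star B‖ * ‖B ξ‖) ^ 2 := by gcongr; exact (star B).le_opNorm _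
    _ = ‖star B * B‖ * vectorForm ξ (star B * B) := by
      rw [CStarRing.norm_star_mul_self, vectorForm_star_mul_self, norm_star]; ring

theorem norm_apply_sub_apply_sq_le {S T U : H →L[ℂ] H} (hS : 0 ≤ S) (hST : S ≤ T) (hTU : T ≤ U)
    (ξ : H) : ‖T ξ - S ξ‖ ^ 2 ≤ ‖U‖ * (vectorForm ξ T - vectorForm ξ S) := by
  have hnonneg : 0 ≤ T - S := sub_nonneg.2 hST
  have hnorm : ‖T - S‖ ≤ ‖U‖ :=
    CStarAlgebra.norm_le_norm_of_nonneg_of_le hnonneg ((sub_le_self _ hS).trans hTU)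
  calc ‖T ξ - S ξ‖ ^ 2 ≤ ‖T - S‖ * vectorForm ξ (T - S) :=
        norm_apply_sq_le_norm_mul_vectorForm hnonneg ξ
    _ ≤ ‖U‖ * (vectorForm ξ T - vectorForm ξ S) := by
        rw [← map_sub]; gcongr; exact vectorForm_nonneg hnonneg ξ

theorem isLUB_of_isLUB_vectorForm {D : Set (H →L[ℂ] H)} (hD : ∀ d ∈ D, 0 ≤ d) (hne : D.Nonempty)
    {x : H →L[ℂ] H} (hx : 0 ≤ x) (h : ∀ ξ, IsLUB (vectorForm ξ '' D) (vectorForm ξ x)) :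
    IsLUB D x := by
  refine ⟨fun d hd => ?_, fun u hu => ?_⟩
  · exact le_of_vectorForm_le (hD d hd).isSelfAdjoint hx.isSelfAdjoint
      fun ξ => (h ξ).1 (Set.mem_image_of_mem _ hd)
  · obtain ⟨d, hd⟩ := hne
    exact le_of_vectorForm_le hx.isSelfAdjoint ((hD d hd).trans (hu hd)).isSelfAdjoint
      fun ξ => (h ξ).2 ((vectorForm_mono ξ).mem_upperBounds_image hu)

section StrongLimit

variable {α : Type*} [Preorder α] [IsDirectedOrder α] [Nonempty α] {T : α → H →L[ℂ] H}
  {U x : H →L[ℂ] H}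

theorem cauchy_map_apply_of_monotone (hmono : Monotone T) (hT : ∀ a, 0 ≤ T a) (hU : ∀ a, T a ≤ U)
    (ξ : H) : Cauchy (map (fun a => T a ξ) atTop) := by
  have hlub : IsLUB (Set.range fun a => vectorForm ξ (T a)) (⨆ a, vectorForm ξ (T a)) :=
    isLUB_ciSup ⟨vectorForm ξ U, Set.forall_mem_range.2 fun a => vectorForm_mono ξ (hU a)⟩
  refine Metric.cauchy_iff.2 ⟨inferInstance, fun ε hε => ?_⟩
  have hδ : 0 < (ε / 2) ^ 2 / (‖U‖ + 1) := by positivity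
  obtain ⟨_, ⟨a₀, rfl⟩, ha₀⟩ := (lt_isLUB_iff hlub).1 (sub_lt_self _ hδ)
  have hclose : ∀ a, a₀ ≤ a → dist (T a ξ) (T a₀ ξ) < ε / 2 := fun a ha => by
    rw [dist_eq_norm]
    refine lt_of_pow_lt_pow_left₀ 2 (by positivity) ?_
    have hle : vectorForm ξ (T a) ≤ ⨆ a, vectorForm ξ (T a) := hlub.1 ⟨a, rfl⟩
    have hinc : 0 ≤ vectorForm ξ (T a) - vectorForm ξ (T a₀) :=
      sub_nonneg.2 (vectorForm_mono ξ (hmono ha))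
    calc ‖T a ξ - T a₀ ξ‖ ^ 2 ≤ ‖U‖ * (vectorForm ξ (T a) - vectorForm ξ (T a₀)) :=
          norm_apply_sub_apply_sq_le (hT a₀) (hmono ha) (hU a) ξ
      _ ≤ (‖U‖ + 1) * (vectorForm ξ (T a) - vectorForm ξ (T a₀)) := by gcongr; linarith
      _ < (‖U‖ + 1) * ((ε / 2) ^ 2 / (‖U‖ + 1)) := by gcongr; linarith
      _ = (ε / 2) ^ 2 := by field_simp
  refine ⟨(fun a => T a ξ) '' Set.Ici a₀, image_mem_map (Ici_mem_atTop _), ?_⟩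
  rintro _ ⟨a, ha, rfl⟩ _ ⟨b, hb, rfl⟩
  linarith [dist_triangle_right (T a ξ) (T b ξ) (T a₀ ξ), hclose a ha, hclose b hb]

theorem exists_tendsto_apply_of_monotone (hmono : Monotone T) (hT : ∀ a, 0 ≤ T a)
    (hU : ∀ a, T a ≤ U) :
    ∃ x : H →L[ℂ] H, ∀ ξ, Tendsto (fun a => T a ξ) atTop (𝓝 (x ξ)) := by
  choose f hf using fun ξ =>
    CompleteSpace.complete (cauchy_map_apply_of_monotone hmono hT hU ξ)
  have hlim : ∀ ξ, Tendsto (fun a => T a ξ) atTop (𝓝 (f ξ)) := hf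
  have hnorm : ∀ a ξ, ‖T a ξ‖ ≤ ‖U‖ * ‖ξ‖ := fun a ξ => (T a).le_of_opNorm_le
    (CStarAlgebra.norm_le_norm_of_nonneg_of_le (hT a) (hU a)) ξ
  exact ⟨(linearMapOfTendsto f (fun a => (T a : H →ₗ[ℂ] H)) (tendsto_pi_nhds.2 hlim)).mkContinuous
    ‖U‖ fun ξ => le_of_tendsto (hlim ξ).norm (.of_forall fun a => hnorm a ξ), hlim⟩

theorem nonneg_of_tendsto_apply (hT : ∀ a, 0 ≤ T a)
    (hlim : ∀ ξ, Tendsto (fun a => T a ξ) atTop (𝓝 (x ξ))) : 0 ≤ x := by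
  refine (ContinuousLinearMap.nonneg_iff_isPositive x).2 ⟨fun ξ η => ?_, fun ξ => ?_⟩
  · refine tendsto_nhds_unique ((hlim ξ).inner tendsto_const_nhds)
      ((tendsto_const_nhds.inner (hlim η)).congr fun a => ?_)
    exact ((hT a).isSelfAdjoint.isSymmetric ξ η).symm
  · exact ge_of_tendsto (tendsto_vectorForm (hlim ξ))
      (.of_forall fun a => vectorForm_nonneg (hT a) ξ)

end StrongLimit

theorem exists_isLUB_vectorForm_and_tendsto {D : Set (H →L[ℂ] H)} (hD : ∀ d ∈ D, 0 ≤ d)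
    (hne : D.Nonempty) (hdir : DirectedOn (· ≤ ·) D) (hbdd : BddAbove D) :
    ∃ x : H →L[ℂ] H, 0 ≤ x ∧ (∀ ξ, IsLUB (vectorForm ξ '' D) (vectorForm ξ x)) ∧
      ∀ ξ, Tendsto (fun d : D => d.1 ξ) atTop (𝓝 (x ξ)) := by
  have := hne.to_subtype
  have := hdir.isDirectedOrder
  obtain ⟨U, hU⟩ := hbdd
  have hmono : Monotone fun d : D => d.1 := fun _ _ h => h
  obtain ⟨x, hx⟩ := exists_tendsto_apply_of_monotone hmono (fun d => hD _ d.2) fun d => hU d.2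
  refine ⟨x, nonneg_of_tendsto_apply (fun d : D => hD _ d.2) hx, fun ξ => ?_, hx⟩
  rw [Set.image_eq_range]
  exact isLUB_of_tendsto_atTop ((vectorForm_mono ξ).comp hmono) (tendsto_vectorForm (hx ξ))

theorem isLUB_vectorForm_of_isLUB {D : Set (H →L[ℂ] H)} (hD : ∀ d ∈ D, 0 ≤ d) (hne : D.Nonempty)
    (hdir : DirectedOn (· ≤ ·) D) {x : H →L[ℂ] H} (hx : IsLUB D x) (ξ : H) :
    IsLUB (vectorForm ξ '' D) (vectorForm ξ x) := by
  obtain ⟨y, hy, hlub, -⟩ := exists_isLUB_vectorForm_and_tendsto hD hne hdir ⟨x, hx.1⟩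
  rw [hx.unique (isLUB_of_isLUB_vectorForm hD hne hy hlub)]
  exact hlub ξ

end VectorForm

/-! ### Order properties of a von Neumann algebra and its normal representations -/

section Algebra

variable {H₀ : Type u₀} [NormedAddCommGroup H₀] [InnerProductSpace ℂ H₀] [CompleteSpace H₀]
  {N : VonNeumannAlgebra H₀}

theorem mem_of_forall_mem_commutant {y : H₀ →L[ℂ] H₀} (h : ∀ t ∈ N.commutant, t * y = y * t) :
    y ∈ N := by
  rw [← N.commutant_commutant, VonNeumannAlgebra.mem_commutant_iff]
  exact h

theorem mem_of_tendsto_apply {α : Type*} {l : Filter α} [l.NeBot] {T : α → H₀ →L[ℂ] H₀}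
    (hT : ∀ a, T a ∈ N) {x : H₀ →L[ℂ] H₀}
    (hlim : ∀ ξ, Tendsto (fun a => T a ξ) l (𝓝 (x ξ))) : x ∈ N := by
  refine mem_of_forall_mem_commutant fun t ht => ContinuousLinearMap.ext fun ξ => ?_
  refine tendsto_nhds_unique ((t.continuous.tendsto _).comp (hlim ξ))
    ((hlim (t ξ)).congr fun a => ?_)
  exact congrArg (fun S : H₀ →L[ℂ] H₀ => S ξ) (VonNeumannAlgebra.mem_commutant_iff.1 ht _ (hT a))

theorem Elem.exists_nonneg_mul_self_eq {x : Elem N} (hx : 0 ≤ x) :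
    ∃ s : Elem N, 0 ≤ s ∧ s * s = x := by
  have hx' : (0 : H₀ →L[ℂ] H₀) ≤ x := hx
  refine ⟨⟨CFC.sqrt (x : H₀ →L[ℂ] H₀), mem_of_forall_mem_commutant fun t ht => ?_⟩,
    CFC.sqrt_nonneg (x : H₀ →L[ℂ] H₀), Subtype.ext (CFC.sqrt_mul_sqrt_self _ hx')⟩
  have hcomm : Commute (x : H₀ →L[ℂ] H₀) t := VonNeumannAlgebra.mem_commutant_iff.1 ht _ x.2
  exact (hcomm.cfcₙ_nnreal NNReal.sqrt).eq.symm

instance : StarOrderedRing (Elem N) := by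
  refine .of_nonneg_iff' (fun {x y} h z => ?_) fun x => ⟨fun hx => ?_, ?_⟩
  · exact add_le_add_right (show (x : H₀ →L[ℂ] H₀) ≤ y from h) _
  · obtain ⟨s, hs, rfl⟩ := Elem.exists_nonneg_mul_self_eq hx
    have hs' : star s = s :=
      Subtype.ext (show (0 : H₀ →L[ℂ] H₀) ≤ s from hs).isSelfAdjoint.star_eq
    exact ⟨s, by rw [hs']⟩
  · rintro ⟨s, rfl⟩
    exact star_mul_self_nonneg' s

variable {H : Type u} [NormedAddCommGroup H] [InnerProductSpace ℂ H] [CompleteSpace H]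
  {π : Elem N →⋆ₐ[ℂ] (H →L[ℂ] H)}

theorem vectorForm_map_star_mul_self (π : Elem N →⋆ₐ[ℂ] (H →L[ℂ] H)) (ξ : H) (x : Elem N) :
    vectorForm ξ (π (star x * x)) = ‖π x ξ‖ ^ 2 := by
  rw [map_mul, map_star, vectorForm_star_mul_self]

theorem isNormalRep_iff_isLUB_vectorForm : IsNormalRep π ↔
    ∀ D : Set (Elem N), (∀ d ∈ D, 0 ≤ d) → D.Nonempty → DirectedOn (· ≤ ·) D →
      ∀ x : Elem N, IsLUB D x → ∀ ξ : H,
        IsLUB ((fun d => vectorForm ξ (π d)) '' D) (vectorForm ξ (π x)) := by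
  refine forall₂_congr fun D hD => forall₂_congr fun hne hdir => forall₂_congr fun x hx => ?_
  have hπD : ∀ T ∈ π '' D, 0 ≤ T := Set.forall_mem_image.2 fun d hd => map_nonneg π (hD d hd)
  simp only [← Set.image_image (vectorForm _) π]
  constructor
  · exact isLUB_vectorForm_of_isLUB hπD (hne.image _)
      (hdir.mono_comp fun _ _ h => OrderHomClass.mono π h)
  · obtain ⟨d, hd⟩ := id hne
    exact isLUB_of_isLUB_vectorForm hπD (hne.image _) (map_nonneg π ((hD d hd).trans (hx.1 hd)))

theorem Elem.isLUB_of_isLUB_vectorForm {D : Set (Elem N)} (hD : ∀ d ∈ D, 0 ≤ d)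
    (hne : D.Nonempty) {x : Elem N} (hx : 0 ≤ x)
    (h : ∀ ξ, IsLUB ((fun d : Elem N => vectorForm ξ (d : H₀ →L[ℂ] H₀)) '' D)
      (vectorForm ξ (x : H₀ →L[ℂ] H₀))) : IsLUB D x := by
  have hlub : IsLUB (Subtype.val '' D) x.1 :=
    VNDim.isLUB_of_isLUB_vectorForm (Set.forall_mem_image.2 hD) (hne.image _) hx
      fun ξ => by rw [Set.image_image]; exact h ξ
  exact ⟨fun d hd => hlub.1 ⟨d, hd, rfl⟩, fun u hu => hlub.2 (Set.forall_mem_image.2 hu)⟩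

theorem Elem.exists_isLUB_vectorForm {D : Set (Elem N)} (hD : ∀ d ∈ D, 0 ≤ d)
    (hne : D.Nonempty) (hdir : DirectedOn (· ≤ ·) D) (hbdd : BddAbove D) :
    ∃ x : Elem N, 0 ≤ x ∧ ∀ ξ,
      IsLUB ((fun d : Elem N => vectorForm ξ (d : H₀ →L[ℂ] H₀)) '' D)
        (vectorForm ξ (x : H₀ →L[ℂ] H₀)) := by
  have hdir' : DirectedOn (· ≤ ·) (Subtype.val '' D) := hdir.mono_comp fun _ _ h => h
  have := (hne.image Subtype.val).to_subtype
  have := hdir'.isDirectedOrder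
  obtain ⟨x, hx, hlub, hlim⟩ := exists_isLUB_vectorForm_and_tendsto (Set.forall_mem_image.2 hD)
    (hne.image Subtype.val) hdir' ((Subtype.mono_coe (· ∈ N.toStarSubalgebra)).map_bddAbove hbdd)
  have hxN : x ∈ N := mem_of_tendsto_apply
    (fun d : Subtype.val '' D => by obtain ⟨d, -, hd⟩ := d.2; exact hd ▸ d.2) hlim
  exact ⟨⟨x, hxN⟩, hx, fun ξ => by have := hlub ξ; rwa [Set.image_image] at this⟩

theorem Elem.exists_isLUB {D : Set (Elem N)} (hD : ∀ d ∈ D, 0 ≤ d) (hne : D.Nonempty)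
    (hdir : DirectedOn (· ≤ ·) D) (hbdd : BddAbove D) : ∃ x : Elem N, 0 ≤ x ∧ IsLUB D x := by
  obtain ⟨x, hx, h⟩ := Elem.exists_isLUB_vectorForm hD hne hdir hbdd
  exact ⟨x, hx, Elem.isLUB_of_isLUB_vectorForm hD hne hx h⟩

theorem isNormalRep_subtype : IsNormalRep N.toStarSubalgebra.subtype := by
  refine isNormalRep_iff_isLUB_vectorForm.2 fun D hD hne hdir x hx ξ => ?_
  obtain ⟨y, hy, h⟩ := Elem.exists_isLUB_vectorForm hD hne hdir ⟨x, hx.1⟩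
  rw [hx.unique (Elem.isLUB_of_isLUB_vectorForm hD hne hy h)]
  exact h ξ

end Algebra

/-! ### Comparison of vector functionals of two representations -/

section Comparison

variable {H₀ : Type u₀} [NormedAddCommGroup H₀] [InnerProductSpace ℂ H₀] [CompleteSpace H₀]
  {N : VonNeumannAlgebra H₀}
  {H₁ : Type*} [NormedAddCommGroup H₁] [InnerProductSpace ℂ H₁] [CompleteSpace H₁]
  {H₂ : Type*} [NormedAddCommGroup H₂] [InnerProductSpace ℂ H₂] [CompleteSpace H₂]
  {π₁ : Elem N →⋆ₐ[ℂ] (H₁ →L[ℂ] H₁)} {π₂ : Elem N →⋆ₐ[ℂ] (H₂ →L[ℂ] H₂)}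

theorem exists_maximal_vectorForm_le (h₁ : IsNormalRep π₁) (ζ : H₁) (ξ : H₂)
    {e : Elem N} (he : 0 ≤ e) :
    ∃ m : Elem N, 0 ≤ m ∧ m ≤ e ∧ vectorForm ζ (π₁ m) ≤ vectorForm ξ (π₂ m) ∧
      ∀ z : Elem N, 0 ≤ z → z ≤ e - m → z ≠ 0 →
        vectorForm ξ (π₂ z) < vectorForm ζ (π₁ z) := by
  obtain ⟨m, -, ⟨hm, hme, hmle⟩, hmax⟩ := zorn_le_nonempty₀
    {m : Elem N | 0 ≤ m ∧ m ≤ e ∧ vectorForm ζ (π₁ m) ≤ vectorForm ξ (π₂ m)} (by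
      intro c hc hchain y hy
      have hpos : ∀ d ∈ c, 0 ≤ d := fun d hd => (hc hd).1
      have hle : e ∈ upperBounds c := fun d hd => (hc hd).2.1
      obtain ⟨x, hx, hlub⟩ := Elem.exists_isLUB hpos ⟨y, hy⟩ hchain.directedOn ⟨e, hle⟩
      refine ⟨x, ⟨hx, hlub.2 hle, ?_⟩, hlub.1⟩
      refine (isNormalRep_iff_isLUB_vectorForm.1 h₁ c hpos ⟨y, hy⟩ hchain.directedOn x hlub ζ).2 ?_
      rintro _ ⟨d, hd, rfl⟩
      exact (hc hd).2.2.trans (vectorForm_mono ξ (OrderHomClass.mono π₂ (hlub.1 hd)))) 0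
    ⟨le_rfl, he, by simp⟩
  refine ⟨m, hm, hme, hmle, fun z hz hze hz0 => ?_⟩
  by_contra! hcon
  have hadd : m + z ≤ m := hmax ⟨add_nonneg hm hz, by rwa [add_comm, ← le_sub_iff_add_le],
    by simpa only [map_add] using add_le_add hmle hcon⟩ (le_add_of_nonneg_right hz)
  exact hz0 (le_antisymm (nonpos_of_add_le_right hadd) hz)

theorem exists_vectorForm_pos (h₂ : IsNormalRep π₂) {ξ : H₂} (hξ : ξ ≠ 0) :
    ∃ e : Elem N, 0 ≤ e ∧ e ≠ 0 ∧
      ∀ z : Elem N, 0 ≤ z → z ≤ e → z ≠ 0 → 0 < vectorForm ξ (π₂ z) := by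
  have h_one : (0 : Elem N) ≤ 1 := by simp
  obtain ⟨m, -, hm1, hmξ, hfaithful⟩ := exists_maximal_vectorForm_le h₂ (π₂ := π₂) ξ 0 h_one
  simp only [vectorForm_apply (0 : H₂), map_zero, inner_zero_left, Complex.zero_re]
    at hmξ hfaithful
  refine ⟨1 - m, sub_nonneg.2 hm1, ?_, hfaithful⟩
  rintro h
  rw [← sub_eq_zero.1 h, map_one, vectorForm_one] at hmξ
  exact hmξ.not_gt (by positivity)

theorem exists_lt_vectorForm (hinj : Function.Injective π₁) {e : Elem N} (he : 0 ≤ e)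
    (he0 : e ≠ 0) (c : ℝ) : ∃ ζ : H₁, c < vectorForm ζ (π₁ e) := by
  obtain ⟨ζ, hζ⟩ : ∃ ζ, 0 < vectorForm ζ (π₁ e) := by
    by_contra! hcon
    refine he0 (hinj ?_)
    rw [map_zero]
    exact le_antisymm (le_of_vectorForm_le (map_nonneg π₁ he).isSelfAdjoint (.zero _)
      fun ζ => by simpa using hcon ζ) (map_nonneg π₁ he)
  obtain ⟨n, hn⟩ := exists_nat_gt (c / vectorForm ζ (π₁ e))
  refine ⟨((n + 1 : ℕ) : ℂ) • ζ, ?_⟩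
  rw [div_lt_iff₀ hζ] at hn
  rw [vectorForm_smul_vector, Complex.norm_natCast]
  refine hn.trans_le (mul_le_mul_of_nonneg_right ?_ hζ.le)
  push_cast
  nlinarith [(n.cast_nonneg : (0 : ℝ) ≤ n)]

theorem exists_vectorForm_le (h₁ : IsNormalRep π₁) (hinj : Function.Injective π₁)
    (h₂ : IsNormalRep π₂) {ξ : H₂} (hξ : ξ ≠ 0) :
    ∃ (ζ : H₁) (y : Elem N), 0 ≤ y ∧ 0 < vectorForm ξ (π₂ y) ∧
      ∀ z : Elem N, 0 ≤ z → z ≤ y → vectorForm ξ (π₂ z) ≤ vectorForm ζ (π₁ z) := by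
  obtain ⟨e, he, he0, hfaithful⟩ := exists_vectorForm_pos h₂ hξ
  obtain ⟨ζ, hζ⟩ := exists_lt_vectorForm hinj he he0 (vectorForm ξ (π₂ e))
  obtain ⟨m, hm, hme, hmle, hlt⟩ := exists_maximal_vectorForm_le h₁ (π₂ := π₂) ζ ξ he
  have hne : e - m ≠ 0 := fun h => hmle.not_gt (sub_eq_zero.1 h ▸ hζ)
  refine ⟨ζ, e - m, sub_nonneg.2 hme,
    hfaithful _ (sub_nonneg.2 hme) (sub_le_self _ hm) hne, fun z hz hzy => ?_⟩
  rcases eq_or_ne z 0 with rfl | hz0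
  · simp
  · exact (hlt z hz hzy hz0).le

theorem vectorForm_le_of_le_smul {ζ : H₁} {ξ : H₂} {y : Elem N}
    (h : ∀ z : Elem N, 0 ≤ z → z ≤ y → vectorForm ξ (π₂ z) ≤ vectorForm ζ (π₁ z))
    {c : ℝ≥0} {t : Elem N} (ht : 0 ≤ t) (hty : t ≤ ((c : ℝ) : ℂ) • y) :
    vectorForm ξ (π₂ t) ≤ vectorForm ζ (π₁ t) := by
  rcases eq_or_ne c 0 with rfl | hc
  · rw [le_antisymm (by simpa using hty) ht]
    simp
  have hcancel (x : Elem N) : ((c⁻¹ : ℝ≥0) : ℂ) • ((c : ℝ) : ℂ) • x = x := by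
    rw [smul_smul, NNReal.coe_inv]
    simp [hc]
  have hscaled := h _ (smul_nonneg' c⁻¹ ht) (by
    simpa only [smul_sub, sub_nonneg, hcancel] using smul_nonneg' c⁻¹ (sub_nonneg.2 hty))
  rw [map_smul π₂, map_smul π₁, vectorForm_complex_smul, vectorForm_complex_smul] at hscaled
  exact le_of_mul_le_mul_left hscaled (by positivity)

theorem exists_norm_map_mul_le (h₁ : IsNormalRep π₁) (hinj : Function.Injective π₁)
    (h₂ : IsNormalRep π₂) {ξ : H₂} (hξ : ξ ≠ 0) :
    ∃ (ζ : H₁) (p : Elem N), π₂ p ξ ≠ 0 ∧ ∀ x, ‖π₂ (x * p) ξ‖ ≤ ‖π₁ (x * p) ζ‖ := by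
  obtain ⟨ζ, y, hy, hyξ, hdom⟩ := exists_vectorForm_le h₁ hinj h₂ hξ
  obtain ⟨p, rfl⟩ : ∃ p, star p * p = y := by
    obtain ⟨p, hp, rfl⟩ := Elem.exists_nonneg_mul_self_eq hy
    exact ⟨p, by rw [hp.isSelfAdjoint.star_eq]⟩
  rw [vectorForm_map_star_mul_self] at hyξ
  refine ⟨ζ, p, fun h => by simp [h] at hyξ, fun x => ?_⟩
  have := vectorForm_le_of_le_smul hdom (star_mul_self_nonneg (x * p)) (conj_le x p)
  rw [vectorForm_map_star_mul_self, vectorForm_map_star_mul_self] at this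
  exact (sq_le_sq₀ (norm_nonneg _) (norm_nonneg _)).1 this

end Comparison

/-! ### Intertwiners -/

section Extension

variable {E : Type*} [AddCommGroup E] [Module ℂ E]
  {H₁ : Type*} [NormedAddCommGroup H₁] [InnerProductSpace ℂ H₁] [CompleteSpace H₁]
  {H₂ : Type*} [NormedAddCommGroup H₂] [InnerProductSpace ℂ H₂]

theorem eq_of_eqOn_range_of_eqOn_orthogonal {f : E →ₗ[ℂ] H₁} {S T : H₁ →L[ℂ] H₂}
    (hrange : ∀ e, S (f e) = T (f e)) (horth : ∀ η ∈ (LinearMap.range f)ᗮ, S η = T η) :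
    S = T := by
  ext η
  obtain ⟨a, ha, b, hb, rfl⟩ :=
    (LinearMap.range f).topologicalClosure.exists_add_mem_mem_orthogonal η
  rw [Submodule.orthogonal_closure] at hb
  have hcl : IsClosed {a | S a = T a} := isClosed_eq S.continuous T.continuous
  have hST : S a = T a := closure_minimal (Set.forall_mem_range.2 hrange) hcl ha
  rw [map_add, map_add, horth b hb, hST]

variable [CompleteSpace H₂]

theorem exists_extension_of_norm_le (f : E →ₗ[ℂ] H₁) (g : E →ₗ[ℂ] H₂)
    (hfg : ∀ e, ‖g e‖ ≤ ‖f e‖) :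
    ∃ T : H₁ →L[ℂ] H₂, (∀ e, T (f e) = g e) ∧ (∀ η ∈ (LinearMap.range f)ᗮ, T η = 0) ∧
      ∀ η, T η ∈ (LinearMap.range g).topologicalClosure := by
  set K := (LinearMap.range f).topologicalClosure
  let f' : E →ₗ[ℂ] K := f.codRestrict K fun e => subset_closure ⟨e, rfl⟩
  have hdense : DenseRange f' := by
    rw [DenseRange, Subtype.dense_iff, ← Set.range_comp]
    exact fun x hx => hx
  have hbound : ∃ C, ∀ e, ‖g e‖ ≤ C * ‖f' e‖ := ⟨1, fun e => by rw [one_mul]; exact hfg e⟩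
  refine ⟨(g.extendOfNorm f').comp K.orthogonalProjectionOnto, fun e => ?_, fun η hη => ?_,
    fun η => ?_⟩
  · have : K.orthogonalProjectionOnto (f e) = f' e :=
      K.orthogonalProjectionOnto_mem_subspace_eq_self (f' e)
    rw [ContinuousLinearMap.comp_apply, this, LinearMap.extendOfNorm_eq hdense hbound]
  · rw [← Submodule.orthogonal_closure] at hη
    rw [ContinuousLinearMap.comp_apply,
      K.orthogonalProjectionOnto_apply_of_mem_orthogonal hη, map_zero]
  · refine hdense.induction_on (p := fun k => g.extendOfNorm f' k ∈
      (LinearMap.range g).topologicalClosure) _ ?_ fun e => ?_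
    · exact (Submodule.isClosed_topologicalClosure _).preimage (g.extendOfNorm f').continuous
    · rw [LinearMap.extendOfNorm_eq hdense hbound]
      exact subset_closure ⟨e, rfl⟩

end Extension

section Frames

variable {H₁ : Type*} [NormedAddCommGroup H₁] [InnerProductSpace ℂ H₁]
  {H₂ : Type*} [NormedAddCommGroup H₂] [InnerProductSpace ℂ H₂]

/-- A Parseval frame of operators: `∑ᵢ ‖uᵢ ξ‖² = ‖ξ‖²` for all `ξ`, that is, `∑ᵢ uᵢ* uᵢ = 1`
strongly. Frames of intertwiners into `L²(N, τ)` encode standard intertwiners by their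
coordinates. -/
def IsFrame {ι : Type*} (u : ι → H₁ →L[ℂ] H₂) : Prop :=
  ∀ ξ, HasSum (fun i => ‖u i ξ‖ ^ 2) (‖ξ‖ ^ 2)

theorem IsFrame.eq_zero {ι : Type*} {u : ι → H₁ →L[ℂ] H₂} (hu : IsFrame u) {ξ : H₁}
    (h : ∀ i, u i ξ = 0) : ξ = 0 := by
  have hsum := hu ξ
  simp only [h, norm_zero, zero_pow two_ne_zero] at hsum
  simpa using hsum.unique hasSum_zero

end Frames

section Intertwiners

variable {H₀ : Type u₀} [NormedAddCommGroup H₀] [InnerProductSpace ℂ H₀] [CompleteSpace H₀]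
  {N : VonNeumannAlgebra H₀}
  {H₁ : Type u} [NormedAddCommGroup H₁] [InnerProductSpace ℂ H₁] [CompleteSpace H₁]
  {H₂ : Type*} [NormedAddCommGroup H₂] [InnerProductSpace ℂ H₂] [CompleteSpace H₂]
  {H₃ : Type*} [NormedAddCommGroup H₃] [InnerProductSpace ℂ H₃] [CompleteSpace H₃]
  {π₁ : Elem N →⋆ₐ[ℂ] (H₁ →L[ℂ] H₁)} {π₂ : Elem N →⋆ₐ[ℂ] (H₂ →L[ℂ] H₂)}
  {π₃ : Elem N →⋆ₐ[ℂ] (H₃ →L[ℂ] H₃)}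

/-- `T` is a bounded intertwiner from the representation `π₁` to the representation `π₂`. -/
def Intertwines (π₁ : Elem N →⋆ₐ[ℂ] (H₁ →L[ℂ] H₁)) (π₂ : Elem N →⋆ₐ[ℂ] (H₂ →L[ℂ] H₂))
    (T : H₁ →L[ℂ] H₂) : Prop := ∀ x, T.comp (π₁ x) = (π₂ x).comp T

theorem Intertwines.apply {T : H₁ →L[ℂ] H₂} (hT : Intertwines π₁ π₂ T) (x : Elem N) (ξ : H₁) :
    T (π₁ x ξ) = π₂ x (T ξ) := congrArg (fun S : H₁ →L[ℂ] H₂ => S ξ) (hT x)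

theorem Intertwines.adjoint {T : H₁ →L[ℂ] H₂} (hT : Intertwines π₁ π₂ T) :
    Intertwines π₂ π₁ (ContinuousLinearMap.adjoint T) := fun x => by
  have h := congrArg ContinuousLinearMap.adjoint (hT (star x))
  rw [ContinuousLinearMap.adjoint_comp, ContinuousLinearMap.adjoint_comp, map_star π₁, map_star π₂,
    ← ContinuousLinearMap.star_eq_adjoint (star (π₁ x)),
    ← ContinuousLinearMap.star_eq_adjoint (star (π₂ x)), star_star, star_star] at h
  exact h.symm

theorem Intertwines.comp {T : H₂ →L[ℂ] H₃} {S : H₁ →L[ℂ] H₂} (hT : Intertwines π₂ π₃ T)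
    (hS : Intertwines π₁ π₂ S) : Intertwines π₁ π₃ (T.comp S) := fun x => by
  rw [ContinuousLinearMap.comp_assoc, hS x, ← ContinuousLinearMap.comp_assoc, hT x,
    ContinuousLinearMap.comp_assoc]

theorem Intertwines.add {S T : H₁ →L[ℂ] H₂} (hS : Intertwines π₁ π₂ S)
    (hT : Intertwines π₁ π₂ T) : Intertwines π₁ π₂ (S + T) := fun x => by
  rw [ContinuousLinearMap.add_comp, ContinuousLinearMap.comp_add, hS x, hT x]

theorem Intertwines.zero : Intertwines π₁ π₂ 0 := fun x => by
  rw [ContinuousLinearMap.zero_comp, ContinuousLinearMap.comp_zero]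

theorem Intertwines.one : Intertwines π₁ π₁ 1 := fun _ => rfl

theorem Intertwines.sum {α : Type*} {T : α → H₁ →L[ℂ] H₂} (hT : ∀ i, Intertwines π₁ π₂ (T i))
    (s : Finset α) : Intertwines π₁ π₂ (∑ i ∈ s, T i) :=
  Finset.sum_induction _ _ (fun _ _ => .add) .zero fun i _ => hT i

theorem inner_map_apply_left (π : Elem N →⋆ₐ[ℂ] (H₁ →L[ℂ] H₁)) (x : Elem N) (ξ η : H₁) :
    inner ℂ (π x ξ) η = inner ℂ ξ (π (star x) η) := by
  rw [map_star, ContinuousLinearMap.star_eq_adjoint, ContinuousLinearMap.adjoint_inner_right]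

theorem Intertwines.vectorForm_adjoint_apply {b : H₁ →L[ℂ] H₂} (hb : Intertwines π₁ π₂ b)
    (ξ : H₂) (x : Elem N) : vectorForm (ContinuousLinearMap.adjoint b ξ) (π₁ x) =
      vectorForm ξ ((b.comp (ContinuousLinearMap.adjoint b)).comp (π₂ x)) := by
  rw [vectorForm_apply, vectorForm_apply, ← hb.adjoint.apply,
    ContinuousLinearMap.adjoint_inner_right]
  rfl

theorem map_apply_mem_orthogonal {M : Submodule ℂ H₁} (hM : ∀ x, ∀ η ∈ M, π₁ x η ∈ M)
    (x : Elem N) {η : H₁} (hη : η ∈ Mᗮ) : π₁ x η ∈ Mᗮ := by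
  rw [Submodule.mem_orthogonal] at hη ⊢
  intro ζ hζ
  rw [← star_star x, ← inner_map_apply_left]
  exact hη _ (hM _ _ hζ)

theorem intertwines_starProjection {M : Submodule ℂ H₁} [M.HasOrthogonalProjection]
    (hM : ∀ x, ∀ η ∈ M, π₁ x η ∈ M) : Intertwines π₁ π₁ M.starProjection := by
  intro x
  ext1 ξ
  have hsplit : π₁ x ξ = π₁ x (M.starProjection ξ) + π₁ x (ξ - M.starProjection ξ) := by
    rw [← map_add, add_sub_cancel]
  rw [ContinuousLinearMap.comp_apply, ContinuousLinearMap.comp_apply, hsplit, map_add,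
    Submodule.starProjection_eq_self_iff.2 (hM x _ (M.starProjection_apply_mem ξ)),
    (Submodule.starProjection_apply_eq_zero_iff _).2
      (map_apply_mem_orthogonal hM x (M.sub_starProjection_mem_orthogonal ξ)), add_zero]

theorem exists_intertwiner_of_norm_le {E : Type*} [AddCommGroup E] [Module ℂ E] (f : E →ₗ[ℂ] H₁)
    (g : E →ₗ[ℂ] H₂) (hfg : ∀ e, ‖g e‖ ≤ ‖f e‖) (a : Elem N → E → E)
    (hf : ∀ y e, f (a y e) = π₁ y (f e)) (hg : ∀ y e, g (a y e) = π₂ y (g e)) :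
    ∃ T : H₁ →L[ℂ] H₂, Intertwines π₁ π₂ T ∧ (∀ e, T (f e) = g e) ∧
      (∀ η ∈ (LinearMap.range f)ᗮ, T η = 0) ∧
      ∀ η, T η ∈ (LinearMap.range g).topologicalClosure := by
  obtain ⟨T, hTf, hT0, hTg⟩ := exists_extension_of_norm_le f g hfg
  have hinv : ∀ y, ∀ η ∈ LinearMap.range f, π₁ y η ∈ LinearMap.range f := by
    rintro y _ ⟨e, rfl⟩
    exact ⟨a y e, hf y e⟩
  refine ⟨T, fun y => ?_, hTf, hT0, hTg⟩
  refine eq_of_eqOn_range_of_eqOn_orthogonal (f := f) (fun e => ?_) fun η hη => ?_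
  · simp only [ContinuousLinearMap.comp_apply, ← hf, hTf, hg]
  · simp only [ContinuousLinearMap.comp_apply, hT0 _ (map_apply_mem_orthogonal hinv y hη),
      hT0 η hη, map_zero]

/-- The orbit map `x ↦ π(x p) ξ`. -/
def orbitMap (π₁ : Elem N →⋆ₐ[ℂ] (H₁ →L[ℂ] H₁)) (p : Elem N) (ξ : H₁) : Elem N →ₗ[ℂ] H₁ where
  toFun x := π₁ (x * p) ξ
  map_add' x y := by simp [add_mul]
  map_smul' c x := by simp

theorem orbitMap_mul (p : Elem N) (ξ : H₁) (y x : Elem N) :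
    orbitMap π₁ p ξ (y * x) = π₁ y (orbitMap π₁ p ξ x) := by
  simp [orbitMap]

theorem exists_intertwiner_ne_zero (h₁ : IsNormalRep π₁) (hinj : Function.Injective π₁)
    (h₂ : IsNormalRep π₂) {M : Submodule ℂ H₂} (hM : IsClosed (M : Set H₂))
    (hinv : ∀ x, ∀ η ∈ M, π₂ x η ∈ M) {ξ : H₂} (hξM : ξ ∈ M) (hξ : ξ ≠ 0) :
    ∃ T : H₁ →L[ℂ] H₂, Intertwines π₁ π₂ T ∧ T ≠ 0 ∧ ∀ η, T η ∈ M := by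
  obtain ⟨ζ, p, hp, hle⟩ := exists_norm_map_mul_le h₁ hinj h₂ hξ
  obtain ⟨T, hT, hTorbit, -, hTrange⟩ := exists_intertwiner_of_norm_le (orbitMap π₁ p ζ)
    (orbitMap π₂ p ξ) hle (· * ·) (orbitMap_mul p ζ) (orbitMap_mul p ξ)
  refine ⟨T, hT, ?_, fun η => Submodule.topologicalClosure_minimal _ ?_ hM (hTrange η)⟩
  · rintro rfl
    exact hp (by simpa [orbitMap] using (hTorbit 1).symm)
  · rintro _ ⟨x, rfl⟩
    exact hinv _ _ hξM

/-- `u` is a nonzero partial isometry with initial space `K` intertwining `π₁` and `π₂`. -/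
structure IsInitialSpace (π₁ : Elem N →⋆ₐ[ℂ] (H₁ →L[ℂ] H₁)) (π₂ : Elem N →⋆ₐ[ℂ] (H₂ →L[ℂ] H₂))
    (K : Submodule ℂ H₁) (u : H₁ →L[ℂ] H₂) : Prop where
  intertwines : Intertwines π₁ π₂ u
  norm_map : ∀ ξ ∈ K, ‖u ξ‖ = ‖ξ‖
  map_orthogonal : ∀ ξ ∈ Kᗮ, u ξ = 0
  ne_bot : K ≠ ⊥
  isClosed : IsClosed (K : Set H₁)

theorem IsInitialSpace.mem_orthogonal {K : Submodule ℂ H₁} {u : H₁ →L[ℂ] H₂}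
    (hu : IsInitialSpace π₁ π₂ K u) {ξ : H₁} (hξ : u ξ = 0) : ξ ∈ Kᗮ := by
  have := hu.isClosed.completeSpace_coe
  obtain ⟨a, ha, b, hb, rfl⟩ := K.exists_add_mem_mem_orthogonal ξ
  rw [map_add, hu.map_orthogonal b hb, add_zero] at hξ
  have ha0 : a = 0 := by rw [← norm_eq_zero, ← hu.norm_map a ha, hξ, norm_zero]
  rwa [ha0, zero_add]

theorem Intertwines.exists_abs {T : H₁ →L[ℂ] H₂} (hT : Intertwines π₁ π₂ T) :
    ∃ A : H₁ →L[ℂ] H₁, Intertwines π₁ π₁ A ∧ ∀ η, ‖A η‖ = ‖T η‖ := by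
  set B : H₁ →L[ℂ] H₁ := (ContinuousLinearMap.adjoint T).comp T
  have hB : 0 ≤ B := (ContinuousLinearMap.nonneg_iff_isPositive B).2 T.isPositive_adjoint_comp_self
  have hBT (η : H₁) : vectorForm η B = ‖T η‖ ^ 2 := (T.apply_norm_sq_eq_inner_adjoint_left η).symm
  refine ⟨CFC.sqrt B, fun x =>
    (Commute.cfcₙ_nnreal (show Commute B (π₁ x) from hT.adjoint.comp hT x) NNReal.sqrt).eq,
    fun η => ?_⟩
  have hsqrt : star (CFC.sqrt B) * CFC.sqrt B = B := by
    rw [(CFC.sqrt_nonneg B).isSelfAdjoint.star_eq, CFC.sqrt_mul_sqrt_self B hB]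
  rw [← sq_eq_sq₀ (norm_nonneg _) (norm_nonneg _), ← hBT, ← vectorForm_star_mul_self,
    hsqrt]

theorem Intertwines.exists_isInitialSpace {T : H₁ →L[ℂ] H₂} (hT : Intertwines π₁ π₂ T)
    (hT0 : T ≠ 0) :
    ∃ u, IsInitialSpace π₂ π₁ (LinearMap.range (T : H₁ →ₗ[ℂ] H₂)).topologicalClosure u := by
  obtain ⟨A, hA, hAT⟩ := hT.exists_abs
  obtain ⟨u, hu, huT, hu0, -⟩ := exists_intertwiner_of_norm_le (π₁ := π₂) (π₂ := π₁)
    (T : H₁ →ₗ[ℂ] H₂) (A : H₁ →ₗ[ℂ] H₁) (fun η => (hAT η).le) (fun y η => π₁ y η)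
    hT.apply hA.apply
  refine ⟨u, hu, fun η hη => ?_, by rwa [Submodule.orthogonal_closure], fun hbot => hT0 ?_,
    Submodule.isClosed_topologicalClosure _⟩
  · refine closure_minimal (t := {η | ‖u η‖ = ‖η‖}) ?_
      (isClosed_eq (by fun_prop) (by fun_prop)) hη
    rintro _ ⟨η, rfl⟩
    exact (congrArg norm (huT η)).trans (hAT η)
  · ext η
    have : T η ∈ (LinearMap.range (T : H₁ →ₗ[ℂ] H₂)).topologicalClosure :=
      subset_closure ⟨η, rfl⟩
    rwa [hbot] at this

theorem exists_isInitialSpace_le (h₁ : IsNormalRep π₁) (h₂ : IsNormalRep π₂)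
    (hinj : Function.Injective π₂) {M : Submodule ℂ H₁} (hM : IsClosed (M : Set H₁))
    (hinv : ∀ x, ∀ η ∈ M, π₁ x η ∈ M) {ξ : H₁} (hξM : ξ ∈ M) (hξ : ξ ≠ 0) :
    ∃ K ≤ M, ∃ u, IsInitialSpace π₁ π₂ K u := by
  obtain ⟨T, hT, hT0, hTM⟩ := exists_intertwiner_ne_zero h₂ hinj h₁ hM hinv hξM hξ
  refine ⟨_, Submodule.topologicalClosure_minimal _ ?_ hM, hT.exists_isInitialSpace hT0⟩
  rintro _ ⟨η, rfl⟩
  exact hTM η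

theorem exists_orthogonal_isInitialSpace (h₁ : IsNormalRep π₁) (h₂ : IsNormalRep π₂)
    (hinj : Function.Injective π₂) :
    ∃ (A : Set (Submodule ℂ H₁)) (u : Submodule ℂ H₁ → H₁ →L[ℂ] H₂),
      A.Pairwise (· ⟂ ·) ∧ (∀ K ∈ A, IsInitialSpace π₁ π₂ K (u K)) ∧
      ∀ ξ, (∀ K ∈ A, u K ξ = 0) → ξ = 0 := by
  obtain ⟨A, hA⟩ := zorn_subset
    {A : Set (Submodule ℂ H₁) | (∀ K ∈ A, ∃ u, IsInitialSpace π₁ π₂ K u) ∧ A.Pairwise (· ⟂ ·)}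
    fun c hc hchain => ⟨⋃₀ c, ⟨fun K ⟨s, hs, hK⟩ => (hc hs).1 K hK,
      (Set.pairwise_sUnion hchain.directedOn).2 fun s hs => (hc hs).2⟩,
      fun s hs => Set.subset_sUnion_of_mem hs⟩
  choose! u hu using hA.prop.1
  refine ⟨A, u, hA.prop.2, hu, fun ξ hξ => ?_⟩
  by_contra hξ0
  let M : Submodule ℂ H₁ := ⨅ K ∈ A, LinearMap.ker (u K : H₁ →ₗ[ℂ] H₂)
  have hmem (η : H₁) : η ∈ M ↔ ∀ K ∈ A, u K η = 0 := by simp [M]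
  have hclosed : IsClosed (M : Set H₁) := by
    simp only [M, Submodule.coe_iInf]
    exact isClosed_biInter fun K _ => (u K).isClosed_ker
  obtain ⟨K', hK'M, u', hu'⟩ := exists_isInitialSpace_le h₁ h₂ hinj hclosed
    (fun x η hη => (hmem _).2 fun K hK => by
      rw [(hu K hK).intertwines.apply, (hmem η).1 hη K hK, map_zero]) ((hmem ξ).2 hξ) hξ0
  have horth (K) (hK : K ∈ A) : K' ⟂ K := fun η hη =>
    (hu K hK).mem_orthogonal ((hmem η).1 (hK'M hη) K hK)
  have hK'A : K' ∈ A := by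
    refine hA.le_of_ge (y := insert K' A) ⟨?_, ?_⟩ (Set.subset_insert _ _) (Set.mem_insert _ _)
    · exact Set.forall_mem_insert.2 ⟨⟨u', hu'⟩, hA.prop.1⟩
    · exact Set.pairwise_insert.2 ⟨hA.prop.2, fun K hK _ => ⟨horth K hK, (horth K hK).symm⟩⟩
  exact hu'.ne_bot (Submodule.isOrtho_self.1 (horth K' hK'A))

theorem isFrame_of_isInitialSpace {A : Set (Submodule ℂ H₁)}
    {u : Submodule ℂ H₁ → H₁ →L[ℂ] H₂} (horth : A.Pairwise (· ⟂ ·))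
    (hu : ∀ K ∈ A, IsInitialSpace π₁ π₂ K (u K))
    (htotal : ∀ ξ, (∀ K ∈ A, u K ξ = 0) → ξ = 0) : IsFrame fun K : A => u K := by
  have hcomp (K : A) : CompleteSpace K.1 := (hu K.1 K.2).isClosed.completeSpace_coe
  have horth' (K L : A) (h : K ≠ L) : K.1 ⟂ L.1 := horth K.2 L.2 (Subtype.coe_ne_coe.2 h)
  have hsum : IsHilbertSum ℂ (fun K : A => K.1) fun K => K.1.subtypeₗᵢ := by
    refine IsHilbertSum.mkInternal _ (.of_pairwise horth') (top_le_iff.2 ?_)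
    rw [Submodule.topologicalClosure_eq_top_iff, Submodule.eq_bot_iff]
    exact fun ξ hξ => htotal ξ fun K hK => (hu K hK).map_orthogonal ξ
      (Submodule.orthogonal_le (le_iSup (fun K : A => K.1) ⟨K, hK⟩) hξ)
  intro ξ
  set W := hsum.linearIsometryEquiv ξ
  have hWξ : HasSum (fun K : A => (W K : H₁)) ξ := by
    simpa [W] using hsum.hasSum_linearIsometryEquiv_symm W
  have hu_apply (K : A) : ‖u K ξ‖ = ‖W K‖ := by
    have hsingle : HasSum (fun L : A => u K (W L : H₁)) (u K (W K : H₁)) :=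
      hasSum_single K fun L hL => (hu K.1 K.2).map_orthogonal _ (horth' L K hL (W L).2)
    rw [((u K).hasSum hWξ).unique hsingle, (hu K.1 K.2).norm_map _ (W K).2]
    rfl
  have hnorm := lp.hasSum_norm (p := 2) (by simp) W
  simpa only [ENNReal.toReal_ofNat, Real.rpow_ofNat, W, LinearIsometryEquiv.norm_map, hu_apply]
    using hnorm

theorem exists_isFrame (h₁ : IsNormalRep π₁) (h₂ : IsNormalRep π₂)
    (hinj : Function.Injective π₂) :
    ∃ (ι : Type u) (v : ι → H₁ →L[ℂ] H₂), (∀ i, Intertwines π₁ π₂ (v i)) ∧ IsFrame v := by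
  obtain ⟨A, u, horth, hu, htotal⟩ := exists_orthogonal_isInitialSpace h₁ h₂ hinj
  exact ⟨A, fun K => u K, fun K => (hu K.1 K.2).intertwines,
    isFrame_of_isInitialSpace horth hu htotal⟩

end Intertwiners

/-! ### The standard representation on `L²(N, τ)` -/

section Standard

variable {H₀ : Type u₀} [NormedAddCommGroup H₀] [InnerProductSpace ℂ H₀] [CompleteSpace H₀]
  {N : VonNeumannAlgebra H₀}

theorem Elem.star_mul_self_eq_zero {x : Elem N} (h : star x * x = 0) : x = 0 :=
  Subtype.ext ((CStarRing.star_mul_self_eq_zero_iff (x : H₀ →L[ℂ] H₀)).1 (congrArg Subtype.val h))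

theorem Elem.isLUB_star_mul_mul {D : Set (Elem N)} (hD : ∀ d ∈ D, 0 ≤ d) (hne : D.Nonempty)
    (hdir : DirectedOn (· ≤ ·) D) {x : Elem N} (hx : IsLUB D x) (b : Elem N) :
    IsLUB ((fun d => star b * d * b) '' D) (star b * x * b) := by
  obtain ⟨d, hd⟩ := id hne
  refine Elem.isLUB_of_isLUB_vectorForm
    (Set.forall_mem_image.2 fun d hd => star_left_conjugate_nonneg (hD d hd) b) (hne.image _)
    (star_left_conjugate_nonneg ((hD d hd).trans (hx.1 hd)) b) fun ξ => ?_
  have h := isNormalRep_iff_isLUB_vectorForm.1 isNormalRep_subtype D hD hne hdir x hx (b.1 ξ)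
  rw [Set.image_image]
  simp only [← vectorForm_star_mul_mul] at h
  exact h

namespace TracialWeight

variable (τ : TracialWeight N)

/-- The embedding of `{x : τ(x*x) < ∞}` into `L²(N, τ)`. -/
abbrev vec (a : τ.PreL2) : τ.L2 := (a : UniformSpace.Completion τ.PreL2)

variable {τ}

theorem denseRange_vec : DenseRange τ.vec := UniformSpace.Completion.denseRange_coe

theorem eq_of_eq_vec {F : Type*} [TopologicalSpace F] [T2Space F] {f g : τ.L2 → F}
    (hf : Continuous f) (hg : Continuous g) (h : ∀ a, f (τ.vec a) = g (τ.vec a)) (ξ : τ.L2) :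
    f ξ = g ξ := congrFun (denseRange_vec.equalizer hf hg (funext h)) ξ

theorem ext_vec {S T : τ.L2 →L[ℂ] τ.L2} (h : ∀ a, S (τ.vec a) = T (τ.vec a)) : S = T :=
  ContinuousLinearMap.ext (eq_of_eq_vec S.continuous T.continuous h)

theorem ext_inner_vec {ξ η : τ.L2} (h : ∀ a, inner ℂ ξ (τ.vec a) = inner ℂ η (τ.vec a)) :
    ξ = η :=
  ext_inner_right ℂ fun ζ => eq_of_eq_vec (f := fun ζ => inner ℂ ξ ζ) (g := fun ζ => inner ℂ η ζ)
    (by fun_prop) (by fun_prop) h ζ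

theorem lmul_vec (x : Elem N) (a : τ.PreL2) : τ.lmul x (τ.vec a) = τ.vec (τ.preLmul x a) :=
  ContinuousLinearMap.completion_apply_coe _ _

theorem J_vec (a : τ.PreL2) : τ.J (τ.vec a) = τ.vec (τ.preJ a) :=
  ContinuousLinearMap.completion_apply_coe _ _

@[simp] theorem val_preLmul (x : Elem N) (a : τ.PreL2) :
    PreL2.val τ (τ.preLmul x a) = x * PreL2.val τ a := rfl

@[simp] theorem val_preJ (a : τ.PreL2) : PreL2.val τ (τ.preJ a) = star (PreL2.val τ a) := rfl

@[simp] theorem preJ_preJ (a : τ.PreL2) : τ.preJ (τ.preJ a) = a := PreL2.ext (by simp)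

theorem inner_eq_reInner (x y : τ.PreL2) :
    inner ℂ x y = (τ.reInner x y : ℂ) + Complex.I * τ.reInner (Complex.I • x) y :=
  τ.polarization_eq x y

theorem norm_vec_sq (a : τ.PreL2) : ‖τ.vec a‖ ^ 2 = τ.quad a := by
  rw [UniformSpace.Completion.norm_coe, norm_sq_preL2]

theorem quad_add_quad (a b : τ.PreL2) : τ.quad a + τ.quad b =
    (τ (star (PreL2.val τ a) * PreL2.val τ a + star (PreL2.val τ b) * PreL2.val τ b)).toReal :=
  (τ.toReal_add (star_mul_self_nonneg _) (star_mul_self_nonneg _) a.2 b.2).1.symm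

theorem reInner_preLmul (x : Elem N) (a b : τ.PreL2) :
    τ.reInner (τ.preLmul x a) b = τ.reInner a (τ.preLmul (star x) b) := by
  have hident (a b : Elem N) : star (x * a + b) * (x * a + b) +
      star (a - star x * b) * (a - star x * b) =
      star (x * a - b) * (x * a - b) + star (a + star x * b) * (a + star x * b) := by
    simp only [star_add, star_sub, star_mul, star_star]
    noncomm_ring
  have hquad : τ.quad (τ.preLmul x a + b) + τ.quad (a - τ.preLmul (star x) b) =
      τ.quad (τ.preLmul x a - b) + τ.quad (a + τ.preLmul (star x) b) := by
    simp only [quad_add_quad, map_add, map_sub, val_preLmul, hident]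
  simp only [reInner]
  linarith

theorem adjoint_lmul (x : Elem N) :
    ContinuousLinearMap.adjoint (τ.lmul x) = τ.lmul (star x) := by
  refine ext_vec fun a => ext_inner_vec fun b => ?_
  rw [ContinuousLinearMap.adjoint_inner_left, lmul_vec, lmul_vec,
    UniformSpace.Completion.inner_coe, UniformSpace.Completion.inner_coe, inner_eq_reInner,
    inner_eq_reInner, ← map_smul, reInner_preLmul, reInner_preLmul, star_star]

variable (τ) in
/-- The representation of `N` on `L²(N, τ)` by left multiplication. -/
def lmulHom : Elem N →⋆ₐ[ℂ] (τ.L2 →L[ℂ] τ.L2) where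
  toFun := τ.lmul
  map_one' := ext_vec fun a => by
    rw [lmul_vec]; exact congrArg τ.vec (PreL2.ext (by simp))
  map_mul' x y := ext_vec fun a => by
    rw [mul_apply_eq_comp, lmul_vec, lmul_vec, lmul_vec]
    exact congrArg τ.vec (PreL2.ext (by simp [mul_assoc]))
  map_zero' := ext_vec fun a => by
    have : τ.preLmul 0 a = 0 := PreL2.ext (by simp)
    rw [lmul_vec, this]; exact UniformSpace.Completion.coe_zero
  map_add' x y := ext_vec fun a => by
    have : τ.preLmul (x + y) a = τ.preLmul x a + τ.preLmul y a := PreL2.ext (by simp [add_mul])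
    rw [add_apply, lmul_vec, lmul_vec, lmul_vec, this]
    exact UniformSpace.Completion.coe_add _ _
  commutes' c := ext_vec fun a => by
    have : τ.preLmul (c • 1) a = c • a := PreL2.ext (by simp)
    rw [lmul_vec, Algebra.algebraMap_eq_smul_one, Algebra.algebraMap_eq_smul_one, this]
    exact UniformSpace.Completion.coe_smul _ _
  map_star' x := by
    rw [ContinuousLinearMap.star_eq_adjoint, adjoint_lmul]

theorem lmulHom_apply (x : Elem N) : τ.lmulHom x = τ.lmul x := rfl

theorem ofReal_vectorForm_vec_lmul {x : Elem N} (hx : 0 ≤ x) (a : τ.PreL2) :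
    ENNReal.ofReal (vectorForm (τ.vec a) (τ.lmulHom x)) =
      τ (star (PreL2.val τ a) * x * PreL2.val τ a) := by
  obtain ⟨s, hs, rfl⟩ := Elem.exists_nonneg_mul_self_eq hx
  have hstar : s * s = star s * s := by rw [hs.isSelfAdjoint.star_eq]
  rw [hstar, vectorForm_map_star_mul_self, lmulHom_apply, lmul_vec, norm_vec_sq, quad,
    ENNReal.ofReal_toReal (PreL2.lt_top τ _).ne]
  simp only [val_preLmul, star_mul, mul_assoc]

theorem isNormalRep_lmulHom (hn : τ.IsNormal) : IsNormalRep τ.lmulHom := by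
  intro D hD hne hdir x hx
  refine ⟨Set.forall_mem_image.2 fun d hd => OrderHomClass.mono τ.lmulHom (hx.1 hd),
    fun U hU => ?_⟩
  obtain ⟨d₀, hd₀⟩ := id hne
  have hx0 : 0 ≤ x := (hD d₀ hd₀).trans (hx.1 hd₀)
  have hU0 : 0 ≤ U := (map_nonneg τ.lmulHom (hD d₀ hd₀)).trans (hU ⟨d₀, hd₀, rfl⟩)
  refine le_of_vectorForm_le (map_nonneg τ.lmulHom hx0).isSelfAdjoint hU0.isSelfAdjoint
    fun ξ => ?_
  refine denseRange_vec.induction_on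
    (p := fun ξ => vectorForm ξ (τ.lmulHom x) ≤ vectorForm ξ U) ξ ?_ fun a => ?_
  · simp only [vectorForm_apply]
    exact isClosed_le (by fun_prop) (by fun_prop)
  have hmono : Monotone fun d => star (PreL2.val τ a) * d * PreL2.val τ a :=
    fun _ _ h => star_left_conjugate_le_conjugate h _
  have hsup := hn _ (Set.forall_mem_image.2 fun d hd => star_left_conjugate_nonneg (hD d hd) _)
    (hne.image _) (hdir.mono_comp fun _ _ h => hmono h) _
    (Elem.isLUB_star_mul_mul hD hne hdir hx (PreL2.val τ a))
  rw [← ENNReal.ofReal_le_ofReal_iff (vectorForm_nonneg hU0 _), ofReal_vectorForm_vec_lmul hx0,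
    hsup, iSup_image]
  refine iSup₂_le fun d hd => ?_
  rw [← ofReal_vectorForm_vec_lmul (hD d hd)]
  exact ENNReal.ofReal_le_ofReal (vectorForm_mono _ (hU ⟨d, hd, rfl⟩))

theorem exists_val_mul_self_eq {y : Elem N} (hy : 0 ≤ y) (hτ : τ y < ∞) :
    ∃ a : τ.PreL2, 0 ≤ PreL2.val τ a ∧ PreL2.val τ a * PreL2.val τ a = y := by
  obtain ⟨s, hs, rfl⟩ := Elem.exists_nonneg_mul_self_eq hy
  exact ⟨PreL2.mk τ s (by rwa [hs.isSelfAdjoint.star_eq]), hs, rfl⟩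

theorem val_eq_zero_of_vec_eq_zero (hf : τ.IsFaithful) {a : τ.PreL2} (h : τ.vec a = 0) :
    PreL2.val τ a = 0 := by
  have hquad : τ.quad a = 0 := by rw [← norm_vec_sq, h, norm_zero, zero_pow two_ne_zero]
  exact Elem.star_mul_self_eq_zero (hf _ (star_mul_self_nonneg _)
    (((ENNReal.toReal_eq_zero_iff _).1 hquad).resolve_right (PreL2.lt_top τ a).ne))

theorem lmulHom_injective (hf : τ.IsFaithful) (hs : τ.IsSemifinite) :
    Function.Injective τ.lmulHom := by
  rw [injective_iff_map_eq_zero]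
  intro x hx
  by_contra hx0
  obtain ⟨y, hy, hyx, hy0, hyτ⟩ := hs (star x * x) (star_mul_self_nonneg x)
    fun h => hx0 (Elem.star_mul_self_eq_zero h)
  obtain ⟨a, ha, rfl⟩ := exists_val_mul_self_eq hy hyτ
  have hzero : τ.lmulHom (PreL2.val τ a * PreL2.val τ a) = 0 := by
    refine le_antisymm ((OrderHomClass.mono τ.lmulHom hyx).trans_eq ?_) (map_nonneg τ.lmulHom hy)
    rw [map_mul, hx, mul_zero]
  have hnorm := vectorForm_map_star_mul_self τ.lmulHom (τ.vec a) (PreL2.val τ a)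
  rw [ha.isSelfAdjoint.star_eq, hzero, map_zero, lmulHom_apply, lmul_vec, eq_comm,
    sq_eq_zero_iff, norm_eq_zero] at hnorm
  exact hy0 (val_eq_zero_of_vec_eq_zero hf hnorm)

/-! ### The modular conjugation and the commutation theorem -/

theorem J_J (ξ : τ.L2) : τ.J (τ.J ξ) = ξ := by
  refine eq_of_eq_vec (f := fun ξ => τ.J (τ.J ξ)) (by fun_prop) continuous_id (fun a => ?_) ξ
  rw [J_vec, J_vec, preJ_preJ, id]

theorem quad_preJ (a : τ.PreL2) : τ.quad (τ.preJ a) = τ.quad a := by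
  simp only [quad, val_preJ]
  rw [τ.tracial, star_star]

theorem reInner_preJ (a b : τ.PreL2) : τ.reInner (τ.preJ a) (τ.preJ b) = τ.reInner a b := by
  rw [reInner, ← map_add, ← map_sub, quad_preJ, quad_preJ, reInner]

theorem inner_preJ_preJ (a b : τ.PreL2) : inner ℂ (τ.preJ a) (τ.preJ b) = inner ℂ b a := by
  have h : Complex.I • τ.preJ a = τ.preJ (-(Complex.I • a)) := by
    rw [map_neg, map_smulₛₗ, Complex.conj_I, neg_smul, neg_neg]
  rw [← inner_conj_symm b a, inner_eq_reInner, inner_eq_reInner, h, reInner_preJ, reInner_preJ,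
    τ.reInner_neg]
  simp

theorem inner_J_J (ξ η : τ.L2) : inner ℂ (τ.J ξ) (τ.J η) = inner ℂ η ξ := by
  refine eq_of_eq_vec (f := fun ξ => inner ℂ (τ.J ξ) (τ.J η))
    (g := fun ξ => inner ℂ η ξ) (by fun_prop) (by fun_prop) (fun a => ?_) ξ
  refine eq_of_eq_vec (f := fun η => inner ℂ (τ.J (τ.vec a)) (τ.J η))
    (g := fun η => inner ℂ η (τ.vec a)) (by fun_prop) (by fun_prop) (fun b => ?_) η
  rw [J_vec, J_vec, UniformSpace.Completion.inner_coe, UniformSpace.Completion.inner_coe,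
    inner_preJ_preJ]

theorem inner_J_left (ξ η : τ.L2) : inner ℂ (τ.J ξ) η = inner ℂ (τ.J η) ξ := by
  conv_lhs => rw [← J_J η]
  exact inner_J_J _ _

/-- Conjugation `T ↦ J T J` of operators on `L²(N, τ)`. -/
def conjOp (T : τ.L2 →L[ℂ] τ.L2) : τ.L2 →L[ℂ] τ.L2 := τ.J.comp (T.comp τ.J)

theorem conjOp_apply (T : τ.L2 →L[ℂ] τ.L2) (ξ : τ.L2) : conjOp T ξ = τ.J (T (τ.J ξ)) := rfl

theorem conjOp_conjOp (T : τ.L2 →L[ℂ] τ.L2) : conjOp (conjOp T) = T := by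
  ext ξ; simp [conjOp_apply, J_J]

theorem conjOp_comp (S T : τ.L2 →L[ℂ] τ.L2) : conjOp (S.comp T) = (conjOp S).comp (conjOp T) := by
  ext ξ; simp [conjOp_apply, J_J]

theorem conjOp_add (S T : τ.L2 →L[ℂ] τ.L2) : conjOp (S + T) = conjOp S + conjOp T := by
  ext ξ; simp [conjOp_apply]

theorem conjOp_zero : conjOp (0 : τ.L2 →L[ℂ] τ.L2) = 0 := by
  ext ξ; simp [conjOp_apply]

theorem adjoint_conjOp (T : τ.L2 →L[ℂ] τ.L2) :
    ContinuousLinearMap.adjoint (conjOp T) = conjOp (ContinuousLinearMap.adjoint T) := by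
  symm
  rw [ContinuousLinearMap.eq_adjoint_iff]
  intro ξ η
  rw [conjOp_apply, conjOp_apply, inner_J_left, ContinuousLinearMap.adjoint_inner_right,
    ← inner_J_J, J_J]

theorem vectorForm_conjOp (T : τ.L2 →L[ℂ] τ.L2) (ξ : τ.L2) :
    vectorForm ξ (conjOp T) = vectorForm (τ.J ξ) T := by
  rw [vectorForm_apply, vectorForm_apply, conjOp_apply, inner_J_left]
  exact inner_re_symm (𝕜 := ℂ) _ _

theorem conjOp_nonneg {T : τ.L2 →L[ℂ] τ.L2} (hT : 0 ≤ T) : 0 ≤ conjOp T := by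
  have hself : IsSelfAdjoint (conjOp T) := by
    rw [IsSelfAdjoint, ContinuousLinearMap.star_eq_adjoint, adjoint_conjOp,
      hT.isSelfAdjoint.adjoint_eq]
  refine le_of_vectorForm_le (.zero _) hself fun ξ => ?_
  rw [map_zero, vectorForm_conjOp]
  exact vectorForm_nonneg hT _

theorem conjOp_mono : Monotone (conjOp (τ := τ)) := fun S T hST => by
  rw [← add_sub_cancel S T, conjOp_add]
  exact le_add_of_nonneg_right (conjOp_nonneg (sub_nonneg.2 hST))

/-- Right multiplication by `x` on `L²(N, τ)`, encoded as `J x* J`. -/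
def rmul (x : Elem N) : τ.L2 →L[ℂ] τ.L2 := conjOp (τ.lmul (star x))

theorem lmul_val_vec (a b : τ.PreL2) :
    τ.lmul (PreL2.val τ a) (τ.vec b) = rmul (PreL2.val τ b) (τ.vec a) := by
  rw [rmul, conjOp_apply, J_vec, lmul_vec, lmul_vec, J_vec]
  exact congrArg τ.vec (PreL2.ext (by simp))

theorem adjoint_rmul (x : Elem N) :
    ContinuousLinearMap.adjoint (rmul (τ := τ) x) = rmul (star x) := by
  rw [rmul, adjoint_conjOp, adjoint_lmul, rmul]

theorem lmul_rmul_comm (x y : Elem N) (ξ : τ.L2) :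
    τ.lmul x (rmul y ξ) = rmul y (τ.lmul x ξ) := by
  refine eq_of_eq_vec (f := fun ξ => τ.lmul x (rmul y ξ)) (by fun_prop)
    (g := fun ξ => rmul y (τ.lmul x ξ)) (by fun_prop) (fun a => ?_) ξ
  simp only [rmul, conjOp_apply, J_vec, lmul_vec]
  exact congrArg τ.vec (PreL2.ext (by simp [mul_assoc]))

theorem inner_lmul_rmul (x y : Elem N) (ξ η : τ.L2) :
    inner ℂ (τ.lmul x ξ) (rmul y η) = inner ℂ (rmul (star y) ξ) (τ.lmul (star x) η) := by
  rw [← adjoint_rmul, ContinuousLinearMap.adjoint_inner_left, ← lmul_rmul_comm, ← adjoint_lmul,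
    ContinuousLinearMap.adjoint_inner_right]

/-- Membership in the commutant of the left multiplications. -/
abbrev CommutesLmul (T : τ.L2 →L[ℂ] τ.L2) : Prop := Intertwines τ.lmulHom τ.lmulHom T

/-- Membership in the commutant of the right multiplications. -/
def CommutesRmul (S : τ.L2 →L[ℂ] τ.L2) : Prop := ∀ x ξ, S (rmul x ξ) = rmul x (S ξ)

theorem CommutesRmul.adjoint {S : τ.L2 →L[ℂ] τ.L2} (hS : CommutesRmul S) :
    CommutesRmul (ContinuousLinearMap.adjoint S) := by
  intro x ξ
  refine ext_inner_right ℂ fun η => ?_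
  rw [ContinuousLinearMap.adjoint_inner_left, ← star_star x, ← adjoint_rmul,
    ContinuousLinearMap.adjoint_inner_left, ContinuousLinearMap.adjoint_inner_left, ← hS,
    ContinuousLinearMap.adjoint_inner_left]

theorem CommutesLmul.commutesRmul_conjOp {T : τ.L2 →L[ℂ] τ.L2} (hT : CommutesLmul T) :
    CommutesRmul (conjOp T) := by
  intro x ξ
  simp only [rmul, conjOp_apply, J_J]
  exact congrArg τ.J (hT.apply (star x) _)

theorem eq_zero_of_forall_lmul_eq_zero (hn : τ.IsNormal) (hs : τ.IsSemifinite) {ξ : τ.L2}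
    (h : ∀ a : τ.PreL2, τ.lmul (PreL2.val τ a) ξ = 0) : ξ = 0 := by
  by_contra hξ
  obtain ⟨e, he, he0, hpos⟩ := exists_vectorForm_pos (isNormalRep_lmulHom hn) hξ
  obtain ⟨y, hy, hye, hy0, hyτ⟩ := hs e he he0
  obtain ⟨a, -, rfl⟩ := exists_val_mul_self_eq hy hyτ
  refine (hpos _ hy hye hy0).ne' ?_
  rw [map_mul, vectorForm_apply, mul_apply_eq_comp, lmulHom_apply, h, map_zero, inner_zero_left,
    Complex.zero_re]

theorem ext_inner_lmul_vec (hn : τ.IsNormal) (hs : τ.IsSemifinite) {ξ η : τ.L2}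
    (h : ∀ a b : τ.PreL2, inner ℂ ξ (τ.lmul (PreL2.val τ a) (τ.vec b)) =
      inner ℂ η (τ.lmul (PreL2.val τ a) (τ.vec b))) : ξ = η := by
  refine sub_eq_zero.1 (eq_zero_of_forall_lmul_eq_zero hn hs fun a => ?_)
  rw [map_sub, sub_eq_zero]
  refine ext_inner_vec fun b => ?_
  have hab := h (τ.preJ a) b
  rwa [val_preJ, ← adjoint_lmul, ContinuousLinearMap.adjoint_inner_right,
    ContinuousLinearMap.adjoint_inner_right] at hab

theorem eq_of_inner_lmul_vec (hn : τ.IsNormal) (hs : τ.IsSemifinite) {S T : τ.L2 →L[ℂ] τ.L2}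
    (h : ∀ a b c d : τ.PreL2,
      inner ℂ (S (τ.lmul (PreL2.val τ a) (τ.vec b))) (τ.lmul (PreL2.val τ c) (τ.vec d)) =
      inner ℂ (T (τ.lmul (PreL2.val τ a) (τ.vec b))) (τ.lmul (PreL2.val τ c) (τ.vec d))) :
    S = T := by
  rw [← (ContinuousLinearMap.adjoint (𝕜 := ℂ)).injective.eq_iff]
  ext ξ
  refine ext_inner_lmul_vec hn hs fun a b => ?_
  rw [ContinuousLinearMap.adjoint_inner_left, ContinuousLinearMap.adjoint_inner_left,
    ext_inner_lmul_vec hn hs (h a b)]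

theorem CommutesRmul.lmul_adjoint_vec {S : τ.L2 →L[ℂ] τ.L2} (hS : CommutesRmul S)
    (a c : τ.PreL2) :
    τ.lmul (star (PreL2.val τ a)) (ContinuousLinearMap.adjoint S (τ.vec c)) =
      τ.J (τ.lmul (star (PreL2.val τ c)) (S (τ.vec a))) := by
  refine ext_inner_vec fun x => ?_
  rw [← adjoint_lmul, ContinuousLinearMap.adjoint_inner_left,
    ContinuousLinearMap.adjoint_inner_left, lmul_val_vec, hS, ← star_star (PreL2.val τ x),
    ← adjoint_rmul, ContinuousLinearMap.adjoint_inner_right, ← val_preJ, ← lmul_val_vec,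
    inner_J_left, ← adjoint_lmul, ContinuousLinearMap.adjoint_inner_right, J_vec]

theorem CommutesLmul.rmul_adjoint_vec {T : τ.L2 →L[ℂ] τ.L2} (hT : CommutesLmul T)
    (b d : τ.PreL2) :
    rmul (star (PreL2.val τ b)) (ContinuousLinearMap.adjoint T (τ.vec d)) =
      τ.J (rmul (star (PreL2.val τ d)) (T (τ.vec b))) := by
  refine ext_inner_vec fun x => ?_
  rw [← adjoint_rmul, ContinuousLinearMap.adjoint_inner_left,
    ContinuousLinearMap.adjoint_inner_left, ← lmul_val_vec, ← lmulHom_apply, hT.apply,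
    lmulHom_apply, ← star_star (PreL2.val τ x), ← adjoint_lmul,
    ContinuousLinearMap.adjoint_inner_right, ← val_preJ, lmul_val_vec, inner_J_left,
    ← adjoint_rmul, ContinuousLinearMap.adjoint_inner_right, J_vec]

theorem CommutesRmul.comp_comm (hn : τ.IsNormal) (hs : τ.IsSemifinite) {S T : τ.L2 →L[ℂ] τ.L2}
    (hS : CommutesRmul S) (hT : CommutesLmul T) : S.comp T = T.comp S := by
  refine eq_of_inner_lmul_vec hn hs fun a b c d => ?_
  simp only [ContinuousLinearMap.comp_apply]
  have hSab : S (τ.lmul (PreL2.val τ a) (τ.vec b)) = rmul (PreL2.val τ b) (S (τ.vec a)) := by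
    rw [lmul_val_vec, hS]
  have hScd : ContinuousLinearMap.adjoint S (τ.lmul (PreL2.val τ c) (τ.vec d)) =
      rmul (PreL2.val τ d) (ContinuousLinearMap.adjoint S (τ.vec c)) := by
    rw [lmul_val_vec, hS.adjoint]
  calc
    _ = inner ℂ (τ.lmul (PreL2.val τ a) (T (τ.vec b)))
        (rmul (PreL2.val τ d) (ContinuousLinearMap.adjoint S (τ.vec c))) := by
      rw [← ContinuousLinearMap.adjoint_inner_right, hScd, ← lmulHom_apply, hT.apply]
    _ = inner ℂ (rmul (star (PreL2.val τ d)) (T (τ.vec b)))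
        (τ.lmul (star (PreL2.val τ a)) (ContinuousLinearMap.adjoint S (τ.vec c))) :=
      inner_lmul_rmul _ _ _ _
    _ = inner ℂ (τ.lmul (star (PreL2.val τ c)) (S (τ.vec a)))
        (rmul (star (PreL2.val τ b)) (ContinuousLinearMap.adjoint T (τ.vec d))) := by
      rw [hS.lmul_adjoint_vec, hT.rmul_adjoint_vec, ← inner_J_J, J_J]
    _ = inner ℂ (rmul (PreL2.val τ b) (S (τ.vec a)))
        (τ.lmul (PreL2.val τ c) (ContinuousLinearMap.adjoint T (τ.vec d))) := by
      rw [inner_lmul_rmul, star_star, star_star]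
    _ = _ := by
      rw [← ContinuousLinearMap.adjoint_inner_right T, ← lmulHom_apply (PreL2.val τ c),
        hT.adjoint.apply, hSab, lmulHom_apply]

end TracialWeight

end Standard

section OperatorConjugation

variable {H K : Type*} [NormedAddCommGroup H] [InnerProductSpace ℂ H] [CompleteSpace H]
  [NormedAddCommGroup K] [InnerProductSpace ℂ K] [CompleteSpace K]

theorem vectorForm_conj_adjoint (v : H →L[ℂ] K) (Z : H →L[ℂ] H) (ξ : K) :
    vectorForm ξ (v.comp (Z.comp (ContinuousLinearMap.adjoint v))) =
      vectorForm (ContinuousLinearMap.adjoint v ξ) Z := by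
  rw [vectorForm_apply, vectorForm_apply, ContinuousLinearMap.comp_apply,
    ContinuousLinearMap.comp_apply, ContinuousLinearMap.adjoint_inner_right]

theorem vectorForm_comp_adjoint (v : H →L[ℂ] K) (ξ : K) :
    vectorForm ξ (v.comp (ContinuousLinearMap.adjoint v)) =
      ‖ContinuousLinearMap.adjoint v ξ‖ ^ 2 := by
  rw [← vectorForm_one, ← vectorForm_conj_adjoint, ContinuousLinearMap.one_def,
    ContinuousLinearMap.id_comp]

theorem vectorForm_adjoint_comp (v : H →L[ℂ] K) (ξ : H) :
    vectorForm ξ ((ContinuousLinearMap.adjoint v).comp v) = ‖v ξ‖ ^ 2 := by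
  simpa only [ContinuousLinearMap.adjoint_adjoint] using
    vectorForm_comp_adjoint (ContinuousLinearMap.adjoint v) ξ

theorem comp_adjoint_nonneg (v : H →L[ℂ] K) : 0 ≤ v.comp (ContinuousLinearMap.adjoint v) :=
  (ContinuousLinearMap.nonneg_iff_isPositive _).2 v.isPositive_self_comp_adjoint

theorem adjoint_comp_nonneg (v : H →L[ℂ] K) : 0 ≤ (ContinuousLinearMap.adjoint v).comp v :=
  (ContinuousLinearMap.nonneg_iff_isPositive _).2 v.isPositive_adjoint_comp_self

theorem conj_adjoint_nonneg (v : H →L[ℂ] K) {Z : H →L[ℂ] H} (hZ : 0 ≤ Z) :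
    0 ≤ v.comp (Z.comp (ContinuousLinearMap.adjoint v)) :=
  (ContinuousLinearMap.nonneg_iff_isPositive _).2
    (((ContinuousLinearMap.nonneg_iff_isPositive Z).1 hZ).conj_adjoint v)

end OperatorConjugation

section Amplification

variable {H₀ : Type u₀} [NormedAddCommGroup H₀] [InnerProductSpace ℂ H₀] [CompleteSpace H₀]
  {N : VonNeumannAlgebra H₀}

namespace TracialWeight

variable {τ : TracialWeight N}

/-! ### Coordinates in the amplification -/

section Coordinates

variable {ι : Type w}

variable (τ) in
/-- The `i`-th coordinate map of `L²(N, τ) ⊗ ℓ²(ι)`, the adjoint of the `i`-th inclusion. -/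
def coord (i : ι) : τ.Amp ι →L[ℂ] τ.L2 := ContinuousLinearMap.adjoint (τ.coordEmb i)

theorem coord_apply (i : ι) (f : τ.Amp ι) : τ.coord i f = f i := by
  classical
  refine ext_inner_left ℂ fun η => ?_
  rw [coord, ContinuousLinearMap.adjoint_inner_right]
  exact lp.inner_single_left (G := fun _ : ι => τ.L2) (𝕜 := ℂ) i η f

theorem adjoint_coord (i : ι) : ContinuousLinearMap.adjoint (τ.coord i) = τ.coordEmb i :=
  ContinuousLinearMap.adjoint_adjoint _

theorem ext_coord {f g : τ.Amp ι} (h : ∀ i, τ.coord i f = τ.coord i g) : f = g := by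
  ext i
  simpa only [coord_apply] using h i

theorem ext_coordEmb {F : Type*} [NormedAddCommGroup F] [NormedSpace ℂ F]
    {S T : τ.Amp ι →L[ℂ] F} (h : ∀ i η, S (τ.coordEmb i η) = T (τ.coordEmb i η)) : S = T := by
  classical
  refine lp.ext_continuousLinearMap (by simp) fun i => ContinuousLinearMap.ext fun η => ?_
  exact h i η

theorem coord_coordEmb_self (i : ι) (η : τ.L2) : τ.coord i (τ.coordEmb i η) = η := by
  classical
  rw [coord_apply]
  exact lp.single_apply_self (E := fun _ : ι => τ.L2) 2 i η

theorem coord_coordEmb_of_ne {i j : ι} (h : i ≠ j) (η : τ.L2) :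
    τ.coord i (τ.coordEmb j η) = 0 := by
  classical
  rw [coord_apply]
  exact lp.single_apply_ne (E := fun _ : ι => τ.L2) 2 j η h

theorem coord_amplify (T : τ.L2 →L[ℂ] τ.L2) (i : ι) (f : τ.Amp ι) :
    τ.coord i (τ.amplify ι T f) = T (τ.coord i f) := by
  rw [coord_apply, coord_apply]; rfl

theorem coord_ampJ (i : ι) (f : τ.Amp ι) : τ.coord i (τ.ampJ ι f) = τ.J (τ.coord i f) := by
  rw [coord_apply, coord_apply]; rfl

theorem amplify_coordEmb (T : τ.L2 →L[ℂ] τ.L2) (j : ι) (η : τ.L2) :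
    τ.amplify ι T (τ.coordEmb j η) = τ.coordEmb j (T η) := by
  refine ext_coord fun i => ?_
  rw [coord_amplify]
  by_cases h : i = j
  · subst h; rw [coord_coordEmb_self, coord_coordEmb_self]
  · rw [coord_coordEmb_of_ne h, coord_coordEmb_of_ne h, map_zero]

theorem ampJ_coordEmb (j : ι) (η : τ.L2) :
    τ.ampJ ι (τ.coordEmb j η) = τ.coordEmb j (τ.J η) := by
  refine ext_coord fun i => ?_
  rw [coord_ampJ]
  by_cases h : i = j
  · subst h; rw [coord_coordEmb_self, coord_coordEmb_self]
  · rw [coord_coordEmb_of_ne h, coord_coordEmb_of_ne h, map_zero]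

theorem hasSum_norm_coord (f : τ.Amp ι) :
    HasSum (fun i => ‖τ.coord i f‖ ^ 2) (‖f‖ ^ 2) := by
  have hn := lp.hasSum_norm (p := 2) (by simp) f
  simp only [ENNReal.toReal_ofNat, Real.rpow_ofNat] at hn
  simpa only [coord_apply] using hn

end Coordinates

section Frames

variable {ι : Type w} {H : Type u} [NormedAddCommGroup H] [InnerProductSpace ℂ H]

theorem exists_coord_apply_eq {c : ι → H →L[ℂ] τ.L2}
    (hc : ∀ (s : Finset ι) ξ, ∑ i ∈ s, ‖c i ξ‖ ^ 2 ≤ ‖ξ‖ ^ 2) :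
    ∃ W : H →L[ℂ] τ.Amp ι, ∀ ξ i, τ.coord i (W ξ) = c i ξ := by
  have hsummable (ξ : H) : Summable fun i => ‖c i ξ‖ ^ 2 :=
    summable_of_sum_le (fun i => by positivity) fun s => hc s ξ
  let W : H →ₗ[ℂ] τ.Amp ι :=
    { toFun := fun ξ => ⟨fun i => c i ξ, memℓp_gen (by simpa using hsummable ξ)⟩
      map_add' := fun ξ η => by ext i; exact map_add (c i) ξ η
      map_smul' := fun a ξ => by ext i; exact map_smul (c i) a ξ }
  have hW (ξ : H) (i : ι) : τ.coord i (W ξ) = c i ξ := by rw [coord_apply]; rfl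
  have hnorm (ξ : H) : ‖W ξ‖ ≤ 1 * ‖ξ‖ := by
    rw [one_mul, ← sq_le_sq₀ (norm_nonneg _) (norm_nonneg _), ← (hasSum_norm_coord _).tsum_eq]
    simp only [hW]
    exact (hsummable ξ).tsum_le_of_sum_le fun s => hc s ξ
  exact ⟨W.mkContinuous 1 hnorm, hW⟩

theorem isClosed_setOf_hasSum_norm_sq {c : ι → H →L[ℂ] τ.L2}
    (hc : ∀ (s : Finset ι) ξ, ∑ i ∈ s, ‖c i ξ‖ ^ 2 ≤ ‖ξ‖ ^ 2) :
    IsClosed {ξ | HasSum (fun i => ‖c i ξ‖ ^ 2) (‖ξ‖ ^ 2)} := by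
  obtain ⟨W, hW⟩ := exists_coord_apply_eq hc
  have hsum (ξ : H) : HasSum (fun i => ‖c i ξ‖ ^ 2) (‖W ξ‖ ^ 2) := by
    simpa only [hW] using hasSum_norm_coord (W ξ)
  have heq : {ξ | HasSum (fun i => ‖c i ξ‖ ^ 2) (‖ξ‖ ^ 2)} = {ξ | ‖W ξ‖ ^ 2 = ‖ξ‖ ^ 2} :=
    Set.ext fun ξ => ⟨(hsum ξ).unique, fun h => Eq.subst (motive := HasSum _) h (hsum ξ)⟩
  rw [heq]
  exact isClosed_eq (by fun_prop) (by fun_prop)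

theorem exists_isometry_of_isFrame {v : ι → H →L[ℂ] τ.L2} (hv : IsFrame v) :
    ∃ V : H →ₗᵢ[ℂ] τ.Amp ι, ∀ i, (τ.coord i).comp V.toContinuousLinearMap = v i := by
  obtain ⟨W, hW⟩ := exists_coord_apply_eq fun s ξ =>
    sum_le_hasSum s (fun i _ => by positivity) (hv ξ)
  refine ⟨⟨W.toLinearMap, fun ξ => ?_⟩, fun i => ContinuousLinearMap.ext fun ξ => hW ξ i⟩
  rw [← sq_eq_sq₀ (norm_nonneg _) (norm_nonneg _)]
  refine (hasSum_norm_coord (W ξ)).unique ?_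
  simpa only [hW] using hv ξ

theorem hasSum_inner_of_isFrame {v : ι → H →L[ℂ] τ.L2} (hv : IsFrame v) (ξ η : H) :
    HasSum (fun i => inner ℂ (v i ξ) (v i η)) (inner ℂ ξ η) := by
  obtain ⟨V, hV⟩ := exists_isometry_of_isFrame hv
  rw [← V.inner_map_map]
  simp only [← hV, ContinuousLinearMap.comp_apply, coord_apply]
  exact lp.hasSum_inner (𝕜 := ℂ) (V ξ) (V η)

theorem isFrame_coord (V : H →ₗᵢ[ℂ] τ.Amp ι) :
    IsFrame fun i => (τ.coord i).comp V.toContinuousLinearMap := fun ξ => by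
  simpa using hasSum_norm_coord (V ξ)

variable [CompleteSpace H] {π : Elem N →⋆ₐ[ℂ] (H →L[ℂ] H)}

theorem isStandardIntertwiner_iff (V : H →ₗᵢ[ℂ] τ.Amp ι) : τ.IsStandardIntertwiner π V ↔
    ∀ i, Intertwines π τ.lmulHom ((τ.coord i).comp V.toContinuousLinearMap) := by
  constructor
  · intro h i x
    rw [ContinuousLinearMap.comp_assoc, h x]
    ext1 ξ
    exact coord_amplify _ _ _
  · intro h x
    ext1 ξ
    refine ext_coord fun i => ?_
    rw [ContinuousLinearMap.comp_apply (τ.amplify ι _), coord_amplify]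
    exact (h i).apply x ξ

theorem matrixEntry_conjRangeProj (V : H →ₗᵢ[ℂ] τ.Amp ι) (i j : ι) :
    τ.matrixEntry (τ.conjRangeProj V) i j =
      conjOp (((τ.coord i).comp V.toContinuousLinearMap).comp
        (ContinuousLinearMap.adjoint ((τ.coord j).comp V.toContinuousLinearMap))) := by
  ext1 η
  rw [ContinuousLinearMap.adjoint_comp, adjoint_coord]
  change τ.coord i (τ.ampJ ι (V (ContinuousLinearMap.adjoint V.toContinuousLinearMap
    (τ.ampJ ι (τ.coordEmb j η))))) = _
  rw [coord_ampJ, ampJ_coordEmb]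
  rfl

end Frames

/-! ### The bicommutant of the standard representation -/

/-- `τ` is a faithful normal semifinite tracial weight. -/
structure IsFNS (τ : TracialWeight N) : Prop where
  faithful : τ.IsFaithful
  normal : τ.IsNormal
  semifinite : τ.IsSemifinite

theorem IsFNS.isNormalRep (h : τ.IsFNS) : IsNormalRep τ.lmulHom := isNormalRep_lmulHom h.normal

theorem IsFNS.injective (h : τ.IsFNS) : Function.Injective τ.lmulHom :=
  lmulHom_injective h.faithful h.semifinite

section Bicommutant

variable {H : Type u} [NormedAddCommGroup H] [InnerProductSpace ℂ H] [CompleteSpace H]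
  {π : Elem N →⋆ₐ[ℂ] (H →L[ℂ] H)} {S : τ.L2 →L[ℂ] τ.L2}

theorem comp_adjoint_comp_amplify {ι : Type w} {V : H →ₗᵢ[ℂ] τ.Amp ι}
    (hS : ∀ T, CommutesLmul T → S.comp T = T.comp S)
    (hV : ∀ i, Intertwines π τ.lmulHom ((τ.coord i).comp V.toContinuousLinearMap))
    {u : H →L[ℂ] τ.L2} (hu : Intertwines π τ.lmulHom u) :
    (u.comp (ContinuousLinearMap.adjoint V.toContinuousLinearMap)).comp (τ.amplify ι S) =
      S.comp (u.comp (ContinuousLinearMap.adjoint V.toContinuousLinearMap)) := by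
  refine ext_coordEmb fun j η => ?_
  have hcomm := hS _ (hu.comp (hV j).adjoint)
  rw [ContinuousLinearMap.adjoint_comp, adjoint_coord] at hcomm
  rw [ContinuousLinearMap.comp_apply, amplify_coordEmb]
  exact (DFunLike.congr_fun hcomm η).symm

theorem exists_comp_eq_comp_of_isFrame {ι : Type w} {v : ι → H →L[ℂ] τ.L2}
    (hS : ∀ T, CommutesLmul T → S.comp T = T.comp S)
    (hv : ∀ i, Intertwines π τ.lmulHom (v i)) (hframe : IsFrame v) :
    ∃ S' : H →L[ℂ] H, ∀ u, Intertwines π τ.lmulHom u → S.comp u = u.comp S' := by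
  obtain ⟨V, hV⟩ := exists_isometry_of_isFrame hframe
  have hVV : (ContinuousLinearMap.adjoint V.toContinuousLinearMap).comp
      V.toContinuousLinearMap = 1 :=
    (ContinuousLinearMap.norm_map_iff_adjoint_comp_self _).1 V.norm_map
  refine ⟨(ContinuousLinearMap.adjoint V.toContinuousLinearMap).comp
    ((τ.amplify ι S).comp V.toContinuousLinearMap), fun u hu => ?_⟩
  have hcomm := comp_adjoint_comp_amplify hS (fun i => (hV i).symm ▸ hv i) hu
  rw [← ContinuousLinearMap.comp_assoc, ← ContinuousLinearMap.comp_assoc, hcomm,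
    ContinuousLinearMap.comp_assoc, ContinuousLinearMap.comp_assoc, hVV,
    ContinuousLinearMap.one_def, ContinuousLinearMap.comp_id]

theorem mem_of_comp_eq_comp {ι : Type w} {v : ι → H₀ →L[ℂ] τ.L2} {S' : H₀ →L[ℂ] H₀}
    (hv : ∀ i, Intertwines N.toStarSubalgebra.subtype τ.lmulHom (v i)) (hframe : IsFrame v)
    (hS' : ∀ u, Intertwines N.toStarSubalgebra.subtype τ.lmulHom u → S.comp u = u.comp S') :
    S' ∈ N := by
  refine mem_of_forall_mem_commutant fun t ht => ContinuousLinearMap.ext fun ξ => ?_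
  have htN : Intertwines N.toStarSubalgebra.subtype N.toStarSubalgebra.subtype t := fun x =>
    (VonNeumannAlgebra.mem_commutant_iff.1 ht x x.2).symm
  refine sub_eq_zero.1 (hframe.eq_zero fun i => ?_)
  rw [map_sub, sub_eq_zero]
  calc v i (t (S' ξ)) = S (v i (t ξ)) := (DFunLike.congr_fun (hS' _ ((hv i).comp htN)) ξ).symm
    _ = v i (S' (t ξ)) := DFunLike.congr_fun (hS' _ (hv i)) (t ξ)

theorem IsFNS.eq_of_comp_eq_comp (h : τ.IsFNS) {S T : τ.L2 →L[ℂ] τ.L2}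
    (hST : ∀ u, Intertwines N.toStarSubalgebra.subtype τ.lmulHom u → S.comp u = T.comp u) :
    S = T := by
  obtain ⟨ι, v, hv, hframe⟩ := exists_isFrame h.isNormalRep (isNormalRep_subtype (N := N))
    Subtype.val_injective
  rw [← (ContinuousLinearMap.adjoint (𝕜 := ℂ)).injective.eq_iff]
  ext1 ξ
  refine sub_eq_zero.1 (hframe.eq_zero fun i => ?_)
  have hadj := congrArg ContinuousLinearMap.adjoint (hST _ (hv i).adjoint)
  simp only [ContinuousLinearMap.adjoint_comp, ContinuousLinearMap.adjoint_adjoint] at hadj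
  rw [map_sub, sub_eq_zero]
  exact DFunLike.congr_fun hadj ξ

theorem IsFNS.exists_lmul_eq (h : τ.IsFNS) (hS : ∀ T, CommutesLmul T → S.comp T = T.comp S) :
    ∃ z, τ.lmul z = S := by
  obtain ⟨ι, v, hv, hframe⟩ :=
    exists_isFrame (isNormalRep_subtype (N := N)) h.isNormalRep h.injective
  obtain ⟨S', hS'⟩ := exists_comp_eq_comp_of_isFrame hS hv hframe
  exact ⟨⟨S', mem_of_comp_eq_comp hv hframe hS'⟩, h.eq_of_comp_eq_comp fun u hu =>
    (hu ⟨S', _⟩).symm.trans (hS' u hu).symm⟩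

end Bicommutant

theorem IsFNS.exists_lmul_eq_conjOp (h : τ.IsFNS) {T : τ.L2 →L[ℂ] τ.L2} (hT : CommutesLmul T) :
    ∃ z, τ.lmul z = conjOp T :=
  h.exists_lmul_eq fun _ hS => hT.commutesRmul_conjOp.comp_comm h.normal h.semifinite hS

theorem IsFNS.nonneg_of_lmulHom_nonneg (h : τ.IsFNS) {x : Elem N} (hx : 0 ≤ τ.lmulHom x) :
    0 ≤ x := by
  obtain ⟨b, hb⟩ := h.exists_lmul_eq (S := CFC.sqrt (τ.lmulHom x)) fun T hT =>
    (Commute.cfcₙ_nnreal (show Commute (τ.lmulHom x) T from (hT x).symm) NNReal.sqrt).eq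
  rw [← lmulHom_apply] at hb
  have hx' : x = star b * b := h.injective (by
    rw [map_mul, map_star, hb, (CFC.sqrt_nonneg (τ.lmulHom x)).isSelfAdjoint.star_eq,
      CFC.sqrt_mul_sqrt_self _ hx])
  rw [hx']
  exact star_mul_self_nonneg b

theorem IsFNS.lmulHom_le_lmulHom_iff (h : τ.IsFNS) {x y : Elem N} :
    τ.lmulHom x ≤ τ.lmulHom y ↔ x ≤ y := by
  refine ⟨fun hxy => ?_, fun hxy => OrderHomClass.mono τ.lmulHom hxy⟩
  rw [← sub_nonneg]
  exact h.nonneg_of_lmulHom_nonneg (by rwa [map_sub, sub_nonneg])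

/-! ### The trace on the commutant -/

theorem IsFNS.opTrace_lmul (h : τ.IsFNS) {x : Elem N} (hx : 0 ≤ x) :
    τ.opTrace (τ.lmul x) = τ x := by
  refine le_antisymm (iInf₂_le_of_le x hx (iInf_le _ rfl)) ?_
  refine le_iInf₂ fun y _ => le_iInf fun hxy => ?_
  rw [h.injective hxy]

/-- The trace `T ↦ τ(J T J)` on the positive part of the commutant of the left multiplications. -/
def comTrace (T : τ.L2 →L[ℂ] τ.L2) : ℝ≥0∞ := τ.opTrace (conjOp T)

theorem IsFNS.exists_comTrace_eq (h : τ.IsFNS) {T : τ.L2 →L[ℂ] τ.L2} (hT : CommutesLmul T)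
    (hT0 : 0 ≤ T) : ∃ z, 0 ≤ z ∧ τ.lmulHom z = conjOp T ∧ comTrace T = τ z := by
  obtain ⟨z, hz⟩ := h.exists_lmul_eq_conjOp hT
  have hz0 : 0 ≤ z :=
    h.nonneg_of_lmulHom_nonneg (by rw [lmulHom_apply, hz]; exact conjOp_nonneg hT0)
  exact ⟨z, hz0, hz, by rw [comTrace, ← hz, h.opTrace_lmul hz0]⟩

theorem IsFNS.comTrace_comp_adjoint (h : τ.IsFNS) {T : τ.L2 →L[ℂ] τ.L2} (hT : CommutesLmul T) :
    comTrace (T.comp (ContinuousLinearMap.adjoint T)) =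
      comTrace ((ContinuousLinearMap.adjoint T).comp T) := by
  obtain ⟨z, hz⟩ := h.exists_lmul_eq_conjOp hT
  have hz_star : conjOp (ContinuousLinearMap.adjoint T) = τ.lmul (star z) := by
    rw [← adjoint_conjOp, ← hz, adjoint_lmul]
  have hmul (x y : Elem N) : (τ.lmul x).comp (τ.lmul y) = τ.lmul (x * y) :=
    (map_mul τ.lmulHom x y).symm
  rw [comTrace, comTrace, conjOp_comp, conjOp_comp, hz_star, ← hz, hmul, hmul,
    h.opTrace_lmul (mul_star_self_nonneg z), h.opTrace_lmul (star_mul_self_nonneg z), τ.tracial]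

theorem IsFNS.comTrace_add (h : τ.IsFNS) {S T : τ.L2 →L[ℂ] τ.L2} (hS : CommutesLmul S)
    (hS0 : 0 ≤ S) (hT : CommutesLmul T) (hT0 : 0 ≤ T) :
    comTrace (S + T) = comTrace S + comTrace T := by
  obtain ⟨y, hy, hyS, hτy⟩ := h.exists_comTrace_eq hS hS0
  obtain ⟨z, hz, hzT, hτz⟩ := h.exists_comTrace_eq hT hT0
  rw [hτy, hτz, ← τ.add_of_nonneg y z hy hz, comTrace, conjOp_add, ← hyS, ← hzT, ← map_add,
    lmulHom_apply, h.opTrace_lmul (add_nonneg hy hz)]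

theorem IsFNS.comTrace_zero (h : τ.IsFNS) : comTrace (0 : τ.L2 →L[ℂ] τ.L2) = 0 := by
  have hτ0 : τ 0 = 0 := by simpa using τ.smul_of_nonneg 0 0 le_rfl
  rw [comTrace, conjOp_zero, ← map_zero τ.lmulHom, lmulHom_apply, h.opTrace_lmul le_rfl, hτ0]

theorem IsFNS.comTrace_mono (h : τ.IsFNS) {S T : τ.L2 →L[ℂ] τ.L2} (hS : CommutesLmul S)
    (hS0 : 0 ≤ S) (hT : CommutesLmul T) (hST : S ≤ T) : comTrace S ≤ comTrace T := by
  obtain ⟨y, hy, hyS, hτy⟩ := h.exists_comTrace_eq hS hS0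
  obtain ⟨z, -, hzT, hτz⟩ := h.exists_comTrace_eq hT (hS0.trans hST)
  rw [hτy, hτz]
  refine τ.mono hy (h.lmulHom_le_lmulHom_iff.1 ?_)
  rw [hyS, hzT]
  exact conjOp_mono hST

theorem IsFNS.comTrace_iSup (h : τ.IsFNS) {α : Type*} [Preorder α] [IsDirectedOrder α] [Nonempty α]
    {T : α → τ.L2 →L[ℂ] τ.L2} {T' : τ.L2 →L[ℂ] τ.L2} (hmono : Monotone T)
    (hT : ∀ i, CommutesLmul (T i)) (hT0 : ∀ i, 0 ≤ T i) (hT' : CommutesLmul T') (hT0' : 0 ≤ T')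
    (hlub : ∀ ξ, IsLUB (Set.range fun i => vectorForm ξ (T i)) (vectorForm ξ T')) :
    comTrace T' = ⨆ i, comTrace (T i) := by
  choose y hy hyT hτy using fun i => h.exists_comTrace_eq (hT i) (hT0 i)
  obtain ⟨z, hz, hzT, hτz⟩ := h.exists_comTrace_eq hT' hT0'
  have hpos : ∀ d ∈ Set.range y, 0 ≤ d := Set.forall_mem_range.2 hy
  have hymono : Monotone y := fun i j hij => by
    rw [← h.lmulHom_le_lmulHom_iff, hyT, hyT]
    exact conjOp_mono (hmono hij)
  have hyz : IsLUB (Set.range y) z := by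
    refine IsLUB.of_image h.lmulHom_le_lmulHom_iff (isLUB_of_isLUB_vectorForm
      (Set.forall_mem_image.2 fun d hd => map_nonneg τ.lmulHom (hpos d hd))
      ((Set.range_nonempty y).image _) (map_nonneg τ.lmulHom hz) fun ξ => ?_)
    simp only [← Set.range_comp, Function.comp_def, hyT, hzT, vectorForm_conjOp]
    exact hlub (τ.J ξ)
  rw [hτz, h.normal _ hpos (Set.range_nonempty y) (directedOn_range.2 hymono.directed_le) z hyz,
    iSup_range]
  exact iSup_congr fun i => (hτy i).symm

theorem IsFNS.comTrace_sum (h : τ.IsFNS) {α : Type*} {T : α → τ.L2 →L[ℂ] τ.L2}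
    (hT : ∀ i, CommutesLmul (T i)) (hT0 : ∀ i, 0 ≤ T i) (s : Finset α) :
    comTrace (∑ i ∈ s, T i) = ∑ i ∈ s, comTrace (T i) := by
  classical
  induction s using Finset.induction_on with
  | empty => exact h.comTrace_zero
  | insert a s ha ih =>
    rw [Finset.sum_insert ha, Finset.sum_insert ha, h.comTrace_add (hT a) (hT0 a)
      (Intertwines.sum hT s) (Finset.sum_nonneg fun i _ => hT0 i), ih]

theorem IsFNS.comTrace_hasSum (h : τ.IsFNS) {α : Type*}
    {T : α → τ.L2 →L[ℂ] τ.L2} {T' : τ.L2 →L[ℂ] τ.L2} (hT : ∀ i, CommutesLmul (T i))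
    (hT0 : ∀ i, 0 ≤ T i) (hT' : CommutesLmul T') (hT0' : 0 ≤ T')
    (hsum : ∀ ξ, HasSum (fun i => vectorForm ξ (T i)) (vectorForm ξ T')) :
    comTrace T' = ∑' i, comTrace (T i) := by
  have hmono : Monotone fun s : Finset α => ∑ i ∈ s, T i := fun s t hst =>
    Finset.sum_le_sum_of_subset_of_nonneg hst fun i _ _ => hT0 i
  rw [ENNReal.tsum_eq_iSup_sum, h.comTrace_iSup hmono (Intertwines.sum hT)
    (fun s => Finset.sum_nonneg fun i _ => hT0 i) hT' hT0' fun ξ => ?_]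
  · exact iSup_congr fun s => h.comTrace_sum hT hT0 s
  · refine isLUB_of_tendsto_atTop (fun s t hst => vectorForm_mono ξ (hmono hst)) ?_
    simp only [map_sum]
    exact hsum ξ

/-! ### Independence of the frame -/

section Exchange

variable {H : Type u} [NormedAddCommGroup H] [InnerProductSpace ℂ H] [CompleteSpace H]
  {π : Elem N →⋆ₐ[ℂ] (H →L[ℂ] H)} {κ ι : Type*}

theorem IsFNS.comTrace_comp_adjoint_eq_tsum (h : τ.IsFNS) {v : κ → H →L[ℂ] τ.L2}
    (hv : ∀ j, Intertwines π τ.lmulHom (v j)) (hframe : IsFrame v) {c : H →L[ℂ] τ.L2}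
    (hc : Intertwines π τ.lmulHom c) :
    comTrace (c.comp (ContinuousLinearMap.adjoint c)) =
      ∑' j, comTrace (((v j).comp (ContinuousLinearMap.adjoint c)).comp
        (ContinuousLinearMap.adjoint ((v j).comp (ContinuousLinearMap.adjoint c)))) := by
  have hT (j) : CommutesLmul ((v j).comp (ContinuousLinearMap.adjoint c)) :=
    (hv j).comp hc.adjoint
  rw [h.comTrace_hasSum (fun j => (hT j).adjoint.comp (hT j))
    (fun j => adjoint_comp_nonneg _) (hc.comp hc.adjoint) (comp_adjoint_nonneg _) fun ξ => ?_]
  · exact tsum_congr fun j => (h.comTrace_comp_adjoint (hT j)).symm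
  · simp only [vectorForm_adjoint_comp, vectorForm_comp_adjoint]
    exact hframe _

theorem IsFNS.comTrace_conj_eq_tsum (h : τ.IsFNS) {v : H →L[ℂ] τ.L2}
    (hv : Intertwines π τ.lmulHom v) {c : ι → H →L[ℂ] τ.L2}
    (hc : ∀ i, Intertwines π τ.lmulHom (c i)) {Z : H →L[ℂ] H} (hZ : Intertwines π π Z)
    (hZ0 : 0 ≤ Z) (hsum : ∀ ξ, HasSum (fun i => ‖c i ξ‖ ^ 2) (vectorForm ξ Z)) :
    comTrace (v.comp (Z.comp (ContinuousLinearMap.adjoint v))) =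
      ∑' i, comTrace ((v.comp (ContinuousLinearMap.adjoint (c i))).comp
        (ContinuousLinearMap.adjoint (v.comp (ContinuousLinearMap.adjoint (c i))))) := by
  have hT (i) : CommutesLmul (v.comp (ContinuousLinearMap.adjoint (c i))) :=
    hv.comp (hc i).adjoint
  refine h.comTrace_hasSum (fun i => (hT i).comp (hT i).adjoint)
    (fun i => comp_adjoint_nonneg _) (hv.comp (hZ.comp hv.adjoint)) (conj_adjoint_nonneg _ hZ0)
    fun ξ => ?_
  simp only [vectorForm_comp_adjoint, vectorForm_conj_adjoint]
  simp only [ContinuousLinearMap.adjoint_comp, ContinuousLinearMap.adjoint_adjoint,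
    ContinuousLinearMap.comp_apply]
  exact hsum _

theorem IsFNS.tsum_comTrace_eq (h : τ.IsFNS) {v : κ → H →L[ℂ] τ.L2}
    (hv : ∀ j, Intertwines π τ.lmulHom (v j)) (hframe : IsFrame v) {c : ι → H →L[ℂ] τ.L2}
    (hc : ∀ i, Intertwines π τ.lmulHom (c i)) {Z : H →L[ℂ] H} (hZ : Intertwines π π Z)
    (hZ0 : 0 ≤ Z) (hsum : ∀ ξ, HasSum (fun i => ‖c i ξ‖ ^ 2) (vectorForm ξ Z)) :
    ∑' i, comTrace ((c i).comp (ContinuousLinearMap.adjoint (c i))) =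
      ∑' j, comTrace ((v j).comp (Z.comp (ContinuousLinearMap.adjoint (v j)))) := by
  simp only [fun i => h.comTrace_comp_adjoint_eq_tsum hv hframe (hc i),
    fun j => h.comTrace_conj_eq_tsum (hv j) hc hZ hZ0 hsum]
  exact ENNReal.tsum_comm

theorem IsFNS.tsum_comTrace_eq_of_isFrame (h : τ.IsFNS) {v : κ → H →L[ℂ] τ.L2}
    (hv : ∀ j, Intertwines π τ.lmulHom (v j)) (hvframe : IsFrame v) {c : ι → H →L[ℂ] τ.L2}
    (hc : ∀ i, Intertwines π τ.lmulHom (c i)) (hcframe : IsFrame c) :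
    ∑' i, comTrace ((c i).comp (ContinuousLinearMap.adjoint (c i))) =
      ∑' j, comTrace ((v j).comp (ContinuousLinearMap.adjoint (v j))) := by
  rw [h.tsum_comTrace_eq hv hvframe hc .one zero_le_one fun ξ => by
    rw [vectorForm_one]; exact hcframe ξ]
  simp only [ContinuousLinearMap.one_def, ContinuousLinearMap.id_comp]

theorem tensorTrace_conjRangeProj {ι : Type w} (V : H →ₗᵢ[ℂ] τ.Amp ι) :
    τ.tensorTrace (τ.conjRangeProj V) =
      ∑' i, comTrace (((τ.coord i).comp V.toContinuousLinearMap).comp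
        (ContinuousLinearMap.adjoint ((τ.coord i).comp V.toContinuousLinearMap))) :=
  tsum_congr fun i => by rw [matrixEntry_conjRangeProj]; rfl

theorem IsFNS.memTensor_conjRangeProj (h : τ.IsFNS) {ι : Type w} {V : H →ₗᵢ[ℂ] τ.Amp ι}
    (hV : τ.IsStandardIntertwiner π V) : τ.MemTensor (τ.conjRangeProj V) := by
  intro i j
  rw [isStandardIntertwiner_iff] at hV
  rw [matrixEntry_conjRangeProj]
  exact h.exists_lmul_eq_conjOp ((hV i).comp (hV j).adjoint)

theorem IsFNS.exists_isStandardIntertwiner (h : τ.IsFNS) (hπ : IsNormalRep π) :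
    ∃ (ι : Type u) (V : H →ₗᵢ[ℂ] τ.Amp ι), τ.IsStandardIntertwiner π V := by
  obtain ⟨ι, v, hv, hframe⟩ := exists_isFrame hπ h.isNormalRep h.injective
  obtain ⟨V, hV⟩ := exists_isometry_of_isFrame hframe
  exact ⟨ι, V, (isStandardIntertwiner_iff V).2 fun i => by rw [hV]; exact hv i⟩

theorem IsFNS.dim_eq (h : τ.IsFNS) (hπ : IsNormalRep π) {v : κ → H →L[ℂ] τ.L2}
    (hv : ∀ j, Intertwines π τ.lmulHom (v j)) (hframe : IsFrame v) :
    τ.dim π = ∑' j, comTrace ((v j).comp (ContinuousLinearMap.adjoint (v j))) := by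
  have htrace (ι : Type u) (V : H →ₗᵢ[ℂ] τ.Amp ι) (hV : τ.IsStandardIntertwiner π V) :
      τ.tensorTrace (τ.conjRangeProj V) =
        ∑' j, comTrace ((v j).comp (ContinuousLinearMap.adjoint (v j))) := by
    rw [tensorTrace_conjRangeProj]
    exact h.tsum_comTrace_eq_of_isFrame hv hframe ((isStandardIntertwiner_iff V).1 hV)
      (isFrame_coord V)
  obtain ⟨ι, V, hV⟩ := h.exists_isStandardIntertwiner hπ
  refine le_antisymm ?_ (le_iInf fun ι => le_iInf₂ fun V hV => (htrace ι V hV).ge)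
  rw [← htrace ι V hV]
  exact iInf₂_le_of_le ι V (iInf_le _ hV)

theorem IsFNS.dim_eq_tensorTrace (h : τ.IsFNS) (hπ : IsNormalRep π) {ι : Type w}
    {V : H →ₗᵢ[ℂ] τ.Amp ι} (hV : τ.IsStandardIntertwiner π V) :
    τ.dim π = τ.tensorTrace (τ.conjRangeProj V) := by
  rw [tensorTrace_conjRangeProj]
  exact h.dim_eq hπ ((isStandardIntertwiner_iff V).1 hV) (isFrame_coord V)

end Exchange

end TracialWeight

end Amplification

section Corners

variable {H₀ : Type u₀} [NormedAddCommGroup H₀] [InnerProductSpace ℂ H₀] [CompleteSpace H₀]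
  {N : VonNeumannAlgebra H₀}
  {H : Type u} [NormedAddCommGroup H] [InnerProductSpace ℂ H] [CompleteSpace H]
  {π : Elem N →⋆ₐ[ℂ] (H →L[ℂ] H)}

/-! ### Corners -/

section Corner

theorem StarProj.compress_extend (e : StarProj H) (y : e.space →L[ℂ] e.space) :
    e.compress (e.extend y) = y := by
  ext1 ξ
  simp [StarProj.compress, StarProj.extend, StarProj.proj_incl_apply]

theorem StarProj.extend_compress (e : StarProj H) (x : H →L[ℂ] H) :
    e.extend (e.compress x) = e.1 * x * e.1 := by
  ext1 ξ
  simp [StarProj.compress, StarProj.extend, StarProj.incl_proj_apply]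

theorem Proj.star_eq (p : Proj N) : star p.1 = p.1 := p.2.isSelfAdjoint.star_eq

theorem Proj.mul_self (p : Proj N) : p.1 * p.1 = p.1 := p.2.isIdempotentElem

theorem Proj.nonneg (p : Proj N) : 0 ≤ p.1 := p.2.nonneg

theorem Proj.mem_map_space_iff (p : Proj N) {ξ : H} : ξ ∈ (p.map π).space ↔ π p.1 ξ = ξ :=
  (p.map π).mem_space_iff

variable (p : Proj N)

theorem cornerIncl_injective : Function.Injective (cornerIncl p) := fun x y h => by
  have hop := congrArg (fun z : Elem N => p.op.compress z.1) h
  simp only [cornerIncl, StarProj.compress_extend] at hop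
  exact Subtype.ext hop

theorem cornerIncl_zero : cornerIncl p 0 = 0 := by simpa using cornerIncl_smul p 0 0

theorem cornerIncl_mono : Monotone (cornerIncl p) := fun x y h => by
  have hadd := cornerIncl_add p (y - x) x
  rw [sub_add_cancel] at hadd
  rw [hadd]
  exact le_add_of_nonneg_left (cornerIncl_nonneg p (sub_nonneg.2 h))

theorem proj_mul_cornerIncl (y : Elem (corner p)) : p.1 * cornerIncl p y = cornerIncl p y :=
  Subtype.ext (p.op.mul_extend y.1)

theorem cornerIncl_mul_proj (y : Elem (corner p)) : cornerIncl p y * p.1 = cornerIncl p y :=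
  Subtype.ext (p.op.extend_mul' y.1)

/-- The compression `x ↦ p x p` from `N` to `pNp`. -/
def cornerCompress (x : Elem N) : Elem (corner p) :=
  ⟨p.op.compress x.1, by
    change p.op.extend (p.op.compress x.1) ∈ N
    rw [StarProj.extend_compress]
    exact mul_mem (mul_mem p.op_mem x.2) p.op_mem⟩

theorem cornerIncl_cornerCompress (x : Elem N) :
    cornerIncl p (cornerCompress p x) = p.1 * x * p.1 :=
  Subtype.ext (p.op.extend_compress x.1)

theorem cornerCompress_nonneg {x : Elem N} (hx : 0 ≤ x) : 0 ≤ cornerCompress p x :=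
  (ContinuousLinearMap.nonneg_iff_isPositive _).2 <|
    ((ContinuousLinearMap.nonneg_iff_isPositive _).1 hx).adjoint_conj p.op.incl

theorem StarProj.vectorForm_extend (e : StarProj H) (y : e.space →L[ℂ] e.space) (ξ : H) :
    vectorForm ξ (e.extend y) = vectorForm (e.proj ξ) y :=
  vectorForm_conj_adjoint e.incl y ξ

theorem directedOn_cornerIncl_image {D : Set (Elem (corner p))} (hdir : DirectedOn (· ≤ ·) D) :
    DirectedOn (· ≤ ·) (cornerIncl p '' D) :=
  directedOn_image.2 (hdir.mono' fun _ _ _ _ h => cornerIncl_mono p h)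

theorem isLUB_cornerIncl {D : Set (Elem (corner p))} (hD : ∀ d ∈ D, 0 ≤ d) (hne : D.Nonempty)
    (hdir : DirectedOn (· ≤ ·) D) {x : Elem (corner p)} (hx : IsLUB D x) :
    IsLUB (cornerIncl p '' D) (cornerIncl p x) := by
  obtain ⟨d, hd⟩ := id hne
  refine Elem.isLUB_of_isLUB_vectorForm (Set.forall_mem_image.2 fun d hd =>
    cornerIncl_nonneg p (hD d hd)) (hne.image _)
    (cornerIncl_nonneg p ((hD d hd).trans (hx.1 hd))) fun ξ => ?_
  have h := isNormalRep_iff_isLUB_vectorForm.1 isNormalRep_subtype D hD hne hdir x hx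
    (p.op.proj ξ)
  rw [Set.image_image]
  simp only [cornerIncl, StarProj.vectorForm_extend]
  exact h

theorem vectorForm_cornerRep (y : Elem (corner p)) (ξ : (p.map π).space) :
    vectorForm ξ (cornerRep π p y) = vectorForm (ξ : H) (π (cornerIncl p y)) := by
  rw [vectorForm_apply, vectorForm_apply]
  change (inner ℂ ((p.map π).proj (π (cornerIncl p y) ((p.map π).incl ξ))) ξ).re = _
  rw [StarProj.proj, ContinuousLinearMap.adjoint_inner_left]
  rfl

theorem coe_cornerRep (y : Elem (corner p)) (ξ : (p.map π).space) :
    (cornerRep π p y ξ : H) = π (cornerIncl p y) ξ := by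
  change ((p.map π).proj (π (cornerIncl p y) (ξ : H)) : H) = _
  rw [StarProj.proj_apply]
  change π p.1 (π (cornerIncl p y) (ξ : H)) = _
  rw [← mul_apply_eq_comp, ← map_mul, proj_mul_cornerIncl]

theorem IsNormalRep.cornerRep (hπ : IsNormalRep π) : IsNormalRep (VNDim.cornerRep π p) :=
  isNormalRep_iff_isLUB_vectorForm.2 fun D hD hne hdir x hx ξ => by
    have h := isNormalRep_iff_isLUB_vectorForm.1 hπ (cornerIncl p '' D)
      (Set.forall_mem_image.2 fun d hd => cornerIncl_nonneg p (hD d hd)) (hne.image _)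
      (directedOn_cornerIncl_image p hdir) _ (isLUB_cornerIncl p hD hne hdir hx) (ξ : H)
    rw [Set.image_image] at h
    simpa only [vectorForm_cornerRep] using h

end Corner

section CornerWeight

variable {τ : TracialWeight N} {p : Proj N}

namespace TracialWeight

theorem cornerWeight_apply (y : Elem (corner p)) :
    τ.cornerWeight p y = (τ p.1)⁻¹ * τ (cornerIncl p y) := rfl

theorem mul_cornerWeight (hp0 : τ p.1 ≠ 0) (hp : τ p.1 < ∞) (y : Elem (corner p)) :
    τ p.1 * τ.cornerWeight p y = τ (cornerIncl p y) := by
  rw [cornerWeight_apply, ENNReal.mul_inv_cancel_left hp0 hp.ne]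

theorem cornerWeight_one (hp0 : τ p.1 ≠ 0) (hp : τ p.1 < ∞) : τ.cornerWeight p 1 = 1 := by
  rw [cornerWeight_apply, cornerIncl_one, ENNReal.inv_mul_cancel hp0 hp.ne]

theorem cornerWeight_lt_top (hp0 : τ p.1 ≠ 0) (hp : τ p.1 < ∞) {y : Elem (corner p)}
    (hy : 0 ≤ y) : τ.cornerWeight p y < ∞ := by
  obtain ⟨s, hs, rfl⟩ := Elem.exists_nonneg_mul_self_eq hy
  have hle := conj_le (cornerIncl p s) p.1
  rw [cornerIncl_mul_proj, p.star_eq, p.mul_self, ← cornerIncl_star, hs.isSelfAdjoint.star_eq,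
    ← cornerIncl_mul] at hle
  refine ENNReal.mul_lt_top (ENNReal.inv_lt_top.2 (pos_iff_ne_zero.2 hp0)) ?_
  refine (τ.mono (cornerIncl_nonneg p hy) hle).trans_lt ?_
  rw [τ.smul_of_nonneg _ _ p.nonneg]
  exact ENNReal.mul_lt_top (by simp) hp

theorem IsFNS.cornerWeight (h : τ.IsFNS) (hp0 : τ p.1 ≠ 0) (hp : τ p.1 < ∞) :
    (τ.cornerWeight p).IsFNS where
  faithful y hy h0 := by
    rw [cornerWeight_apply, mul_eq_zero, ENNReal.inv_eq_zero] at h0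
    refine cornerIncl_injective p ?_
    rw [cornerIncl_zero, h.faithful _ (cornerIncl_nonneg p hy) (h0.resolve_left hp.ne)]
  normal D hD hne hdir x hx := by
    rw [cornerWeight_apply, h.normal _
      (Set.forall_mem_image.2 fun d hd => cornerIncl_nonneg p (hD d hd)) (hne.image _)
      (directedOn_cornerIncl_image p hdir) _ (isLUB_cornerIncl p hD hne hdir hx), iSup_image]
    simp only [ENNReal.mul_iSup]
    rfl
  semifinite x hx hx0 := ⟨x, hx, le_rfl, hx0, cornerWeight_lt_top hp0 hp hx⟩

theorem cornerIncl_lt_top (hp0 : τ p.1 ≠ 0) (hp : τ p.1 < ∞) (x : (τ.cornerWeight p).PreL2) :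
    τ (star (cornerIncl p (PreL2.val _ x)) * cornerIncl p (PreL2.val _ x)) < ∞ := by
  rw [← cornerIncl_star, ← cornerIncl_mul, ← mul_cornerWeight hp0 hp]
  exact ENNReal.mul_lt_top hp (PreL2.lt_top _ x)

/-- The inclusion of `{x ∈ pNp : τ(x*x) < ∞}` into `{x ∈ N : τ(x*x) < ∞}`. -/
def cornerVec (hp0 : τ p.1 ≠ 0) (hp : τ p.1 < ∞) : (τ.cornerWeight p).PreL2 →ₗ[ℂ] τ.PreL2 where
  toFun x := PreL2.mk τ (cornerIncl p (PreL2.val _ x)) (cornerIncl_lt_top hp0 hp x)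
  map_add' x y := PreL2.ext (by simp [cornerIncl_add])
  map_smul' c x := PreL2.ext (by simp [cornerIncl_smul])

@[simp] theorem val_cornerVec (hp0 : τ p.1 ≠ 0) (hp : τ p.1 < ∞) (x : (τ.cornerWeight p).PreL2) :
    PreL2.val τ (cornerVec hp0 hp x) = cornerIncl p (PreL2.val _ x) := rfl

theorem quad_cornerVec (hp0 : τ p.1 ≠ 0) (hp : τ p.1 < ∞) (x : (τ.cornerWeight p).PreL2) :
    τ.quad (cornerVec hp0 hp x) = (τ p.1).toReal * (τ.cornerWeight p).quad x := by
  rw [quad, quad, ← ENNReal.toReal_mul, mul_cornerWeight hp0 hp, cornerIncl_mul, cornerIncl_star,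
    val_cornerVec]

theorem exists_cornerEmbedding (hp0 : τ p.1 ≠ 0) (hp : τ p.1 < ∞) :
    ∃ U : (τ.cornerWeight p).L2 →ₗᵢ[ℂ] τ.L2, ∀ x,
      U (vec _ x) = ((Real.sqrt (τ p.1).toReal)⁻¹ : ℂ) • τ.vec (cornerVec hp0 hp x) := by
  have ht : 0 < (τ p.1).toReal := ENNReal.toReal_pos hp0 hp.ne
  let f : (τ.cornerWeight p).PreL2 →ₗ[ℂ] (τ.cornerWeight p).L2 :=
    UniformSpace.Completion.toComplₗᵢ.toLinearMap
  let g : (τ.cornerWeight p).PreL2 →ₗ[ℂ] τ.L2 := ((Real.sqrt (τ p.1).toReal)⁻¹ : ℂ) •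
    UniformSpace.Completion.toComplₗᵢ.toLinearMap ∘ₗ cornerVec hp0 hp
  have hgf : ∀ x, ‖g x‖ = ‖f x‖ := fun x => by
    change ‖((Real.sqrt (τ p.1).toReal)⁻¹ : ℂ) • τ.vec (cornerVec hp0 hp x)‖ = ‖vec _ x‖
    rw [← sq_eq_sq₀ (norm_nonneg _) (norm_nonneg _), norm_smul, mul_pow, norm_vec_sq, norm_vec_sq,
      quad_cornerVec, norm_inv, Complex.norm_real, Real.norm_eq_abs, inv_pow, sq_abs,
      Real.sq_sqrt ht.le, inv_mul_cancel_left₀ ht.ne']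
  obtain ⟨U, hU, -, -⟩ := exists_extension_of_norm_le f g fun x => (hgf x).le
  exact ⟨⟨U, eq_of_eq_vec (by fun_prop) (by fun_prop)
    fun x => (congrArg norm (hU x)).trans (hgf x)⟩, hU⟩

end TracialWeight

end CornerWeight

/-! ### The central support of a projection in a representation -/

section CyclicSpace

variable (π) (p : Proj N)

/-- The closed submodule `[π(N) π(p) H]`. -/
def cyclicSpace : Submodule ℂ H :=
  (Submodule.span ℂ (Set.range fun q : Elem N × H => π q.1 (π p.1 q.2))).topologicalClosure

instance : CompleteSpace (cyclicSpace π p) :=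
  (Submodule.isClosed_topologicalClosure _).completeSpace_coe

/-- The projection onto `[π(N) π(p) H]`. -/
def cyclicProj : H →L[ℂ] H := (cyclicSpace π p).starProjection

variable {π}

theorem map_map_mem_cyclicSpace (x : Elem N) (ξ : H) : π x (π p.1 ξ) ∈ cyclicSpace π p :=
  Submodule.le_topologicalClosure _ (Submodule.subset_span ⟨(x, ξ), rfl⟩)

variable {p} in
theorem cyclicSpace_le {M : Submodule ℂ H} (hM : IsClosed (M : Set H))
    (h : ∀ x ξ, π x (π p.1 ξ) ∈ M) : cyclicSpace π p ≤ M :=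
  Submodule.topologicalClosure_minimal _
    (Submodule.span_le.2 (Set.range_subset_iff.2 fun q => h q.1 q.2)) hM

variable {p} in
theorem map_mem_cyclicSpace (x : Elem N) {ξ : H} (hξ : ξ ∈ cyclicSpace π p) :
    π x ξ ∈ cyclicSpace π p := by
  have hle : cyclicSpace π p ≤ (cyclicSpace π p).comap (π x : H →ₗ[ℂ] H) := by
    refine cyclicSpace_le ((Submodule.isClosed_topologicalClosure _).preimage (π x).continuous)
      fun y η => ?_
    change π x (π y (π p.1 η)) ∈ cyclicSpace π p
    rw [← mul_apply_eq_comp, ← map_mul]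
    exact map_map_mem_cyclicSpace p _ _
  exact hle hξ

theorem intertwines_cyclicProj : Intertwines π π (cyclicProj π p) :=
  intertwines_starProjection fun x _ => map_mem_cyclicSpace x

theorem vectorForm_cyclicProj (ξ : H) :
    vectorForm ξ (cyclicProj π p) = ‖cyclicProj π p ξ‖ ^ 2 := by
  have h : IsStarProjection (cyclicProj π p) := isStarProjection_starProjection
  rw [← vectorForm_star_mul_self, h.isSelfAdjoint.star_eq, h.isIdempotentElem.eq]

theorem cyclicProj_nonneg : 0 ≤ cyclicProj π p :=
  (isStarProjection_starProjection (U := cyclicSpace π p)).nonneg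

end CyclicSpace

theorem Intertwines.inner_map_proj_left {K : Type*} [NormedAddCommGroup K]
    [InnerProductSpace ℂ K] [CompleteSpace K] {ρ : Elem N →⋆ₐ[ℂ] (K →L[ℂ] K)} {T : H →L[ℂ] K}
    (hT : Intertwines π ρ T) (p : Proj N) (x : Elem N) (ξ η : H) :
    inner ℂ (T (π x (π p.1 ξ))) (T η) = inner ℂ (T (π p.1 ξ)) (T (π p.1 (π (star x) η))) := by
  have hp : ρ p.1 (T (π p.1 ξ)) = T (π p.1 ξ) := by
    rw [← hT.apply, ← mul_apply_eq_comp, ← map_mul, p.mul_self]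
  rw [hT.apply x, inner_map_apply_left, ← hT.apply (star x), hT.apply p.1 (π (star x) η),
    ← p.star_eq, ← inner_map_apply_left, p.star_eq, hp]

namespace TracialWeight

variable {τ : TracialWeight N}

theorem hasSum_norm_sq_starProjection {ι : Type w} {K : Type*} [NormedAddCommGroup K]
    [InnerProductSpace ℂ K] {c : ι → K →L[ℂ] τ.L2} {M : Submodule ℂ K}
    [M.topologicalClosure.HasOrthogonalProjection]
    (hM : ∀ ξ ∈ M, HasSum (fun i => ‖c i ξ‖ ^ 2) (‖ξ‖ ^ 2))
    (hc : ∀ i, ∀ ξ ∈ M.topologicalClosureᗮ, c i ξ = 0) (ξ : K) :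
    HasSum (fun i => ‖c i ξ‖ ^ 2) (‖M.topologicalClosure.starProjection ξ‖ ^ 2) := by
  set P := M.topologicalClosure.starProjection
  have hproj : ∀ i ξ, c i (P ξ) = c i ξ := fun i ξ => by
    rw [← sub_eq_zero, ← map_sub, ← neg_sub, map_neg, neg_eq_zero]
    exact hc i _ (M.topologicalClosure.sub_starProjection_mem_orthogonal ξ)
  have hmem : ∀ ξ, P ξ ∈ M.topologicalClosure := M.topologicalClosure.starProjection_apply_mem
  have hbound : ∀ (s : Finset ι) ξ, ∑ i ∈ s, ‖c i ξ‖ ^ 2 ≤ ‖ξ‖ ^ 2 := by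
    intro s ξ
    have hclosed : IsClosed {ξ | ∑ i ∈ s, ‖c i ξ‖ ^ 2 ≤ ‖ξ‖ ^ 2} :=
      isClosed_le (by fun_prop) (by fun_prop)
    have hP : ∑ i ∈ s, ‖c i (P ξ)‖ ^ 2 ≤ ‖P ξ‖ ^ 2 :=
      closure_minimal (fun ξ hξ => sum_le_hasSum s (fun i _ => by positivity) (hM ξ hξ))
        hclosed (hmem ξ)
    simp only [hproj] at hP
    exact hP.trans (by gcongr; exact M.topologicalClosure.norm_starProjection_apply_le ξ)
  have hsum : HasSum (fun i => ‖c i (P ξ)‖ ^ 2) (‖P ξ‖ ^ 2) :=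
    closure_minimal hM (isClosed_setOf_hasSum_norm_sq hbound) (hmem ξ)
  simpa only [hproj] using hsum

theorem hasSum_norm_sq_of_mem_span {ι : Type w} {p : Proj N} {c : ι → H →L[ℂ] τ.L2}
    (hc : ∀ i, Intertwines π τ.lmulHom (c i))
    (hsum : ∀ ξ η, HasSum (fun i => inner ℂ (c i (π p.1 ξ)) (c i (π p.1 η)))
      (inner ℂ (π p.1 ξ) (π p.1 η))) {ξ : H}
    (hξ : ξ ∈ Submodule.span ℂ (Set.range fun q : Elem N × H => π q.1 (π p.1 q.2))) :
    HasSum (fun i => ‖c i ξ‖ ^ 2) (‖ξ‖ ^ 2) := by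
  have hinner : ∀ η, HasSum (fun i => inner ℂ (c i ξ) (c i η)) (inner ℂ ξ η) := by
    induction hξ using Submodule.span_induction with
    | mem ξ hξ =>
      obtain ⟨⟨x, ξ⟩, rfl⟩ := hξ
      intro η
      have h := hsum ξ (π (star x) η)
      simp only [← (hc _).inner_map_proj_left p x] at h
      rwa [show inner ℂ (π p.1 ξ) (π p.1 (π (star x) η)) = inner ℂ (π x (π p.1 ξ)) η from
        (Intertwines.one.inner_map_proj_left p x ξ η).symm] at h
    | zero => simp
    | add ξ₁ ξ₂ _ _ h₁ h₂ => intro η; simpa [inner_add_left] using (h₁ η).add (h₂ η)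
    | smul r ξ _ h =>
      intro η
      simpa [inner_smul_left, mul_comm] using (h η).mul_left (starRingEnd ℂ r)
  have h := Complex.hasSum_re (hinner ξ)
  simpa only [← RCLike.re_eq_complex_re, inner_self_eq_norm_sq] using h

theorem hasSum_norm_sq_cyclicProj {ι : Type w} {p : Proj N} {c : ι → H →L[ℂ] τ.L2}
    (hc : ∀ i, Intertwines π τ.lmulHom (c i)) (hc0 : ∀ i, ∀ ξ ∈ (cyclicSpace π p)ᗮ, c i ξ = 0)
    (hsum : ∀ ξ η, HasSum (fun i => inner ℂ (c i (π p.1 ξ)) (c i (π p.1 η)))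
      (inner ℂ (π p.1 ξ) (π p.1 η))) (ξ : H) :
    HasSum (fun i => ‖c i ξ‖ ^ 2) (vectorForm ξ (cyclicProj π p)) := by
  rw [vectorForm_cyclicProj]
  exact hasSum_norm_sq_starProjection (fun ξ hξ => hasSum_norm_sq_of_mem_span hc hsum hξ) hc0 ξ

end TracialWeight

theorem adjoint_comp_self_eq_of_norm_apply_eq {H₁ H₂ H₃ : Type*} [NormedAddCommGroup H₁]
    [InnerProductSpace ℂ H₁] [CompleteSpace H₁] [NormedAddCommGroup H₂] [InnerProductSpace ℂ H₂]
    [CompleteSpace H₂] [NormedAddCommGroup H₃] [InnerProductSpace ℂ H₃] [CompleteSpace H₃]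
    {S : H₁ →L[ℂ] H₂} {T : H₁ →L[ℂ] H₃} (h : ∀ ξ, ‖S ξ‖ = ‖T ξ‖) :
    (ContinuousLinearMap.adjoint S).comp S = (ContinuousLinearMap.adjoint T).comp T := by
  have hform : ∀ ξ, vectorForm ξ ((ContinuousLinearMap.adjoint S).comp S) =
      vectorForm ξ ((ContinuousLinearMap.adjoint T).comp T) := fun ξ => by
    rw [vectorForm_adjoint_comp, vectorForm_adjoint_comp, h]
  have hS := (adjoint_comp_nonneg S).isSelfAdjoint
  have hT := (adjoint_comp_nonneg T).isSelfAdjoint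
  exact le_antisymm (le_of_vectorForm_le hS hT fun ξ => (hform ξ).le)
    (le_of_vectorForm_le hT hS fun ξ => (hform ξ).ge)

namespace TracialWeight

variable {τ : TracialWeight N}

/-! ### Lifting intertwiners from a corner -/

/-- Right multiplication on `{x ∈ N : τ(x*x) < ∞}`. -/
def preRmul (x : Elem N) (a : τ.PreL2) : τ.PreL2 := τ.preJ (τ.preLmul (star x) (τ.preJ a))

@[simp] theorem val_preRmul (x : Elem N) (a : τ.PreL2) :
    PreL2.val τ (preRmul x a) = PreL2.val τ a * x := by
  simp [preRmul]

theorem rmul_vec (x : Elem N) (a : τ.PreL2) : rmul x (τ.vec a) = τ.vec (preRmul x a) := by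
  rw [rmul, conjOp_apply, J_vec, lmul_vec, J_vec]; rfl

theorem commutesLmul_rmul (x : Elem N) : CommutesLmul (rmul (τ := τ) x) := fun y =>
  ContinuousLinearMap.ext fun ξ => (lmul_rmul_comm y x ξ).symm

theorem IsFNS.comTrace_adjoint_rmul_comp_rmul (h : τ.IsFNS) (x : Elem N) :
    comTrace ((ContinuousLinearMap.adjoint (rmul (τ := τ) x)).comp (rmul x)) =
      τ (x * star x) := by
  rw [adjoint_rmul, rmul, rmul, ← conjOp_comp, star_star, comTrace, conjOp_conjOp, ← h.opTrace_lmul]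
  · exact congrArg τ.opTrace (map_mul τ.lmulHom x (star x)).symm
  · exact mul_star_self_nonneg x

theorem exists_intertwiner_vec_eq {x : Elem N} {ζ : H}
    (h : ∀ a, ‖π (PreL2.val τ a) ζ‖ = ‖rmul x (τ.vec a)‖) :
    ∃ T : τ.L2 →L[ℂ] H, Intertwines τ.lmulHom π T ∧ (∀ a, T (τ.vec a) = π (PreL2.val τ a) ζ) ∧
      (ContinuousLinearMap.adjoint T).comp T =
        (ContinuousLinearMap.adjoint (rmul x)).comp (rmul x) := by
  let f : τ.PreL2 →ₗ[ℂ] τ.L2 :=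
    (rmul x).toLinearMap ∘ₗ UniformSpace.Completion.toComplₗᵢ.toLinearMap
  let g : τ.PreL2 →ₗ[ℂ] H :=
    { toFun := fun a => π (PreL2.val τ a) ζ
      map_add' := fun a b => by simp
      map_smul' := fun c a => by simp }
  obtain ⟨S, hS, hSf, -, -⟩ := exists_intertwiner_of_norm_le (π₁ := τ.lmulHom) (π₂ := π) f g
    (fun a => (h a).le) (fun y a => τ.preLmul y a)
    (fun y a => ((lmul_rmul_comm y x (τ.vec a)).trans (congrArg _ (lmul_vec y a))).symm)
    (fun y a => by
      change π (y * PreL2.val τ a) ζ = _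
      rw [map_mul]; rfl)
  refine ⟨S.comp (rmul x), hS.comp (commutesLmul_rmul x), hSf, ?_⟩
  have hnorm : ∀ ξ, ‖S (rmul x ξ)‖ = ‖rmul x ξ‖ :=
    eq_of_eq_vec (by fun_prop) (by fun_prop) fun a => (congrArg norm (hSf a)).trans (h a)
  exact adjoint_comp_self_eq_of_norm_apply_eq hnorm

theorem ofReal_vectorForm_adjoint_unit {b : H →L[ℂ] τ.L2} (hb : Intertwines π τ.lmulHom b)
    {s : Elem N} (hs : star s = s)
    (hsb : τ.lmulHom (s * s) = conjOp (b.comp (ContinuousLinearMap.adjoint b)))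
    {Ω : τ.PreL2} (hΩ : PreL2.val τ Ω = 1) {x : Elem N} (hx : 0 ≤ x) :
    ENNReal.ofReal (vectorForm (ContinuousLinearMap.adjoint b (τ.vec Ω)) (π x)) =
      τ (s * x * s) := by
  have hbb : b.comp (ContinuousLinearMap.adjoint b) =
      (rmul s).comp (ContinuousLinearMap.adjoint (rmul s)) := by
    rw [adjoint_rmul, hs, ← conjOp_conjOp (b.comp _), ← hsb, map_mul, rmul, hs, ← conjOp_comp]; rfl
  have hsΩ : ContinuousLinearMap.adjoint (rmul s) (τ.vec Ω) = τ.vec (τ.preLmul s Ω) := by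
    rw [adjoint_rmul, hs, rmul_vec]
    exact congrArg τ.vec (PreL2.ext (by simp [hΩ]))
  rw [hb.vectorForm_adjoint_apply, hbb,
    ← Intertwines.vectorForm_adjoint_apply (commutesLmul_rmul s), hsΩ,
    ofReal_vectorForm_vec_lmul hx, val_preLmul, hΩ, mul_one, hs]

section Lift

variable {p : Proj N} (hp0 : τ p.1 ≠ 0) (hp : τ p.1 < ∞)

/-- The unit `p` of the corner `pNp`, as an element of finite trace. -/
def cornerUnit : (τ.cornerWeight p).PreL2 :=
  PreL2.mk _ 1 (by rw [star_one, one_mul, cornerWeight_one hp0 hp]; exact ENNReal.one_lt_top)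

@[simp] theorem val_cornerUnit : PreL2.val _ (cornerUnit hp0 hp) = 1 := rfl

theorem inner_vec_proj_conj {x a : τ.PreL2} (hl : p.1 * PreL2.val τ x = PreL2.val τ x)
    (hr : PreL2.val τ x * p.1 = PreL2.val τ x) :
    inner ℂ (τ.vec x) (τ.vec (τ.preLmul p.1 (preRmul p.1 a))) = inner ℂ (τ.vec x) (τ.vec a) := by
  have hx : preRmul p.1 (τ.preLmul p.1 x) = x := PreL2.ext (by simp [hl, hr])
  rw [← lmul_vec, ← rmul_vec]
  nth_rw 1 [← p.star_eq]
  rw [← adjoint_lmul, ContinuousLinearMap.adjoint_inner_right, lmul_vec]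
  nth_rw 2 [← p.star_eq]
  rw [← adjoint_rmul, ContinuousLinearMap.adjoint_inner_right, rmul_vec, hx]

theorem inner_cornerEmbedding {U : (τ.cornerWeight p).L2 →ₗᵢ[ℂ] τ.L2}
    (hU : ∀ x, U (vec _ x) = ((Real.sqrt (τ p.1).toReal)⁻¹ : ℂ) • τ.vec (cornerVec hp0 hp x))
    (β : (τ.cornerWeight p).L2) (a : τ.PreL2) :
    inner ℂ (U β) (τ.vec a) = (Real.sqrt (τ p.1).toReal : ℂ) *
      inner ℂ β ((τ.cornerWeight p).lmul (cornerCompress p (PreL2.val τ a))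
        (vec _ (cornerUnit hp0 hp))) := by
  have ht : (Real.sqrt (τ p.1).toReal : ℂ) ≠ 0 := by
    exact_mod_cast (Real.sqrt_pos.2 (ENNReal.toReal_pos hp0 hp.ne)).ne'
  refine eq_of_eq_vec (f := fun β => inner ℂ (U β) (τ.vec a))
    (g := fun β => (Real.sqrt (τ p.1).toReal : ℂ) *
      inner ℂ β ((τ.cornerWeight p).lmul (cornerCompress p (PreL2.val τ a))
        (vec _ (cornerUnit hp0 hp)))) (by fun_prop) (by fun_prop) (fun x => ?_) β
  have hpap : cornerVec hp0 hp ((τ.cornerWeight p).preLmul (cornerCompress p (PreL2.val τ a))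
      (cornerUnit hp0 hp)) = τ.preLmul p.1 (preRmul p.1 a) :=
    PreL2.ext (by simp [cornerIncl_cornerCompress, mul_assoc])
  rw [← U.inner_map_map, lmul_vec, hU, hU, hpap, inner_smul_right, inner_smul_left,
    inner_smul_left, inner_vec_proj_conj (by simp [proj_mul_cornerIncl])
      (by simp [cornerIncl_mul_proj])]
  simp only [map_inv₀, Complex.conj_ofReal]
  field_simp

variable {b : (p.map π).space →L[ℂ] (τ.cornerWeight p).L2}

theorem norm_map_adjoint_cornerUnit
    (hb : Intertwines (cornerRep π p) (τ.cornerWeight p).lmulHom b) {s : Elem (corner p)}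
    (hs : star s = s)
    (hsb : (τ.cornerWeight p).lmulHom (s * s) =
      conjOp (b.comp (ContinuousLinearMap.adjoint b))) (a : τ.PreL2) :
    ‖π (PreL2.val τ a) ((Real.sqrt (τ p.1).toReal : ℂ) •
      (ContinuousLinearMap.adjoint b (vec _ (cornerUnit hp0 hp)) : H))‖ =
      ‖rmul (cornerIncl p s) (τ.vec a)‖ := by
  set α := PreL2.val τ a
  have hα := cornerCompress_nonneg p (star_mul_self_nonneg α)
  have hform := ofReal_vectorForm_adjoint_unit hb hs hsb (val_cornerUnit hp0 hp) hα
  generalize ContinuousLinearMap.adjoint b (vec _ (cornerUnit hp0 hp)) = ζ at hform ⊢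
  have hζ : π p.1 (ζ : H) = ζ := p.mem_map_space_iff.1 ζ.2
  have hnorm : ‖π α (ζ : H)‖ ^ 2 =
      vectorForm ζ (cornerRep π p (cornerCompress p (star α * α))) := by
    rw [vectorForm_cornerRep, cornerIncl_cornerCompress, ← mul_assoc, mul_assoc _ α, ← p.star_eq,
      ← star_mul, p.star_eq, vectorForm_map_star_mul_self, map_mul, mul_apply_eq_comp, hζ]
  have hconj : cornerIncl p (s * cornerCompress p (star α * α) * s) =
      star (α * cornerIncl p s) * (α * cornerIncl p s) := by
    rw [star_mul, ← cornerIncl_star, hs, cornerIncl_mul, cornerIncl_mul, cornerIncl_cornerCompress]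
    calc _ = (cornerIncl p s * p.1) * (star α * α) * (p.1 * cornerIncl p s) := by
          simp only [mul_assoc]
      _ = _ := by
          rw [cornerIncl_mul_proj, proj_mul_cornerIncl]
          simp only [mul_assoc]
  rw [← sq_eq_sq₀ (norm_nonneg _) (norm_nonneg _), map_smul, norm_smul, mul_pow,
    Complex.norm_real, Real.norm_eq_abs, sq_abs, Real.sq_sqrt ENNReal.toReal_nonneg, hnorm,
    rmul_vec, norm_vec_sq, quad, val_preRmul, ← hconj, ← mul_cornerWeight hp0 hp,
    ENNReal.toReal_mul, ← hform, ENNReal.toReal_ofReal]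
  exact vectorForm_nonneg (map_nonneg _ hα) ζ

theorem exists_lift_adjoint (h : τ.IsFNS)
    (hb : Intertwines (cornerRep π p) (τ.cornerWeight p).lmulHom b) :
    ∃ T : τ.L2 →L[ℂ] H, Intertwines τ.lmulHom π T ∧
      (∀ a, T (τ.vec a) = π (PreL2.val τ a) ((Real.sqrt (τ p.1).toReal : ℂ) •
        (ContinuousLinearMap.adjoint b (vec _ (cornerUnit hp0 hp)) : H))) ∧
      comTrace ((ContinuousLinearMap.adjoint T).comp T) =
        τ p.1 * comTrace (b.comp (ContinuousLinearMap.adjoint b)) := by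
  obtain ⟨y, hy, hyb, htrace⟩ := (h.cornerWeight hp0 hp).exists_comTrace_eq
    (hb.comp hb.adjoint) (comp_adjoint_nonneg b)
  obtain ⟨s, hs, rfl⟩ := Elem.exists_nonneg_mul_self_eq hy
  have hs' := hs.isSelfAdjoint.star_eq
  obtain ⟨T, hT, hTvec, hTT⟩ :=
    exists_intertwiner_vec_eq (norm_map_adjoint_cornerUnit hp0 hp hb hs' hyb)
  refine ⟨T, hT, hTvec, ?_⟩
  rw [hTT, h.comTrace_adjoint_rmul_comp_rmul, ← cornerIncl_star, hs', ← cornerIncl_mul, htrace,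
    mul_cornerWeight hp0 hp]

theorem coe_adjoint_eq_cornerEmbedding
    (hb : Intertwines (cornerRep π p) (τ.cornerWeight p).lmulHom b) {T : τ.L2 →L[ℂ] H}
    (hT : ∀ a, T (τ.vec a) = π (PreL2.val τ a) ((Real.sqrt (τ p.1).toReal : ℂ) •
      (ContinuousLinearMap.adjoint b (vec _ (cornerUnit hp0 hp)) : H)))
    {U : (τ.cornerWeight p).L2 →ₗᵢ[ℂ] τ.L2}
    (hU : ∀ x, U (vec _ x) = ((Real.sqrt (τ p.1).toReal)⁻¹ : ℂ) • τ.vec (cornerVec hp0 hp x))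
    (ξ : (p.map π).space) : ContinuousLinearMap.adjoint T (ξ : H) = U (b ξ) := by
  refine ext_inner_vec fun a => ?_
  rw [ContinuousLinearMap.adjoint_inner_left, hT, map_smul, inner_smul_right,
    inner_cornerEmbedding hp0 hp hU, ← ContinuousLinearMap.adjoint_inner_right, ← lmulHom_apply,
    hb.adjoint.apply, Submodule.coe_inner, coe_cornerRep, cornerIncl_cornerCompress]
  generalize ContinuousLinearMap.adjoint b (vec _ (cornerUnit hp0 hp)) = ζ
  have hζ : π p.1 (ζ : H) = ζ := p.mem_map_space_iff.1 ζ.2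
  have hξ : π p.1 (ξ : H) = ξ := p.mem_map_space_iff.1 ξ.2
  rw [map_mul, map_mul, mul_apply_eq_comp, mul_apply_eq_comp, hζ]
  have hinner := inner_map_apply_left π p.1 (ξ : H) (π (PreL2.val τ a) ζ)
  rw [hξ, p.star_eq] at hinner
  rw [← hinner]

end Lift

theorem exists_lift {p : Proj N} (hp0 : τ p.1 ≠ 0) (hp : τ p.1 < ∞) (h : τ.IsFNS)
    {b : (p.map π).space →L[ℂ] (τ.cornerWeight p).L2}
    (hb : Intertwines (cornerRep π p) (τ.cornerWeight p).lmulHom b) :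
    ∃ c : H →L[ℂ] τ.L2, Intertwines π τ.lmulHom c ∧
      comTrace (c.comp (ContinuousLinearMap.adjoint c)) =
        τ p.1 * comTrace (b.comp (ContinuousLinearMap.adjoint b)) ∧
      (∀ ξ ∈ (cyclicSpace π p)ᗮ, c ξ = 0) ∧
      ∀ ξ η : (p.map π).space, inner ℂ (c ξ) (c η) = inner ℂ (b ξ) (b η) := by
  obtain ⟨T, hT, hTvec, htrace⟩ := exists_lift_adjoint hp0 hp h hb
  obtain ⟨U, hU⟩ := exists_cornerEmbedding hp0 hp
  have hTU := coe_adjoint_eq_cornerEmbedding hp0 hp hb hTvec hU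
  refine ⟨ContinuousLinearMap.adjoint T, hT.adjoint, ?_, fun ξ hξ => ?_, fun ξ η => ?_⟩
  · rw [ContinuousLinearMap.adjoint_adjoint, htrace]
  · refine ext_inner_vec fun a => ?_
    rw [ContinuousLinearMap.adjoint_inner_left, hTvec, map_smul, inner_smul_right]
    generalize ContinuousLinearMap.adjoint b (vec _ (cornerUnit hp0 hp)) = ζ
    rw [← p.mem_map_space_iff.1 ζ.2, (Submodule.mem_orthogonal' _ _).1 hξ _
      (map_map_mem_cyclicSpace p _ _), mul_zero, inner_zero_left]
  · rw [hTU, hTU, U.inner_map_map]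

theorem cyclicProj_eq_zero {p : Proj N} (hp : p.1 = 0) : cyclicProj π p = 0 := by
  have hle : cyclicSpace π p ≤ ⊥ := cyclicSpace_le isClosed_singleton fun x ξ => by simp [hp]
  exact ContinuousLinearMap.ext fun ξ =>
    (Submodule.mem_bot ℂ).1 (hle ((cyclicSpace π p).starProjection_apply_mem ξ))

theorem IsFNS.mul_dim_cornerRep (h : τ.IsFNS) (hπ : IsNormalRep π) {κ : Type*}
    {v : κ → H →L[ℂ] τ.L2} (hv : ∀ j, Intertwines π τ.lmulHom (v j)) (hframe : IsFrame v)
    (p : Proj N) (hp : τ p.1 < ∞) :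
    τ p.1 * (τ.cornerWeight p).dim (cornerRep π p) =
      ∑' j, comTrace ((v j).comp ((cyclicProj π p).comp (ContinuousLinearMap.adjoint (v j)))) := by
  by_cases hp0 : τ p.1 = 0
  · rw [hp0, zero_mul, cyclicProj_eq_zero (h.faithful _ p.nonneg hp0)]
    simp [h.comTrace_zero]
  have hcorner := h.cornerWeight hp0 hp
  obtain ⟨ι, b, hb, hbframe⟩ :=
    exists_isFrame (hπ.cornerRep p) hcorner.isNormalRep hcorner.injective
  choose c hc hctrace hc0 hcb using fun i => exists_lift hp0 hp h (hb i)
  have hsum : ∀ ξ η : H, HasSum (fun i => inner ℂ (c i (π p.1 ξ)) (c i (π p.1 η)))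
      (inner ℂ (π p.1 ξ) (π p.1 η)) := fun ξ η => by
    have hpH := hasSum_inner_of_isFrame hbframe
      (⟨π p.1 ξ, ⟨ξ, rfl⟩⟩ : (p.map π).space) ⟨π p.1 η, ⟨η, rfl⟩⟩
    simp only [← hcb] at hpH
    exact hpH
  rw [hcorner.dim_eq (hπ.cornerRep p) hb hbframe, ← ENNReal.tsum_mul_left,
    ← h.tsum_comTrace_eq hv hframe hc (intertwines_cyclicProj p) (cyclicProj_nonneg p)
      (hasSum_norm_sq_cyclicProj hc hc0 hsum)]
  exact tsum_congr fun i => (hctrace i).symm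

end TracialWeight

end Corners

/-! ### Projections of finite trace -/

section SpectralProjection

variable {H : Type u} [NormedAddCommGroup H] [InnerProductSpace ℂ H]

theorem continuous_vectorForm (T : H →L[ℂ] H) : Continuous fun ξ => vectorForm ξ T := by
  simp only [vectorForm_apply]
  fun_prop

theorem apply_mem_closure_range_of_commute {f t : H →L[ℂ] H} (h : Commute f t) {ξ : H}
    (hξ : ξ ∈ (LinearMap.range (f : H →ₗ[ℂ] H)).topologicalClosure) :
    t ξ ∈ (LinearMap.range (f : H →ₗ[ℂ] H)).topologicalClosure := by
  refine map_mem_closure t.continuous hξ ?_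
  rintro _ ⟨η, rfl⟩
  exact ⟨t η, congrArg (fun S : H →L[ℂ] H => S η) h.eq⟩

variable [CompleteSpace H]

theorem vectorForm_starProjection_apply_le {y : H →L[ℂ] H} (hy : 0 ≤ y) {K : Submodule ℂ H}
    [K.HasOrthogonalProjection] (hK : ∀ ξ ∈ K, y ξ ∈ K) (ξ : H) :
    vectorForm (K.starProjection ξ) y ≤ vectorForm ξ y := by
  obtain ⟨k, hk, k', hk', rfl⟩ := K.exists_add_mem_mem_orthogonal ξ
  have hyk : inner ℂ (y k) k' = 0 := hk' _ (hK k hk)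
  have hyk' : inner ℂ (y k') k = 0 := by
    rw [← ContinuousLinearMap.adjoint_inner_right, ← ContinuousLinearMap.star_eq_adjoint,
      hy.isSelfAdjoint.star_eq]
    exact (Submodule.mem_orthogonal' _ _).1 hk' _ (hK k hk)
  have hpos := vectorForm_nonneg hy k'
  rw [map_add, Submodule.starProjection_eq_self_iff.2 hk,
    (Submodule.starProjection_apply_eq_zero_iff K).2 hk', add_zero]
  simp only [vectorForm_apply, map_add, inner_add_left, inner_add_right, hyk, hyk',
    Complex.add_re, Complex.zero_re] at hpos ⊢
  linarith

theorem isSelfAdjoint_sub_smul_one {y : H →L[ℂ] H} (hy : IsSelfAdjoint y) (ε : ℝ) :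
    IsSelfAdjoint (y - (ε : ℂ) • (1 : H →L[ℂ] H)) :=
  hy.sub (.smul (Complex.conj_ofReal ε) (.one _))

theorem posPart_sub_smul_one_ne_zero {y : H →L[ℂ] H} (hy : 0 ≤ y) {ε : ℝ} (hε : 0 ≤ ε)
    (hlt : ε < ‖y‖) : (y - (ε : ℂ) • (1 : H →L[ℂ] H))⁺ ≠ 0 := fun h => by
  rw [CFC.posPart_eq_zero_iff _ (isSelfAdjoint_sub_smul_one hy.isSelfAdjoint ε), sub_nonpos] at h
  refine hlt.not_ge ((CStarAlgebra.norm_le_norm_of_nonneg_of_le hy h).trans ?_)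
  rw [norm_smul, Complex.norm_real, Real.norm_of_nonneg hε]
  exact mul_le_of_le_one_right hε ContinuousLinearMap.norm_id_le

theorem mul_norm_sq_le_vectorForm_of_mem_closure_range_posPart {y : H →L[ℂ] H}
    (hy : IsSelfAdjoint y) (ε : ℝ) {k : H} (hk : k ∈ (LinearMap.range
      (((y - (ε : ℂ) • (1 : H →L[ℂ] H))⁺ : H →L[ℂ] H) : H →ₗ[ℂ] H)).topologicalClosure) :
    ε * ‖k‖ ^ 2 ≤ vectorForm k y := by
  have hsa := isSelfAdjoint_sub_smul_one hy ε
  refine closure_minimal (t := {k | ε * ‖k‖ ^ 2 ≤ vectorForm k y}) ?_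
    (isClosed_le (by fun_prop) (continuous_vectorForm y)) hk
  rintro _ ⟨η, rfl⟩
  set a := y - (ε : ℂ) • (1 : H →L[ℂ] H) with ha
  have hmul : a * a⁺ = a⁺ * a⁺ := by
    nth_rw 1 [← CFC.posPart_sub_negPart a hsa]
    rw [sub_mul, CFC.negPart_mul_posPart, sub_zero]
  have hform : vectorForm (a⁺ η) a = vectorForm (a⁺ η) a⁺ := by
    rw [vectorForm_apply, vectorForm_apply, ← mul_apply_eq_comp, hmul, mul_apply_eq_comp]
  have hpos : 0 ≤ vectorForm (a⁺ η) a := hform ▸ vectorForm_nonneg (CFC.posPart_nonneg a) _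
  rw [ha, map_sub, vectorForm_complex_smul, vectorForm_one] at hpos
  exact sub_nonneg.1 hpos

theorem vectorForm_starProjection (K : Submodule ℂ H) [K.HasOrthogonalProjection] (ξ : H) :
    vectorForm ξ K.starProjection = ‖K.starProjection ξ‖ ^ 2 := by
  have hK := isStarProjection_starProjection (U := K)
  rw [← vectorForm_star_mul_self, hK.isSelfAdjoint.star_eq, hK.isIdempotentElem.eq]

/-- The witness is the projection onto the closed range of `(y - ε)⁺` with `ε = ‖y‖ / 2`. -/
theorem exists_isStarProjection_smul_le {y : H →L[ℂ] H} (hy : 0 ≤ y) (hy0 : y ≠ 0) :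
    ∃ e : H →L[ℂ] H, IsStarProjection e ∧ e ≠ 0 ∧
      (∃ ε : ℝ, 0 < ε ∧ ∀ ξ, ε * vectorForm ξ e ≤ vectorForm ξ y) ∧
      ∀ t, Commute y t → ∀ ξ, t (e ξ) ∈ e.range := by
  have hε : 0 < ‖y‖ / 2 := half_pos (norm_pos_iff.2 hy0)
  set ε := ‖y‖ / 2
  set f := (y - (ε : ℂ) • (1 : H →L[ℂ] H))⁺ with hf
  have hf0 : f ≠ 0 := posPart_sub_smul_one_ne_zero hy hε.le (half_lt_self (norm_pos_iff.2 hy0))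
  have hfcomm : ∀ t, Commute y t → Commute f t := fun t ht => by
    rw [hf, CFC.posPart_def]
    exact .cfcₙ_real (ht.sub_left ((Commute.one_left t).smul_left _)) _
  set K := (LinearMap.range (f : H →ₗ[ℂ] H)).topologicalClosure
  have : CompleteSpace K := (Submodule.isClosed_topologicalClosure _).completeSpace_coe
  refine ⟨K.starProjection, isStarProjection_starProjection, fun h => hf0 ?_,
    ⟨ε, hε, fun ξ => ?_⟩, fun t ht ξ => ?_⟩
  · ext ξ
    rw [← Submodule.starProjection_eq_self_iff.2
      (show f ξ ∈ K from Submodule.le_topologicalClosure _ ⟨ξ, rfl⟩), h]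
    rfl
  · rw [vectorForm_starProjection]
    exact (mul_norm_sq_le_vectorForm_of_mem_closure_range_posPart hy.isSelfAdjoint ε
      (K.starProjection_apply_mem ξ)).trans (vectorForm_starProjection_apply_le hy
        (fun _ => apply_mem_closure_range_of_commute (hfcomm y (.refl y))) ξ)
  · rw [Submodule.range_starProjection]
    exact apply_mem_closure_range_of_commute (hfcomm t ht) (K.starProjection_apply_mem ξ)

end SpectralProjection

section Projection

variable {H₀ : Type u₀} [NormedAddCommGroup H₀] [InnerProductSpace ℂ H₀] [CompleteSpace H₀]
  {N : VonNeumannAlgebra H₀}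

theorem Elem.exists_proj_le_smul {y : Elem N} (hy : 0 ≤ y) (hy0 : y ≠ 0) :
    ∃ e : Proj N, e.1 ≠ 0 ∧ ∃ C : ℝ≥0, e.1 ≤ ((C : ℝ) : ℂ) • y := by
  obtain ⟨e, he, he0, ⟨ε, hε, hle⟩, hinv⟩ :=
    exists_isStarProjection_smul_le (y := (y : H₀ →L[ℂ] H₀)) hy fun h => hy0 (Subtype.ext h)
  have hmem : e ∈ N := by
    rw [VonNeumannAlgebra.IsStarProjection.mem_iff he N]
    rintro t ht _ ⟨ξ, rfl⟩
    exact hinv t (VonNeumannAlgebra.mem_commutant_iff.1 ht _ y.2) ξ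
  refine ⟨⟨⟨e, hmem⟩, ⟨Subtype.ext he.isIdempotentElem, Subtype.ext he.isSelfAdjoint⟩⟩,
    fun h => he0 (congrArg Subtype.val h), ⟨ε⁻¹, by positivity⟩, ?_⟩
  refine le_of_vectorForm_le he.isSelfAdjoint
    (.of_nonneg (show (0 : H₀ →L[ℂ] H₀) ≤ ((ε⁻¹ : ℝ) : ℂ) • y.1 from
      smul_nonneg' ⟨ε⁻¹, by positivity⟩ hy)) fun ξ => ?_
  change vectorForm ξ e ≤ vectorForm ξ (((ε⁻¹ : ℝ) : ℂ) • y.1)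
  rw [vectorForm_complex_smul, ← div_eq_inv_mul, le_div_iff₀ hε, mul_comm]
  exact hle ξ

theorem Proj.mul_eq_zero_of_le_smul {e p : Proj N} {y : Elem N} {C : ℝ≥0}
    (he : e.1 ≤ ((C : ℝ) : ℂ) • y) (hy : 0 ≤ y) (hyp : y ≤ 1 - p.1) : p.1 * e.1 = 0 := by
  have hpyp : star p.1 * y * p.1 = 0 := by
    refine le_antisymm ((star_left_conjugate_le_conjugate hyp p.1).trans_eq ?_)
      (star_left_conjugate_nonneg hy p.1)
    rw [mul_assoc, p.2.one_sub_mul_self, mul_zero]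
  have hpep : star (e.1 * p.1) * (e.1 * p.1) = 0 := by
    rw [star_mul, e.star_eq, mul_assoc, ← mul_assoc e.1, e.mul_self, ← mul_assoc]
    refine le_antisymm ((star_left_conjugate_le_conjugate he p.1).trans_eq ?_)
      (star_left_conjugate_nonneg e.nonneg p.1)
    rw [mul_smul_comm, smul_mul_assoc, hpyp, smul_zero]
  have hep : e.1 * p.1 = 0 := Subtype.ext
    ((CStarRing.star_mul_self_eq_zero_iff (e.1 * p.1).1).1 (congrArg Subtype.val hpep))
  rw [← p.star_eq, ← e.star_eq, ← star_mul, hep, star_zero]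

theorem Proj.mul_comm_eq_zero {p q : Proj N} (h : p.1 * q.1 = 0) : q.1 * p.1 = 0 := by
  rw [← p.star_eq, ← q.star_eq, ← star_mul, h, star_zero]

theorem Proj.mul_eq_right_of_le {p q : Proj N} (h : p.1 ≤ q.1) : q.1 * p.1 = p.1 :=
  Subtype.ext ((IsStarProjection.le_iff_mul_eq_right p.op.2 q.op.2).1 h)

theorem Proj.le_one (p : Proj N) : p.1 ≤ 1 := sub_nonneg.1 p.2.one_sub.nonneg

/-- The sum of finitely many pairwise orthogonal projections. -/
def Proj.sum {ι : Type*} {p : ι → Proj N} (hp : Pairwise fun i j => (p i).1 * (p j).1 = 0)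
    (s : Finset ι) : Proj N :=
  ⟨∑ i ∈ s, (p i).1,
    OrthogonalIdempotents.isIdempotentElem_sum ⟨fun i => (p i).mul_self, hp⟩,
    isSelfAdjoint_sum _ fun i _ => (p i).2.isSelfAdjoint⟩

theorem Proj.sum_mono {ι : Type*} {p : ι → Proj N}
    (hp : Pairwise fun i j => (p i).1 * (p j).1 = 0) : Monotone fun s => (Proj.sum hp s).1 :=
  fun _ _ hst => Finset.sum_le_sum_of_subset_of_nonneg hst fun i _ _ => (p i).nonneg

theorem Proj.isLUB_sum_of_maximal {ι : Type*} {p : ι → Proj N}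
    (hp : Pairwise fun i j => (p i).1 * (p j).1 = 0)
    (hmax : ∀ y : Elem N, 0 ≤ y → (∀ i, y ≤ 1 - (p i).1) → y = 0) :
    IsLUB (Set.range fun s => (Proj.sum hp s).1) 1 := by
  have hle : ∀ d ∈ Set.range fun s => (Proj.sum hp s).1, d ≤ 1 :=
    Set.forall_mem_range.2 fun s => (Proj.sum hp s).le_one
  obtain ⟨x, -, hx⟩ := Elem.exists_isLUB
    (Set.forall_mem_range.2 fun s => (Proj.sum hp s).nonneg) (Set.range_nonempty _)
    (Proj.sum_mono hp).directed_le.directedOn_range ⟨1, hle⟩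
  have hpx : ∀ i, (p i).1 ≤ x := fun i => hx.1 ⟨{i}, Finset.sum_singleton _ _⟩
  rwa [sub_eq_zero.1 (hmax (1 - x) (sub_nonneg.2 (hx.2 hle)) fun i => sub_le_sub_left (hpx i) 1)]

end Projection

section CentralSupport

variable {H₀ : Type u₀} [NormedAddCommGroup H₀] [InnerProductSpace ℂ H₀] [CompleteSpace H₀]
  {N : VonNeumannAlgebra H₀}
  {H : Type u} [NormedAddCommGroup H] [InnerProductSpace ℂ H] [CompleteSpace H]
  {π : Elem N →⋆ₐ[ℂ] (H →L[ℂ] H)}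

theorem cyclicProj_mono {p q : Proj N} (h : p.1 ≤ q.1) : cyclicProj π p ≤ cyclicProj π q := by
  refine Submodule.starProjection_le_starProjection_iff.2
    (cyclicSpace_le (Submodule.isClosed_topologicalClosure _) fun x ξ => ?_)
  rw [← Proj.mul_eq_right_of_le h, map_mul, mul_apply_eq_comp]
  exact map_map_mem_cyclicSpace q x _

theorem cyclicProj_le_one (p : Proj N) : cyclicProj π p ≤ 1 :=
  isStarProjection_starProjection.le_one

theorem map_le_cyclicProj (p : Proj N) : π p.1 ≤ cyclicProj π p := by
  refine (IsStarProjection.le_iff_mul_eq_right (p.map π).2 isStarProjection_starProjection).2 ?_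
  ext ξ
  have hmem := map_map_mem_cyclicSpace (π := π) p 1 ξ
  rw [map_one] at hmem
  exact Submodule.starProjection_eq_self_iff.2 hmem

theorem isLUB_vectorForm_cyclicProj (hπ : IsNormalRep π) {α : Type*} [Preorder α]
    [IsDirectedOrder α] [Nonempty α] {P : α → Proj N} (hmono : Monotone fun i => (P i).1)
    (hP : IsLUB (Set.range fun i => (P i).1) 1) (ξ : H) :
    IsLUB (Set.range fun i => vectorForm ξ (cyclicProj π (P i))) (vectorForm ξ 1) := by
  have hlub := isNormalRep_iff_isLUB_vectorForm.1 hπ _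
    (Set.forall_mem_range.2 fun i => (P i).nonneg) (Set.range_nonempty _)
    hmono.directed_le.directedOn_range 1 hP ξ
  rw [map_one] at hlub
  refine ⟨Set.forall_mem_range.2 fun i => vectorForm_mono ξ (cyclicProj_le_one _),
    fun b hb => hlub.2 ?_⟩
  rintro _ ⟨_, ⟨i, rfl⟩, rfl⟩
  exact (vectorForm_mono ξ (map_le_cyclicProj (P i))).trans (hb ⟨i, rfl⟩)

end CentralSupport

namespace TracialWeight

variable {H₀ : Type u₀} [NormedAddCommGroup H₀] [InnerProductSpace ℂ H₀] [CompleteSpace H₀]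
  {N : VonNeumannAlgebra H₀} {τ : TracialWeight N}

theorem proj_sum_lt_top {ι : Type*} {p : ι → Proj N}
    (hp : Pairwise fun i j => (p i).1 * (p j).1 = 0) (hτ : ∀ i, τ (p i).1 < ∞) (s : Finset ι) :
    τ (Proj.sum hp s).1 < ∞ := by
  classical
  change τ (∑ i ∈ s, (p i).1) < ∞
  induction s using Finset.induction_on with
  | empty =>
    have hzero := τ.smul_of_nonneg 0 0 le_rfl
    rw [smul_zero, ENNReal.coe_zero, zero_mul] at hzero
    rw [Finset.sum_empty, hzero]
    exact ENNReal.zero_lt_top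
  | insert i s hi ih =>
    rw [Finset.sum_insert hi,
      τ.add_of_nonneg _ _ (p i).nonneg (Finset.sum_nonneg fun i _ => (p i).nonneg)]
    exact ENNReal.add_lt_top.2 ⟨hτ i, ih⟩

theorem exists_maximal_orthogonal (τ : TracialWeight N) :
    ∃ A : Set (Proj N), (∀ p ∈ A, τ p.1 < ∞) ∧ A.Pairwise (fun p q => p.1 * q.1 = 0) ∧
      ∀ q : Proj N, τ q.1 < ∞ → (∀ p ∈ A, p.1 * q.1 = 0) → q.1 = 0 := by
  obtain ⟨A, hA⟩ := zorn_subset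
    {A : Set (Proj N) | (∀ p ∈ A, τ p.1 < ∞) ∧ A.Pairwise fun p q => p.1 * q.1 = 0}
    fun c hc hchain => ⟨⋃₀ c, ⟨fun p ⟨B, hB, hp⟩ => (hc hB).1 p hp,
      (Set.pairwise_sUnion hchain.directedOn).2 fun B hB => (hc hB).2⟩,
      fun B hB => Set.subset_sUnion_of_mem hB⟩
  refine ⟨A, hA.prop.1, hA.prop.2, fun q hq hort => ?_⟩
  have hins : insert q A ⊆ A := hA.le_of_ge (y := insert q A)
    ⟨Set.forall_mem_insert.2 ⟨hq, hA.prop.1⟩, hA.prop.2.insert fun p hp _ =>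
      ⟨Proj.mul_comm_eq_zero (hort p hp), hort p hp⟩⟩ (Set.subset_insert q A)
  rw [← q.mul_self]
  exact hort q (hins (Set.mem_insert q A))

theorem IsFNS.exists_monotone_proj (h : τ.IsFNS) :
    ∃ (α : Type u₀) (_ : SemilatticeSup α) (_ : Nonempty α) (P : α → Proj N),
      (∀ i, τ (P i).1 < ∞) ∧ (Monotone fun i => (P i).1) ∧
      IsLUB (Set.range fun i => (P i).1) 1 := by
  classical
  obtain ⟨A, hAτ, hA, hmax⟩ := τ.exists_maximal_orthogonal
  have hp : Pairwise fun p q : A => p.1.1 * q.1.1 = 0 :=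
    fun p q hne => hA p.2 q.2 (Subtype.coe_ne_coe.2 hne)
  refine ⟨Finset A, inferInstance, inferInstance, Proj.sum hp,
    proj_sum_lt_top hp fun p => hAτ p.1 p.2, Proj.sum_mono hp, Proj.isLUB_sum_of_maximal hp ?_⟩
  intro x hx hxp
  by_contra hx0
  obtain ⟨y, hy, hyx, hy0, hyτ⟩ := h.semifinite x hx hx0
  obtain ⟨e, he0, C, heC⟩ := Elem.exists_proj_le_smul hy hy0
  refine he0 (hmax e ?_ fun p hp => Proj.mul_eq_zero_of_le_smul heC hy (hyx.trans (hxp ⟨p, hp⟩)))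
  refine (τ.mono e.nonneg heC).trans_lt ?_
  rw [τ.smul_of_nonneg _ _ hy]
  exact ENNReal.mul_lt_top ENNReal.coe_lt_top hyτ

variable {H : Type u} [NormedAddCommGroup H] [InnerProductSpace ℂ H] [CompleteSpace H]
  {π : Elem N →⋆ₐ[ℂ] (H →L[ℂ] H)}

/-! ### Petersen's dimension -/

/-- The trace of `v Z v*`, for `Z` commuting with a module and an intertwiner `v` of the module
into `L²(N,τ)`. Summed over a frame `(v_j)` it is a weight on the commutant of the module. -/
def conjTrace (v : H →L[ℂ] τ.L2) (Z : H →L[ℂ] H) : ℝ≥0∞ :=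
  comTrace (v.comp (Z.comp (ContinuousLinearMap.adjoint v)))

theorem conjTrace_one (v : H →L[ℂ] τ.L2) :
    conjTrace v 1 = comTrace (v.comp (ContinuousLinearMap.adjoint v)) := by
  rw [conjTrace, ContinuousLinearMap.one_def, ContinuousLinearMap.id_comp]

theorem conj_adjoint_mono (v : H →L[ℂ] τ.L2) {Z Z' : H →L[ℂ] H} (hle : Z ≤ Z') :
    v.comp (Z.comp (ContinuousLinearMap.adjoint v)) ≤
      v.comp (Z'.comp (ContinuousLinearMap.adjoint v)) := by
  rw [← sub_nonneg, ← ContinuousLinearMap.comp_sub, ← ContinuousLinearMap.sub_comp]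
  exact conj_adjoint_nonneg v (sub_nonneg.2 hle)

theorem commutesLmul_conj_adjoint {v : H →L[ℂ] τ.L2} (hv : Intertwines π τ.lmulHom v)
    {Z : H →L[ℂ] H} (hZ : Intertwines π π Z) :
    CommutesLmul (v.comp (Z.comp (ContinuousLinearMap.adjoint v))) :=
  hv.comp (hZ.comp hv.adjoint)

theorem IsFNS.conjTrace_mono (h : τ.IsFNS) {v : H →L[ℂ] τ.L2} (hv : Intertwines π τ.lmulHom v)
    {Z Z' : H →L[ℂ] H} (hZ : Intertwines π π Z) (hZ' : Intertwines π π Z') (hZ0 : 0 ≤ Z)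
    (hle : Z ≤ Z') : conjTrace v Z ≤ conjTrace v Z' :=
  h.comTrace_mono (commutesLmul_conj_adjoint hv hZ) (conj_adjoint_nonneg v hZ0)
    (commutesLmul_conj_adjoint hv hZ') (conj_adjoint_mono v hle)

theorem IsFNS.conjTrace_iSup (h : τ.IsFNS) {v : H →L[ℂ] τ.L2} (hv : Intertwines π τ.lmulHom v)
    {α : Type*} [Preorder α] [IsDirectedOrder α] [Nonempty α] {Z : α → H →L[ℂ] H}
    {Z' : H →L[ℂ] H} (hmono : Monotone Z) (hZ : ∀ i, Intertwines π π (Z i)) (hZ0 : ∀ i, 0 ≤ Z i)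
    (hZ' : Intertwines π π Z') (hZ0' : 0 ≤ Z')
    (hlub : ∀ ξ, IsLUB (Set.range fun i => vectorForm ξ (Z i)) (vectorForm ξ Z')) :
    conjTrace v Z' = ⨆ i, conjTrace v (Z i) :=
  h.comTrace_iSup (T := fun i => v.comp ((Z i).comp (ContinuousLinearMap.adjoint v)))
    (fun _ _ hik => conj_adjoint_mono v (hmono hik))
    (fun i => commutesLmul_conj_adjoint hv (hZ i)) (fun i => conj_adjoint_nonneg v (hZ0 i))
    (commutesLmul_conj_adjoint hv hZ') (conj_adjoint_nonneg v hZ0') fun ξ => by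
      simp only [vectorForm_conj_adjoint]
      exact hlub _

theorem IsFNS.mul_dim_cornerRep_le_dim (h : τ.IsFNS) (hπ : IsNormalRep π) (p : Proj N)
    (hp : τ p.1 < ∞) : τ p.1 * (τ.cornerWeight p).dim (cornerRep π p) ≤ τ.dim π := by
  obtain ⟨ι, v, hv, hframe⟩ := exists_isFrame hπ h.isNormalRep h.injective
  rw [h.mul_dim_cornerRep hπ hv hframe p hp, h.dim_eq hπ hv hframe]
  refine ENNReal.tsum_le_tsum fun j => ?_
  rw [← conjTrace_one]
  exact h.conjTrace_mono (hv j) (intertwines_cyclicProj p) .one (cyclicProj_nonneg p)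
    (cyclicProj_le_one p)

theorem IsFNS.dim_eq_iSup_mul_dim_cornerRep (h : τ.IsFNS) (hπ : IsNormalRep π) {α : Type*}
    [Preorder α] [IsDirectedOrder α] [Nonempty α] {P : α → Proj N} (hPτ : ∀ i, τ (P i).1 < ∞)
    (hmono : Monotone fun i => (P i).1) (hP : IsLUB (Set.range fun i => (P i).1) 1) :
    τ.dim π = ⨆ i, τ (P i).1 * (τ.cornerWeight (P i)).dim (cornerRep π (P i)) := by
  obtain ⟨ι, v, hv, hframe⟩ := exists_isFrame hπ h.isNormalRep h.injective
  have hZ : ∀ i, Intertwines π π (cyclicProj π (P i)) := fun i => intertwines_cyclicProj (P i)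
  have hZ0 : ∀ i, 0 ≤ cyclicProj π (P i) := fun i => cyclicProj_nonneg (P i)
  have hZmono : Monotone fun i => cyclicProj π (P i) := fun i k hik => cyclicProj_mono (hmono hik)
  have hsup : ∀ j, conjTrace (v j) 1 = ⨆ i, conjTrace (v j) (cyclicProj π (P i)) := fun j =>
    h.conjTrace_iSup (hv j) hZmono hZ hZ0 .one zero_le_one (isLUB_vectorForm_cyclicProj hπ hmono hP)
  calc τ.dim π = ∑' j, conjTrace (v j) 1 := by
        simp only [conjTrace_one]
        exact h.dim_eq hπ hv hframe
    _ = ⨆ s : Finset ι, ⨆ i, ∑ j ∈ s, conjTrace (v j) (cyclicProj π (P i)) := by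
        simp only [ENNReal.tsum_eq_iSup_sum, hsup]
        exact iSup_congr fun s => ENNReal.finsetSum_iSup_of_monotone fun j i k hik =>
          h.conjTrace_mono (hv j) (hZ i) (hZ k) (hZ0 i) (hZmono hik)
    _ = ⨆ i, ∑' j, conjTrace (v j) (cyclicProj π (P i)) := by
        simp only [ENNReal.tsum_eq_iSup_sum]
        exact iSup_comm
    _ = _ := iSup_congr fun i => (h.mul_dim_cornerRep hπ hv hframe (P i) (hPτ i)).symm

theorem IsFNS.petersenDim_eq_dim (h : τ.IsFNS) (hπ : IsNormalRep π) :
    τ.petersenDim π = τ.dim π := by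
  refine le_antisymm (iSup₂_le fun p hp => h.mul_dim_cornerRep_le_dim hπ p hp) ?_
  obtain ⟨α, _, _, P, hPτ, hmono, hP⟩ := h.exists_monotone_proj
  rw [h.dim_eq_iSup_mul_dim_cornerRep hπ hPτ hmono hP]
  exact iSup_le fun i => le_iSup₂ (f := fun p (_ : τ p.1 < ∞) =>
    τ p.1 * (τ.cornerWeight p).dim (cornerRep π p)) (P i) (hPτ i)

end TracialWeight

end VNDim

end

theorem mainTheorem12
    {H₀ : Type u₀} [NormedAddCommGroup H₀] [InnerProductSpace ℂ H₀] [CompleteSpace H₀]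
    (N : VonNeumannAlgebra H₀) (τ : VNDim.TracialWeight N)
    (hfaithful : τ.IsFaithful) (hnormal : τ.IsNormal) (hsemifinite : τ.IsSemifinite)
    {H : Type u} [NormedAddCommGroup H] [InnerProductSpace ℂ H] [CompleteSpace H]
    (π : VNDim.Elem N →⋆ₐ[ℂ] (H →L[ℂ] H)) (hπ : VNDim.IsNormalRep π) :
    (∃ (ι : Type u) (v : H →ₗᵢ[ℂ] τ.Amp ι), τ.IsStandardIntertwiner π v) ∧
    (∀ (ι : Type w) (v : H →ₗᵢ[ℂ] τ.Amp ι), τ.IsStandardIntertwiner π v →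
      τ.MemTensor (τ.conjRangeProj v) ∧
      τ.dim π = τ.tensorTrace (τ.conjRangeProj v)) ∧
    τ.petersenDim π = τ.dim π := by
  have h : τ.IsFNS := ⟨hfaithful, hnormal, hsemifinite⟩
  exact ⟨h.exists_isStandardIntertwiner hπ,
    fun _ _ hv => ⟨h.memTensor_conjRangeProj hv, h.dim_eq_tensorTrace hπ hv⟩,
    h.petersenDim_eq_dim hπ⟩
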